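/- Let $n\in\{2,3\}$, $m=n-1$, $\gamma>1$, $1<\lambda<1+\frac n2$, and consider an ideal polytropic gas, $p(\rho,e)=(\gamma-1)\rho e$. **Similarity shock solutions.** Put $D=(1+V)^2-C^2$, $G=C^2\big[nV+\frac{2(\lambda-1)}{\gamma}\big]-V(1+V)(\lambda+V)$ and $$F=C\Big\{C^2\Big[1+\tfrac{\lambda-1}{\gamma(1+V)}\Big]-\Big[1+\tfrac{(n-1)(\gamma-1)}2\Big](1+V)^2+\tfrac{(n-1)(\gamma-1)+(\gamma-3)(\lambda-1)}{2}(1+V)-\tfrac{(\gamma-1)(\lambda-1)}2\Big\}.$$ Let $B>0$. A triple of functions $(R,V,C)$ of $x\in\mathbb R$ is a complete similarity shock solution if: * $R=1$, $V=C=0$ for $x<-1$ (quiescent state of zero pressure); * as $x\downarrow-1$: $V\to-\frac{2}{\gamma+1}$, $C\to\frac{\sqrt{2\gamma(\gamma-1)}}{\gamma+1}$, $R\to\frac{\gamma+1}{\gamma-1}$ (state behind the converging shock $x=-1$); * $R,V,C$ are $C^1$ on $(-1,B)\cup(B,\infty)$ and satisfy there $V'=-\frac1{\lambda x}\frac GD$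 and $C'=-\frac1{\lambda x}\frac FD$ at all points with $x\ne0$, $D\neq 0$, and $x(1+V)R'+xRV'=\frac n\lambda RV$ at all points; the points where $D=0$ do not fill an interval; * at $x=B$ the one-sided limits $(V_-,C_-,R_-)$ and $(V_+,C_+,R_+)$ from the left and right exist and satisfy the Rankine–Hugoniot relations $1+V_+=\frac{\gamma-1}{\gamma+1}(1+V_-)+\frac{2C_-^2}{(\gamma+1)(1+V_-)}$, $C_+^2=C_-^2+\frac{\gamma-1}2[(1+V_-)^2-(1+V_+)^2]$, $R_+(1+V_+)=R_-(1+V_-)$ and the entropy condition $C_-^2<(1+V_-)^2$ (reflected shock). **Flow.** Assume in addition: * (P1) $1+V$ is bounded above and bounded below by a positive constant on $\mathbb R$; * (P2) $V(x)/x\to\ell$ and $C(x)/x\to L$ as $x\to0$, with $-\infty<L<0<\ell<\infty$; * (P3) $(V(x),C(x))\to\big(-\frac{2(\lambda-1)}{n\gamma},-\infty\big)$ as $x\to\infty$. With $x=t/r^\lambda$, set $$\rho(t,r)=R(x),\quad u(t,r)=-\frac{r^{1-\lambda}}\lambda\frac{V(x)}x,\quad c(t,r)=-\frac{r^{1-\lambda}}\lambda\frac{C(x)}x,\quad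 e=\frac{c^2}{\gamma(\gamma-1)}$$ for $t\in\mathbb R$, $r>0$, where at $t=0$ the quotients $V(x)/x$, $C(x)/x$ are replaced by $\ell$, $L$. **Theorem.** (a) $(\rho,u,e)$ is a radial weak solution of the Euler system, that is: $\rho,u,e$ are measurable; $\rho>0$ and $e\ge0$ a.e.; the maps $t\mapsto\rho,\ \rho u,\ \rho(e+\frac{u^2}2)$ belong to $C(\mathbb R;L^1_{loc}([0,\infty),r^mdr))$; $\rho u^2$, $p$ and $[\rho(e+\frac{u^2}2)+p]u$ belong to $L^1_{loc}(\mathbb R\times[0,\infty),dt\times r^mdr)$; and $$\int_{\mathbb R}\int_0^\infty(\rho\psi_t+\rho u\psi_r)\,r^mdr\,dt=0,\qquad \int_{\mathbb R}\int_0^\infty\Big(\rho\big(e+\tfrac{u^2}2\big)\psi_t+\big[\rho\big(e+\tfrac{u^2}2\big)+p\big]u\psi_r\Big)r^mdr\,dt=0$$ for all $\psi\in C^1_c(\mathbb R\times[0,\infty))$ (functions $C^1$ up to $r=0$, vanishing outside some $[-T,T]\times[0,A]$), and $$\int_{\mathbb R}\int_0^\infty\Big(\rho u\psi_t+\rho u^2\psi_r+p\big(\psi_r+\tfrac{m\psi}r\big)\Big)r^mdr\,dt=0$$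 for all such $\psi$ with in addition $\psi(t,0)\equiv0$, all integrands being integrable. (b) The fields $\rho(t,|z|)$, $\vec u(t,z)=u(t,|z|)\frac z{|z|}$, $e(t,|z|)$ on $\mathbb R\times\mathbb R^n$ form a weak solution of the multi-dimensional Euler system: they are measurable; $\rho>0$, $e\ge0$ a.e.; $\rho$, $\rho\vec u$, $\rho(e+\frac{|\vec u|^2}2)$ belong to $C(\mathbb R;L^1_{loc}(\mathbb R^n))$; $\rho|\vec u|^2$, $p$, $[\rho(e+\frac{|\vec u|^2}2)+p]\vec u$ belong to $L^1_{loc}(\mathbb R\times\mathbb R^n)$; and for all $\varphi\in C^1_c(\mathbb R\times\mathbb R^n)$ and $1\le i\le n$, with all integrands integrable, $$\int\!\!\int\rho\varphi_t+\rho\vec u\cdot\nabla\varphi\,dz\,dt=0,\qquad\int\!\!\int\rho u_i\varphi_t+\rho u_i\vec u\cdot\nabla\varphi+p\varphi_{z_i}\,dz\,dt=0,$$ $$\int\!\!\int\rho\big(e+\tfrac{|\vec u|^2}2\big)\varphi_t+\big[\rho\big(e+\tfrac{|\vec u|^2}2\big)+p\big]\vec u\cdot\nabla\varphi\,dz\,dt=0.$$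 (c) The amplitudes are unbounded: each of $|\vec u|$, $e$, $p$ tends to $+\infty$ as $z\to0$ at time $t=0$, and is essentially unbounded in every space-time neighbourhood of $(t,z)=(0,0)$. -/

import Mathlib

open MeasureTheory Filter Set
open scoped Topology

/-! ### Radial weak solutions of the compressible Euler system -/

/-- The ideal polytropic pressure law `p = (γ - 1) ρ e`. -/
def idealPressure (γ : ℝ) (ρ e : ℝ) : ℝ := (γ - 1) * ρ * e

/-- The test functions `C¹_c(ℝ × [0,∞))`: functions that are `C¹` on `ℝ × [0,∞)` (up to the
boundary `r = 0`) and vanish outside some `[-T,T] × [0,A]`.  The values of `ψ` at `r < 0` play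
no role. -/
def IsRadialTest (ψ : ℝ × ℝ → ℝ) : Prop :=
  ContDiffOn ℝ 1 ψ (univ ×ˢ Ici (0 : ℝ)) ∧
    ∃ T A : ℝ, 0 < T ∧ 0 < A ∧ ∀ t r : ℝ, 0 ≤ r → (T < |t| ∨ A < r) → ψ (t, r) = 0

/-- The test functions `C¹_0(ℝ × [0,∞))`: those of `C¹_c(ℝ × [0,∞))` that vanish on `r = 0`. -/
def IsRadialTestZero (ψ : ℝ × ℝ → ℝ) : Prop :=
  IsRadialTest ψ ∧ ∀ t : ℝ, ψ (t, 0) = 0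

/-- `t ↦ f(t, ·)` belongs to `C(ℝ; L¹_loc([0,∞), r^m dr))`. -/
def ContInRadialL1Loc (m : ℕ) (f : ℝ → ℝ → ℝ) : Prop :=
  ∀ A : ℝ, 0 < A →
    (∀ t : ℝ, IntegrableOn (fun r => f t r * r ^ m) (Ioc 0 A)) ∧
    ∀ t₀ : ℝ, Tendsto (fun t => ∫ r in Ioc 0 A, |f t r - f t₀ r| * r ^ m) (𝓝 t₀) (𝓝 0)

/-- `f` belongs to `L¹_loc(ℝ × [0,∞), dt × r^m dr)`. -/
def RadialL1Loc (m : ℕ) (f : ℝ → ℝ → ℝ) : Prop :=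
  ∀ T A : ℝ, 0 < T → 0 < A →
    IntegrableOn (fun q : ℝ × ℝ => f q.1 q.2 * q.2 ^ m) (Icc (-T) T ×ˢ Ioc 0 A)

/-- `F` is integrable on `ℝ × (0,∞)` with respect to `r^m dr dt`, and its integral is `0`. -/
def RadialIntegralZero (m : ℕ) (F : ℝ → ℝ → ℝ) : Prop :=
  IntegrableOn (fun q : ℝ × ℝ => F q.1 q.2 * q.2 ^ m) (univ ×ˢ Ioi (0 : ℝ)) ∧
    ∫ t : ℝ, ∫ r in Ioi (0 : ℝ), F t r * r ^ m = 0

/-- `(ρ, u, e)`, functions of `(t, r) ∈ ℝ × (0,∞)`, form a (non-vacuum) radial weak solution of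
the compressible Euler system with pressure function `p = p(ρ, e)`, where `m = n - 1`:
`(r^m ρ)_t + (r^m ρ u)_r = 0`,
`(r^m ρ u)_t + (r^m (ρ u² + p))_r = m r^(m-1) p`,
`(r^m ρ (e + u²/2))_t + (r^m (ρ (e + u²/2) + p) u)_r = 0`. -/
structure IsRadialWeakSolution (m : ℕ) (p : ℝ → ℝ → ℝ) (ρ u e : ℝ → ℝ → ℝ) : Prop where
  meas_density : AEMeasurable (fun q : ℝ × ℝ => ρ q.1 q.2)
    (volume.restrict (univ ×ˢ Ioi (0 : ℝ)))
  meas_velocity : AEMeasurable (fun q : ℝ × ℝ => u q.1 q.2)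
    (volume.restrict (univ ×ˢ Ioi (0 : ℝ)))
  meas_energy : AEMeasurable (fun q : ℝ × ℝ => e q.1 q.2)
    (volume.restrict (univ ×ˢ Ioi (0 : ℝ)))
  pos : ∀ᵐ q : ℝ × ℝ ∂(volume.restrict (univ ×ˢ Ioi (0 : ℝ))),
    0 < ρ q.1 q.2 ∧ 0 ≤ e q.1 q.2 ∧ 0 ≤ p (ρ q.1 q.2) (e q.1 q.2)
  cont_mass : ContInRadialL1Loc m ρ
  cont_momentum : ContInRadialL1Loc m (fun t r => ρ t r * u t r)
  cont_energy : ContInRadialL1Loc m (fun t r => ρ t r * (e t r + u t r ^ 2 / 2))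
  loc_kinetic : RadialL1Loc m (fun t r => ρ t r * u t r ^ 2)
  loc_pressure : RadialL1Loc m (fun t r => p (ρ t r) (e t r))
  loc_energyFlux : RadialL1Loc m
    (fun t r => (ρ t r * (e t r + u t r ^ 2 / 2) + p (ρ t r) (e t r)) * u t r)
  mass : ∀ ψ : ℝ × ℝ → ℝ, IsRadialTest ψ → RadialIntegralZero m (fun t r =>
    ρ t r * deriv (fun s => ψ (s, r)) t + ρ t r * u t r * deriv (fun s => ψ (t, s)) r)
  momentum : ∀ ψ : ℝ × ℝ → ℝ, IsRadialTestZero ψ → RadialIntegralZero m (fun t r =>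
    ρ t r * u t r * deriv (fun s => ψ (s, r)) t
      + ρ t r * u t r ^ 2 * deriv (fun s => ψ (t, s)) r
      + p (ρ t r) (e t r) * (deriv (fun s => ψ (t, s)) r + (m : ℝ) * ψ (t, r) / r))
  energy : ∀ ψ : ℝ × ℝ → ℝ, IsRadialTest ψ → RadialIntegralZero m (fun t r =>
    ρ t r * (e t r + u t r ^ 2 / 2) * deriv (fun s => ψ (s, r)) t
      + (ρ t r * (e t r + u t r ^ 2 / 2) + p (ρ t r) (e t r)) * u t r
          * deriv (fun s => ψ (t, s)) r)

/-! ### Weak solutions of the multi-dimensional Euler system -/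

/-- `t ↦ f(t, ·)` belongs to `C(ℝ; L¹_loc(ℝⁿ))`. -/
def ContInL1Loc {n : ℕ} {F : Type} [NormedAddCommGroup F]
    (f : ℝ → EuclideanSpace ℝ (Fin n) → F) : Prop :=
  ∀ K : Set (EuclideanSpace ℝ (Fin n)), IsCompact K →
    (∀ t : ℝ, IntegrableOn (f t) K) ∧
    ∀ t₀ : ℝ, Tendsto (fun t => ∫ z in K, ‖f t z - f t₀ z‖) (𝓝 t₀) (𝓝 0)

/-- `F` is integrable on `ℝ × ℝⁿ` and its integral is `0`. -/
def IntegralZero {n : ℕ} (F : ℝ → EuclideanSpace ℝ (Fin n) → ℝ) : Prop :=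
  Integrable (fun q : ℝ × EuclideanSpace ℝ (Fin n) => F q.1 q.2) ∧
    ∫ t : ℝ, ∫ z : EuclideanSpace ℝ (Fin n), F t z = 0

/-- `(ρ, u, e)`, functions of `(t, z) ∈ ℝ × ℝⁿ`, form a (non-vacuum) weak solution of the
compressible Euler system with pressure function `p = p(ρ, e)`:
`ρ_t + div (ρ u) = 0`, `(ρ u)_t + div (ρ u ⊗ u) + ∇p = 0`,
`(ρ (e + |u|²/2))_t + div ((ρ (e + |u|²/2) + p) u) = 0`. -/
structure IsWeakSolution (n : ℕ) (p : ℝ → ℝ → ℝ) (ρ : ℝ → EuclideanSpace ℝ (Fin n) → ℝ)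
    (u : ℝ → EuclideanSpace ℝ (Fin n) → EuclideanSpace ℝ (Fin n))
    (e : ℝ → EuclideanSpace ℝ (Fin n) → ℝ) : Prop where
  meas_density : AEMeasurable (fun q : ℝ × EuclideanSpace ℝ (Fin n) => ρ q.1 q.2)
  meas_velocity : AEMeasurable (fun q : ℝ × EuclideanSpace ℝ (Fin n) => u q.1 q.2)
  meas_energy : AEMeasurable (fun q : ℝ × EuclideanSpace ℝ (Fin n) => e q.1 q.2)
  pos : ∀ᵐ q : ℝ × EuclideanSpace ℝ (Fin n),
    0 < ρ q.1 q.2 ∧ 0 ≤ e q.1 q.2 ∧ 0 ≤ p (ρ q.1 q.2) (e q.1 q.2)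
  cont_mass : ContInL1Loc ρ
  cont_momentum : ContInL1Loc (fun t z => ρ t z • u t z)
  cont_energy : ContInL1Loc (fun t z => ρ t z * (e t z + ‖u t z‖ ^ 2 / 2))
  loc_kinetic : LocallyIntegrable
    (fun q : ℝ × EuclideanSpace ℝ (Fin n) => ρ q.1 q.2 * ‖u q.1 q.2‖ ^ 2)
  loc_pressure : LocallyIntegrable
    (fun q : ℝ × EuclideanSpace ℝ (Fin n) => p (ρ q.1 q.2) (e q.1 q.2))
  loc_energyFlux : LocallyIntegrable
    (fun q : ℝ × EuclideanSpace ℝ (Fin n) =>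
      (ρ q.1 q.2 * (e q.1 q.2 + ‖u q.1 q.2‖ ^ 2 / 2) + p (ρ q.1 q.2) (e q.1 q.2)) • u q.1 q.2)
  mass : ∀ φ : ℝ × EuclideanSpace ℝ (Fin n) → ℝ, ContDiff ℝ 1 φ → HasCompactSupport φ →
    IntegralZero (fun t z =>
      ρ t z * deriv (fun s => φ (s, z)) t
        + ρ t z * fderiv ℝ (fun y => φ (t, y)) z (u t z))
  momentum : ∀ i : Fin n,
    ∀ φ : ℝ × EuclideanSpace ℝ (Fin n) → ℝ, ContDiff ℝ 1 φ → HasCompactSupport φ →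
    IntegralZero (fun t z =>
      ρ t z * u t z i * deriv (fun s => φ (s, z)) t
        + ρ t z * u t z i * fderiv ℝ (fun y => φ (t, y)) z (u t z)
        + p (ρ t z) (e t z) * fderiv ℝ (fun y => φ (t, y)) z (EuclideanSpace.single i 1))
  energy : ∀ φ : ℝ × EuclideanSpace ℝ (Fin n) → ℝ, ContDiff ℝ 1 φ → HasCompactSupport φ →
    IntegralZero (fun t z =>
      ρ t z * (e t z + ‖u t z‖ ^ 2 / 2) * deriv (fun s => φ (s, z)) t
        + (ρ t z * (e t z + ‖u t z‖ ^ 2 / 2) + p (ρ t z) (e t z))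
            * fderiv ℝ (fun y => φ (t, y)) z (u t z))

/-- The function `(t, z) ↦ f(t, |z|)` on `ℝ × ℝⁿ`. -/
noncomputable def radialScalar (n : ℕ) (f : ℝ → ℝ → ℝ) (t : ℝ)
    (z : EuclideanSpace ℝ (Fin n)) : ℝ := f t ‖z‖

/-- The radial vector field `(t, z) ↦ f(t, |z|) z / |z|` on `ℝ × ℝⁿ`. -/
noncomputable def radialVector (n : ℕ) (f : ℝ → ℝ → ℝ) (t : ℝ)
    (z : EuclideanSpace ℝ (Fin n)) : EuclideanSpace ℝ (Fin n) := (f t ‖z‖ / ‖z‖) • z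

/-- `f` is essentially unbounded above in every neighbourhood of `a`. -/
def EssUnboundedNear {X : Type} [TopologicalSpace X] [MeasureSpace X] (f : X → ℝ) (a : X) :
    Prop :=
  ∀ U ∈ 𝓝 a, ∀ M : ℝ, 0 < volume {q ∈ U | M < f q}

/-- Amplitude blowup at collapse: at time `t = 0` the function `f` tends to `+∞` as `z → 0`,
and `f` is essentially unbounded in every space-time neighbourhood of `(t, z) = (0, 0)`. -/
def BlowsUpAtCollapse {n : ℕ} (f : ℝ → EuclideanSpace ℝ (Fin n) → ℝ) : Prop :=
  Tendsto (f 0) (𝓝[≠] 0) atTop ∧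
    EssUnboundedNear (fun q : ℝ × EuclideanSpace ℝ (Fin n) => f q.1 q.2) (0, 0)

/-! ### Similarity shock solutions (ideal polytropic gas, shock case `s = 1`, `κ = 0`) -/

/-- `D(V, C) = (1 + V)² - C²`. -/
def simD (V C : ℝ) : ℝ := (1 + V) ^ 2 - C ^ 2

/-- The polynomial `G(V, C, λ)` of the similarity equations with `s = 1`. -/
noncomputable def simG (n : ℕ) (γ lam V C : ℝ) : ℝ :=
  C ^ 2 * (n * V + 2 * (lam - 1) / γ) - V * (1 + V) * (lam + V)

/-- The rational function `F(V, C, λ)` of the similarity equations with `s = 1`. -/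
noncomputable def simF (n : ℕ) (γ lam V C : ℝ) : ℝ :=
  C * (C ^ 2 * (1 + (lam - 1) / (γ * (1 + V)))
    - (1 + ((n : ℝ) - 1) * (γ - 1) / 2) * (1 + V) ^ 2
    + ((((n : ℝ) - 1) * (γ - 1) + (γ - 3) * (lam - 1)) / 2) * (1 + V)
    - (γ - 1) * (lam - 1) / 2)

/-- The Rankine-Hugoniot relations and the entropy condition across a shock `x = const`, in the
similarity variables; `0` is the state ahead of the shock and `1` the state behind it. -/
structure IsSimilarityJump (γ V₀ C₀ R₀ V₁ C₁ R₁ : ℝ) : Prop where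
  velocity : 1 + V₁ = (γ - 1) / (γ + 1) * (1 + V₀) + 2 * C₀ ^ 2 / ((γ + 1) * (1 + V₀))
  sound : C₁ ^ 2 = C₀ ^ 2 + (γ - 1) / 2 * ((1 + V₀) ^ 2 - (1 + V₁) ^ 2)
  density : R₁ * (1 + V₁) = R₀ * (1 + V₀)
  entropy : C₀ ^ 2 < (1 + V₀) ^ 2

/-- `(R, V, C)`, functions of the similarity variable `x = t / r^λ`, form a complete similarity
shock solution: a converging shock along `x = -1` moving into a quiescent state of unit density
and zero pressure, and a reflected shock along `x = B > 0`.  Between the shocks and behind the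
reflected one the solution is `C¹` and satisfies the similarity equations. -/
structure IsCompleteSimilarityShock (n : ℕ) (γ lam B : ℝ) (R V C : ℝ → ℝ) : Prop where
  B_pos : 0 < B
  quiescent : ∀ x < -1, R x = 1 ∧ V x = 0 ∧ C x = 0
  init_V : Tendsto V (𝓝[>] (-1)) (𝓝 (-2 / (γ + 1)))
  init_C : Tendsto C (𝓝[>] (-1)) (𝓝 (Real.sqrt (2 * γ * (γ - 1)) / (γ + 1)))
  init_R : Tendsto R (𝓝[>] (-1)) (𝓝 ((γ + 1) / (γ - 1)))
  smooth_R : ContDiffOn ℝ 1 R (Ioo (-1) B ∪ Ioi B)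
  smooth_V : ContDiffOn ℝ 1 V (Ioo (-1) B ∪ Ioi B)
  smooth_C : ContDiffOn ℝ 1 C (Ioo (-1) B ∪ Ioi B)
  /-- The critical (sonic) points, where `D` vanishes and the quotients `G / D`, `F / D` are not
  defined, do not fill an interval. -/
  sonic : interior {x : ℝ | simD (V x) (C x) = 0} = ∅
  ode_V : ∀ x ∈ Ioo (-1) B ∪ Ioi B, x ≠ 0 → simD (V x) (C x) ≠ 0 →
    deriv V x = -(1 / (lam * x)) * (simG n γ lam (V x) (C x) / simD (V x) (C x))
  ode_C : ∀ x ∈ Ioo (-1) B ∪ Ioi B, x ≠ 0 → simD (V x) (C x) ≠ 0 →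
    deriv C x = -(1 / (lam * x)) * (simF n γ lam (V x) (C x) / simD (V x) (C x))
  /-- The mass equation `ρ_t + u ρ_r + ρ (u_r + (n-1) u / r) = 0` for `ρ = R(x)` and
  `u = -(r / (λ t)) V(x)`. -/
  ode_R : ∀ x ∈ Ioo (-1) B ∪ Ioi B,
    x * (1 + V x) * deriv R x + x * R x * deriv V x = n / lam * (R x * V x)
  reflected : ∃ V₀ C₀ R₀ V₁ C₁ R₁ : ℝ,
    Tendsto V (𝓝[<] B) (𝓝 V₀) ∧ Tendsto C (𝓝[<] B) (𝓝 C₀) ∧ Tendsto R (𝓝[<] B) (𝓝 R₀) ∧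
    Tendsto V (𝓝[>] B) (𝓝 V₁) ∧ Tendsto C (𝓝[>] B) (𝓝 C₁) ∧ Tendsto R (𝓝[>] B) (𝓝 R₁) ∧
    IsSimilarityJump γ V₀ C₀ R₀ V₁ C₁ R₁

/-- The density `ρ(t, r) = R(x)` with `x = t / r^λ`. -/
noncomputable def simDensity (lam : ℝ) (R : ℝ → ℝ) (t r : ℝ) : ℝ := R (t / r ^ lam)

/-- For a profile `W` (either `V` or `C`), the speed
`-(r / (λ t)) W(x) = -(r^(1-λ) / λ) (W(x) / x)` with `x = t / r^λ`; at `t = 0` the quotient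
`W(x) / x` is given the value `w`, its limit at `x = 0`. -/
noncomputable def simSpeed (lam : ℝ) (W : ℝ → ℝ) (w : ℝ) (t r : ℝ) : ℝ :=
  -(r ^ (1 - lam) / lam) * Function.update (fun x => W x / x) 0 w (t / r ^ lam)

/-- The specific internal energy `e = c² / (γ (γ - 1))`, where `c` is the sound speed with
profile `C`. -/
noncomputable def simEnergy (γ lam : ℝ) (C : ℝ → ℝ) (L : ℝ) (t r : ℝ) : ℝ :=
  simSpeed lam C L t r ^ 2 / (γ * (γ - 1))

/-! Let w = -V/(λx), and let ε be the profile of e, so that ρ = R(x), u = r^(1-λ) w(x) and e =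
r^(2-2λ) ε(x). Each radial conservation law then has a density r^α Q(x), a flux r^(α+1-λ) Φ(x) and a
source r^(α-λ) S(x), and formally it amounts to one equation on the line: (Q - λxΦ)' = S - (α+n)Φ.

This equation holds weakly on all of ℝ (`IsSimilarityShockFlow.isSimilarityFlow`). Off the points
-1, 0, B it follows from the similarity equations. Clearing the denominator D turns these into the
entropy and momentum equations, first off the sonic points and then everywhere by continuity
(`entropy_eq`, `momentum_eq`). At -1 and B the shock conditions say that Q - λxΦ has no jump, and at
0 it is continuous because V/x and C/x have limits there.

To return to (t,r), fix r and substitute t = x r^λ. The weak equation turns the t-integral of the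
balance law into the x-integral of Φ(x) ∂_r[r^(α+n) ψ(x r^λ, r)]
(`integral_balanceIntegrand_slice`). Integrating in r first gives zero, since α+n > 0. The exchange
of integrals is the analytic point and needs decay of Φ (`integrable_mul_radialDeriv`). The
ingredients are: w = O(1/|x|), since V is bounded; R is bounded, since R(1+V) decreases for large x;
and the logarithmic derivative x(RC²)'/(RC²) tends to at most 2/λ, so that p = O(x^θ) for every θ >
-2(λ-1)/λ (`exists_pressure_growth`). The bound λ < 1+n/2 makes the energy density, of size
r^(2-2λ), locally integrable against r^(n-1) dr.

In ℝⁿ, a radial field tested against φ sees only spherical means of φ. For the i-th momentum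
equation the mean is weighted by ω_i, and the divergence theorem on spheres turns the mean of ∂_iφ
into (∂_r + m/r)ψ (`sphere_integral_fderiv_single`). Since ω_i has mean zero, ψ(t,0) = 0, as the
radial momentum equation demands. Blowup is visible at t = 0, where the amplitudes are negative
powers of r times positive constants, and it spreads to sets of positive measure by continuity at
the points (0,z), z ≠ 0. -/

/-! ### Auxiliary facts on functions of one real variable -/

/-- Integration by parts against `C¹` functions of compact support. -/
def HasWeakDeriv (H h : ℝ → ℝ) : Prop :=
  ∀ χ : ℝ → ℝ, ContDiff ℝ 1 χ → HasCompactSupport χ →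
    ∫ x, H x * deriv χ x = -∫ x, h x * χ x

/-- A function that is differentiable off a finite set at whose points it has removable
discontinuities is a primitive of its derivative in the weak sense. -/
theorem hasWeakDeriv_of_hasDerivAt_off_finite {H h : ℝ → ℝ} {s : Set ℝ} (hs : s.Finite)
    (hd : ∀ x ∉ s, HasDerivAt H (h x) x) (hl : ∀ x ∈ s, ∃ l, Tendsto H (𝓝[≠] x) (𝓝 l))
    (hh : LocallyIntegrable h) : HasWeakDeriv H h := by
  classical
  intro χ hχ hχc
  choose! l hl using hl
  -- Filling in the limits gives a continuous function that agrees with `H` almost everywhere, so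
  -- the fundamental theorem of calculus with countably many exceptional points applies to `H' * χ`.
  set H' : ℝ → ℝ := s.piecewise l H with hH'
  have hopen : IsOpen sᶜ := hs.isClosed.isOpen_compl
  have heq : ∀ x, H' =ᶠ[𝓝[≠] x] H := by
    intro x
    have h1 : (s \ {x})ᶜ ∈ 𝓝 x :=
      (hs.subset sdiff_subset).isClosed.isOpen_compl.mem_nhds (by simp)
    filter_upwards [mem_nhdsWithin_of_mem_nhds h1, self_mem_nhdsWithin] with y hy hyx
    have : y ∉ s := fun hys => hy ⟨hys, hyx⟩
    simp [hH', this]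
  have hcont : Continuous H' := by
    rw [continuous_iff_continuousAt]
    intro x
    rw [← continuousWithinAt_compl_self, ContinuousWithinAt]
    by_cases hx : x ∈ s
    · have : H' x = l x := by simp [hH', hx]
      rw [this]
      exact (hl x hx).congr' (heq x).symm
    · have : H' x = H x := by simp [hH', hx]
      rw [this]
      exact ((hd x hx).continuousAt.tendsto.mono_left nhdsWithin_le_nhds).congr' (heq x).symm
  have hd' : ∀ x ∉ s, HasDerivAt H' (h x) x := by
    intro x hx
    refine (hd x hx).congr_of_eventuallyEq ?_
    filter_upwards [hopen.mem_nhds hx] with y hy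
    have hy' : y ∉ s := hy
    simp [hH', hy']
  have hae : H' =ᵐ[volume] H := by
    filter_upwards [measure_eq_zero_iff_ae_notMem.mp (hs.measure_zero volume)] with y hy
    simp [hH', hy]
  have hχd : Continuous (deriv χ) := hχ.continuous_deriv le_rfl
  obtain ⟨A, hA⟩ : ∃ A : ℝ, tsupport χ ⊆ Ioo (-A) A := by
    obtain ⟨A, hA⟩ := hχc.isCompact.isBounded.subset_ball 0
    refine ⟨A, fun x hx => ?_⟩
    have := hA hx
    rw [Metric.mem_ball, dist_zero_right, Real.norm_eq_abs, abs_lt] at this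
    exact this
  have hdsupp : Function.support (deriv χ) ⊆ tsupport χ :=
    (subset_tsupport _).trans (tsupport_deriv_subset)
  have i1 : Integrable (fun x => H' x * deriv χ x) :=
    (hcont.mul hχd).integrable_of_hasCompactSupport (hχc.deriv.mul_left)
  have i2 : Integrable (fun x => h x * χ x) := by
    have := hh.integrable_smul_left_of_hasCompactSupport hχ.continuous hχc
    refine this.congr (ae_of_all _ fun x => ?_)
    simp [mul_comm]
  have key : ∫ x, (H' x * deriv χ x + h x * χ x) = 0 := by
    rcases le_or_gt A 0 with hA0 | hA0
    · have h0 : ∀ x, χ x = 0 := by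
        intro x
        by_contra hx
        have := hA (subset_tsupport _ hx)
        linarith [this.1, this.2]
      have : χ = fun _ => 0 := funext h0
      simp [this]
    have hz : ∀ x, x ∉ Ioc (-A) A → H' x * deriv χ x + h x * χ x = 0 := by
      intro x hx
      have h1 : x ∉ tsupport χ := fun hx' => hx (Ioo_subset_Ioc_self (hA hx'))
      rw [image_eq_zero_of_notMem_tsupport h1,
        Function.notMem_support.mp fun h' => h1 (hdsupp h')]
      simp
    rw [← setIntegral_eq_integral_of_forall_compl_eq_zero hz,
      ← intervalIntegral.integral_of_le (by linarith),
      integral_eq_of_hasDerivAt_off_countable_of_le (fun x => H' x * χ x) _ (by linarith)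
        hs.countable (hcont.mul hχ.continuous).continuousOn ?_ ?_]
    · have e1 : χ A = 0 := image_eq_zero_of_notMem_tsupport fun h' => lt_irrefl _ (hA h').2
      have e2 : χ (-A) = 0 := image_eq_zero_of_notMem_tsupport fun h' => lt_irrefl _ (hA h').1
      simp [e1, e2]
    · rintro x ⟨-, hx⟩
      refine ((hd' x hx).fun_mul
        ((hχ.differentiable one_ne_zero) x).hasDerivAt).congr_deriv ?_
      ring
    · exact (i1.add i2).intervalIntegrable
  rw [integral_add i1 i2] at key
  have : ∫ x, H x * deriv χ x = ∫ x, H' x * deriv χ x :=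
    integral_congr_ae (hae.symm.mul (ae_eq_refl _))
  rw [this]
  linarith

/-- Compactness is applied to local boundedness, not to continuity: at the shocks the profiles have
only one-sided limits. -/
theorem exists_abs_le_on_Icc_of_eventually {f : ℝ → ℝ}
    (hf : ∀ x, ∃ K, ∀ᶠ y in 𝓝 x, |f y| ≤ K) (a b : ℝ) : ∃ K, ∀ y ∈ Icc a b, |f y| ≤ K := by
  refine (isCompact_Icc (a := a) (b := b)).induction_on
    (p := fun s => ∃ K, ∀ y ∈ s, |f y| ≤ K) ⟨0, by simp⟩ ?_ ?_ ?_
  · rintro s t hst ⟨K, hK⟩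
    exact ⟨K, fun y hy => hK y (hst hy)⟩
  · rintro s t ⟨K, hK⟩ ⟨K', hK'⟩
    refine ⟨max K K', fun y hy => ?_⟩
    rcases hy with hy | hy
    · exact (hK y hy).trans (le_max_left _ _)
    · exact (hK' y hy).trans (le_max_right _ _)
  · intro x _
    obtain ⟨K, hK⟩ := hf x
    exact ⟨_, mem_nhdsWithin_of_mem_nhds hK, K, fun y hy => hy⟩

theorem Filter.Tendsto.eventually_abs_le {f : ℝ → ℝ} {F : Filter ℝ} {l : ℝ}
    (h : Tendsto f F (𝓝 l)) : ∀ᶠ y in F, |f y| ≤ |l| + 1 :=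
  (h.abs.eventually (gt_mem_nhds (lt_add_one |l|))).mono fun _ hy => le_of_lt hy

theorem exists_eventually_abs_le_of_sides {f : ℝ → ℝ} {x l₁ l₂ : ℝ}
    (h₁ : Tendsto f (𝓝[<] x) (𝓝 l₁)) (h₂ : Tendsto f (𝓝[>] x) (𝓝 l₂)) :
    ∃ K, ∀ᶠ y in 𝓝 x, |f y| ≤ K := by
  refine ⟨max (max (|l₁| + 1) (|l₂| + 1)) |f x|, ?_⟩
  have h3 : ∀ᶠ y in 𝓝[≠] x, |f y| ≤ max (|l₁| + 1) (|l₂| + 1) := by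
    rw [← nhdsLT_sup_nhdsGT, eventually_sup]
    exact ⟨h₁.eventually_abs_le.mono fun y hy => hy.trans (le_max_left _ _),
      h₂.eventually_abs_le.mono fun y hy => hy.trans (le_max_right _ _)⟩
  rw [eventually_nhdsWithin_iff] at h3
  filter_upwards [h3] with y hy
  by_cases hyx : y = x
  · rw [hyx]; exact le_max_right _ _
  · exact (hy hyx).trans (le_max_left _ _)

/-- If `|M'| ≤ K |M|`, then `M² e^{2Kx}` is nondecreasing. -/
theorem sq_mul_exp_le_of_abs_deriv_le {M M' : ℝ → ℝ} {K y x : ℝ} (hyx : y ≤ x)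
    (hd : ∀ z ∈ Icc y x, HasDerivAt M (M' z) z) (hb : ∀ z ∈ Icc y x, |M' z| ≤ K * |M z|) :
    M y ^ 2 * Real.exp (2 * K * y) ≤ M x ^ 2 * Real.exp (2 * K * x) := by
  have hd' : ∀ z ∈ Icc y x, HasDerivAt (fun z => M z ^ 2 * Real.exp (2 * K * z))
      ((2 * (M z * M' z + K * M z ^ 2)) * Real.exp (2 * K * z)) z := by
    intro z hz
    have h1 := (hd z hz).fun_pow 2
    have h2 : HasDerivAt (fun z => Real.exp (2 * K * z)) (Real.exp (2 * K * z) * (2 * K)) z := by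
      simpa using ((hasDerivAt_id z).const_mul (2 * K)).exp
    refine (h1.fun_mul h2).congr_deriv ?_
    push_cast
    ring
  refine monotoneOn_of_hasDerivWithinAt_nonneg (convex_Icc y x)
    (fun z hz => (hd' z hz).continuousAt.continuousWithinAt)
    (fun z hz => (hd' z (interior_subset hz)).hasDerivWithinAt) (fun z hz => ?_)
    (left_mem_Icc.2 hyx) (right_mem_Icc.2 hyx) hyx
  have hz' := hb z (interior_subset hz)
  have h3 : |M z * M' z| ≤ K * M z ^ 2 := by
    rw [abs_mul, ← sq_abs (M z)]
    nlinarith [abs_nonneg (M z)]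
  have := neg_abs_le (M z * M' z)
  have : 0 ≤ M z * M' z + K * M z ^ 2 := by linarith
  positivity

/-- A solution of a linear differential inequality cannot reach zero: at a zero the nondecreasing
quantity M² e^(2Kx) would have dropped below its positive initial value. -/
theorem pos_of_abs_deriv_le {M M' : ℝ → ℝ} {K y x : ℝ} (hyx : y ≤ x)
    (hd : ∀ z ∈ Icc y x, HasDerivAt M (M' z) z) (hb : ∀ z ∈ Icc y x, |M' z| ≤ K * |M z|)
    (hy : 0 < M y) : 0 < M x := by
  by_contra hx
  obtain ⟨z, hz, hz0⟩ : ∃ z ∈ Icc y x, M z = 0 := by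
    have := intermediate_value_Icc' hyx (f := M)
      fun z hz => (hd z hz).continuousAt.continuousWithinAt
    exact this ⟨not_lt.1 hx, hy.le⟩
  have := sq_mul_exp_le_of_abs_deriv_le hz.1 (fun u hu => hd u ⟨hu.1, hu.2.trans hz.2⟩)
    (fun u hu => hb u ⟨hu.1, hu.2.trans hz.2⟩)
  rw [hz0] at this
  have h2 : 0 < M y ^ 2 * Real.exp (2 * K * y) := by positivity
  simp at this
  linarith

/-- A relation between continuous functions that holds off the sonic points holds everywhere. -/
theorem eq_zero_of_interior_eq_empty {f D : ℝ → ℝ} {U : Set ℝ} (hU : IsOpen U)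
    (hf : ContinuousOn f U) (hD : interior {x | D x = 0} = ∅)
    (h : ∀ x ∈ U, D x ≠ 0 → f x = 0) {x : ℝ} (hx : x ∈ U) : f x = 0 := by
  by_contra hfx
  have ho : IsOpen (U ∩ f ⁻¹' {0}ᶜ) := hf.isOpen_inter_preimage hU isOpen_compl_singleton
  have hsub : U ∩ f ⁻¹' {0}ᶜ ⊆ {x | D x = 0} := by
    rintro y ⟨hy, hy'⟩
    by_contra hDy
    exact hy' (h y hy hDy)
  have : x ∈ interior {x | D x = 0} := interior_maximal hsub ho ⟨hx, hfx⟩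
  rw [hD] at this
  exact this

/-! ### The similarity equations -/

/-- The quotients G/D and F/D arise from solving the Euler equations for the derivatives. Here this
is undone, and the result, the transport equation for the sound speed, no longer contains D as a
denominator. -/
theorem entropy_of_similarity {n γ lam x V C V' C' : ℝ} (hγ : γ ≠ 0) (hlam : lam ≠ 0)
    (hx : x ≠ 0) (hV : 1 + V ≠ 0) (hD : (1 + V) ^ 2 - C ^ 2 ≠ 0)
    (eV : V' = -(1 / (lam * x)) * ((C ^ 2 * (n * V + 2 * (lam - 1) / γ)
      - V * (1 + V) * (lam + V)) / ((1 + V) ^ 2 - C ^ 2)))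
    (eC : C' = -(1 / (lam * x)) * ((C * (C ^ 2 * (1 + (lam - 1) / (γ * (1 + V)))
    - (1 + (n - 1) * (γ - 1) / 2) * (1 + V) ^ 2
    + (((n - 1) * (γ - 1) + (γ - 3) * (lam - 1)) / 2) * (1 + V)
    - (γ - 1) * (lam - 1) / 2)) / ((1 + V) ^ 2 - C ^ 2))) :
    x * (1 + V) * C' - (C * (1 + V / lam) - (γ - 1) / 2 * C * (x * V' - n * V / lam)) = 0 := by
  subst eV eC
  field_simp
  ring

/-- The entropy and mass equations express C' and R' through V'; inserting V' then leaves a rational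
identity. -/
theorem momentum_of_similarity {n γ lam x V C R V' C' R' : ℝ} (hγ : γ ≠ 0) (hlam : lam ≠ 0)
    (hx : x ≠ 0) (hV : 1 + V ≠ 0) (hD : (1 + V) ^ 2 - C ^ 2 ≠ 0)
    (eV : V' = -(1 / (lam * x)) * ((C ^ 2 * (n * V + 2 * (lam - 1) / γ)
      - V * (1 + V) * (lam + V)) / ((1 + V) ^ 2 - C ^ 2)))
    (eC : x * (1 + V) * C' = C * (1 + V / lam) - (γ - 1) / 2 * C * (x * V' - n * V / lam))
    (eR : x * (1 + V) * R' + x * R * V' = n / lam * (R * V)) :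
    R * (V * (lam + V) - lam * (1 + V) * (x * V')) + 1 / γ * (2 * (R * C ^ 2)
      - lam * x * C ^ 2 * R' - 2 * lam * x * R * C * C') = 0 := by
  have eC' : C' =
      (C * (1 + V / lam) - (γ - 1) / 2 * C * (x * V' - n * V / lam)) / (x * (1 + V)) := by
    field_simp
    field_simp at eC
    linear_combination eC
  have eR' : R' = (n / lam * (R * V) - x * R * V') / (x * (1 + V)) := by
    field_simp
    field_simp at eR
    linear_combination eR
  subst eC' eR' eV
  field_simp
  ring

theorem measurable_of_continuousAt_off_finite {f : ℝ → ℝ} {s : Set ℝ} (hs : s.Finite)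
    (hf : ∀ x ∉ s, ContinuousAt f x) : Measurable f := by
  refine measurable_of_isOpen fun U hU => ?_
  have h1 : IsOpen (sᶜ ∩ f ⁻¹' U) :=
    ContinuousOn.isOpen_inter_preimage (fun x hx => (hf x hx).continuousWithinAt)
      hs.isClosed.isOpen_compl hU
  have h2 : (f ⁻¹' U ∩ s).Finite := hs.subset inter_subset_right
  have h3 : f ⁻¹' U = (sᶜ ∩ f ⁻¹' U) ∪ (f ⁻¹' U ∩ s) := by
    ext x
    by_cases hx : x ∈ s <;> simp [hx]
  rw [h3]
  exact h1.measurableSet.union h2.measurableSet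

/-- For a similarity profile `W`, the factor `-(W(x)/x)/λ`, continued by `w` at `x = 0`. -/
noncomputable def speedProfile (lam : ℝ) (W : ℝ → ℝ) (w : ℝ) (x : ℝ) : ℝ :=
  -(Function.update (fun x => W x / x) 0 w x) / lam

theorem speedProfile_of_ne {lam : ℝ} {W : ℝ → ℝ} {w x : ℝ} (hx : x ≠ 0) :
    speedProfile lam W w x = -(W x / x) / lam := by
  simp [speedProfile, hx]

theorem speedProfile_zero {lam : ℝ} {W : ℝ → ℝ} {w : ℝ} :
    speedProfile lam W w 0 = -w / lam := by
  simp [speedProfile]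

theorem simSpeed_eq (lam : ℝ) (W : ℝ → ℝ) (w t r : ℝ) :
    simSpeed lam W w t r = r ^ (1 - lam) * speedProfile lam W w (t / r ^ lam) := by
  simp only [simSpeed, speedProfile]
  ring

theorem continuousAt_speedProfile {lam : ℝ} {W : ℝ → ℝ} {w x : ℝ}
    (hw : Tendsto (fun x => W x / x) (𝓝[≠] 0) (𝓝 w)) (hx : x ≠ 0 → ContinuousAt W x) :
    ContinuousAt (speedProfile lam W w) x := by
  have : ContinuousAt (Function.update (fun x => W x / x) 0 w) x := by
    by_cases h0 : x = 0
    · rw [h0]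
      exact continuousAt_update_same.2 hw
    · rw [continuousAt_update_of_ne h0]
      exact (hx h0).div continuousAt_id h0
  exact this.neg.div_const lam

/-- A complete similarity shock solution that defines a flow: bounds on `1 + V` and the
behaviour of the profiles at `x = 0` and at infinity. -/
structure IsSimilarityShockFlow (n : ℕ) (γ lam B : ℝ) (R V C : ℝ → ℝ) (ℓ L : ℝ) : Prop where
  dim : n = 2 ∨ n = 3
  one_lt_γ : 1 < γ
  one_lt_lam : 1 < lam
  lam_lt : lam < 1 + (n : ℝ) / 2
  sol : IsCompleteSimilarityShock n γ lam B R V C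
  bounds : ∃ a b : ℝ, 0 < a ∧ ∀ x : ℝ, a ≤ 1 + V x ∧ 1 + V x ≤ b
  tendsto_V : Tendsto (fun x => V x / x) (𝓝[≠] 0) (𝓝 ℓ)
  ℓ_pos : 0 < ℓ
  tendsto_C : Tendsto (fun x => C x / x) (𝓝[≠] 0) (𝓝 L)
  L_neg : L < 0
  tendsto_V_atTop : Tendsto V atTop (𝓝 (-(2 * (lam - 1) / (n * γ))))
  tendsto_C_atTop : Tendsto C atTop atBot

/-- The self-similar variables off the two shocks and the quiescent region. -/
abbrev flowRegion (B : ℝ) : Set ℝ := Ioo (-1) B ∪ Ioi B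

theorem isOpen_flowRegion (B : ℝ) : IsOpen (flowRegion B) := isOpen_Ioo.union isOpen_Ioi

theorem mem_flowRegion_iff {B : ℝ} (hB : 0 < B) {x : ℝ} :
    x ∈ flowRegion B ↔ -1 < x ∧ x ≠ B := by
  constructor
  · rintro (h | h)
    · exact ⟨h.1, h.2.ne⟩
    · have : B < x := h
      exact ⟨by linarith, this.ne'⟩
  · rintro ⟨h1, h2⟩
    rcases lt_or_gt_of_ne h2 with h | h
    · exact Or.inl ⟨h1, h⟩
    · exact Or.inr h

/-! ### Conservation laws between the shocks. -/

namespace IsSimilarityShockFlow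

variable {n : ℕ} {γ lam B : ℝ} {R V C : ℝ → ℝ} {ℓ L : ℝ}

theorem lam_pos (h : IsSimilarityShockFlow n γ lam B R V C ℓ L) : 0 < lam :=
  zero_lt_one.trans h.one_lt_lam

theorem γ_pos (h : IsSimilarityShockFlow n γ lam B R V C ℓ L) : 0 < γ :=
  zero_lt_one.trans h.one_lt_γ

theorem dim_pos (h : IsSimilarityShockFlow n γ lam B R V C ℓ L) : (0 : ℝ) < n := by
  rcases h.dim with rfl | rfl <;> norm_num

theorem one_add_V_pos (h : IsSimilarityShockFlow n γ lam B R V C ℓ L) (x : ℝ) : 0 < 1 + V x := by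
  obtain ⟨a, b, ha, hab⟩ := h.bounds
  exact ha.trans_le (hab x).1

theorem continuousAt_of_contDiffOn (h : IsSimilarityShockFlow n γ lam B R V C ℓ L) {f : ℝ → ℝ}
    {c : ℝ} (hq : ∀ x < -1, f x = c) (hf : ContDiffOn ℝ 1 f (flowRegion B)) {x : ℝ}
    (h1 : x ≠ -1) (h2 : x ≠ B) : ContinuousAt f x := by
  rcases lt_or_gt_of_ne h1 with hx | hx
  · have : f =ᶠ[𝓝 x] fun _ => c := by
      filter_upwards [Iio_mem_nhds hx] with y hy using hq y hy
    exact continuousAt_const.congr this.symm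
  · exact hf.continuousOn.continuousAt
      ((isOpen_flowRegion B).mem_nhds ((mem_flowRegion_iff h.sol.B_pos).2 ⟨hx, h2⟩))

theorem continuousAt_R (h : IsSimilarityShockFlow n γ lam B R V C ℓ L) {x : ℝ}
    (h1 : x ≠ -1) (h2 : x ≠ B) : ContinuousAt R x :=
  h.continuousAt_of_contDiffOn (fun x hx => (h.sol.quiescent x hx).1) h.sol.smooth_R h1 h2

theorem continuousAt_V (h : IsSimilarityShockFlow n γ lam B R V C ℓ L) {x : ℝ}
    (h1 : x ≠ -1) (h2 : x ≠ B) : ContinuousAt V x :=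
  h.continuousAt_of_contDiffOn (fun x hx => (h.sol.quiescent x hx).2.1) h.sol.smooth_V h1 h2

theorem continuousAt_C (h : IsSimilarityShockFlow n γ lam B R V C ℓ L) {x : ℝ}
    (h1 : x ≠ -1) (h2 : x ≠ B) : ContinuousAt C x :=
  h.continuousAt_of_contDiffOn (fun x hx => (h.sol.quiescent x hx).2.2) h.sol.smooth_C h1 h2

theorem continuousAt_w (h : IsSimilarityShockFlow n γ lam B R V C ℓ L) {x : ℝ}
    (h1 : x ≠ -1) (h2 : x ≠ B) : ContinuousAt (speedProfile lam V ℓ) x :=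
  continuousAt_speedProfile h.tendsto_V fun _ => h.continuousAt_V h1 h2

theorem continuousAt_k (h : IsSimilarityShockFlow n γ lam B R V C ℓ L) {x : ℝ}
    (h1 : x ≠ -1) (h2 : x ≠ B) : ContinuousAt (speedProfile lam C L) x :=
  continuousAt_speedProfile h.tendsto_C fun _ => h.continuousAt_C h1 h2

theorem hasDerivAt_of_contDiffOn {f : ℝ → ℝ} (hf : ContDiffOn ℝ 1 f (flowRegion B)) {x : ℝ}
    (hx : x ∈ flowRegion B) : HasDerivAt f (deriv f x) x :=
  ((hf.differentiableOn one_ne_zero).differentiableAt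
    ((isOpen_flowRegion B).mem_nhds hx)).hasDerivAt

theorem continuousOn_deriv_of_contDiffOn {f : ℝ → ℝ} (hf : ContDiffOn ℝ 1 f (flowRegion B)) :
    ContinuousOn (deriv f) (flowRegion B) :=
  hf.continuousOn_deriv_of_isOpen (isOpen_flowRegion B) le_rfl

/-- The entropy equation. -/
theorem entropy_eq (h : IsSimilarityShockFlow n γ lam B R V C ℓ L) {x : ℝ}
    (hx : x ∈ flowRegion B) (hx0 : x ≠ 0) :
    x * (1 + V x) * deriv C x = C x * (1 + V x / lam)
      - (γ - 1) / 2 * C x * (x * deriv V x - n * V x / lam) := by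
  rw [← sub_eq_zero]
  have cV := h.sol.smooth_V.continuousOn
  have cC := h.sol.smooth_C.continuousOn
  have cV' := continuousOn_deriv_of_contDiffOn h.sol.smooth_V
  have cC' := continuousOn_deriv_of_contDiffOn h.sol.smooth_C
  -- With D cleared, both sides are continuous, so the relation extends to the sonic points, whose
  -- set has empty interior.
  refine eq_zero_of_interior_eq_empty (U := flowRegion B ∩ {0}ᶜ)
    (f := fun x => x * (1 + V x) * deriv C x - (C x * (1 + V x / lam)
      - (γ - 1) / 2 * C x * (x * deriv V x - n * V x / lam)))
    ((isOpen_flowRegion B).inter isOpen_compl_singleton) ?_ h.sol.sonic ?_ ⟨hx, hx0⟩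
  · refine ContinuousOn.mono (s := flowRegion B) ?_ inter_subset_left
    fun_prop
  · rintro y ⟨hy, hy0⟩ hD
    exact entropy_of_similarity h.γ_pos.ne' h.lam_pos.ne' hy0 (h.one_add_V_pos y).ne' hD
      (h.sol.ode_V y hy hy0 hD) (h.sol.ode_C y hy hy0 hD)

/-- The momentum equation. -/
theorem momentum_eq (h : IsSimilarityShockFlow n γ lam B R V C ℓ L) {x : ℝ}
    (hx : x ∈ flowRegion B) (hx0 : x ≠ 0) :
    R x * (V x * (lam + V x) - lam * (1 + V x) * (x * deriv V x)) + 1 / γ * (2 * (R x * C x ^ 2)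
      - lam * x * C x ^ 2 * deriv R x - 2 * lam * x * R x * C x * deriv C x) = 0 := by
  have cV := h.sol.smooth_V.continuousOn
  have cC := h.sol.smooth_C.continuousOn
  have cR := h.sol.smooth_R.continuousOn
  have cV' := continuousOn_deriv_of_contDiffOn h.sol.smooth_V
  have cC' := continuousOn_deriv_of_contDiffOn h.sol.smooth_C
  have cR' := continuousOn_deriv_of_contDiffOn h.sol.smooth_R
  refine eq_zero_of_interior_eq_empty (U := flowRegion B ∩ {0}ᶜ)
    (f := fun x => R x * (V x * (lam + V x) - lam * (1 + V x) * (x * deriv V x))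
      + 1 / γ * (2 * (R x * C x ^ 2)
      - lam * x * C x ^ 2 * deriv R x - 2 * lam * x * R x * C x * deriv C x))
    ((isOpen_flowRegion B).inter isOpen_compl_singleton) ?_ h.sol.sonic ?_ ⟨hx, hx0⟩
  · refine ContinuousOn.mono (s := flowRegion B) ?_ inter_subset_left
    fun_prop
  · rintro y ⟨hy, hy0⟩ hD
    exact momentum_of_similarity h.γ_pos.ne' h.lam_pos.ne' hy0 (h.one_add_V_pos y).ne' hD
      (h.sol.ode_V y hy hy0 hD) (h.entropy_eq hy hy0) (h.sol.ode_R y hy)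

/-- The mass equation in conservative form. -/
theorem mass_eq (h : IsSimilarityShockFlow n γ lam B R V C ℓ L) {x : ℝ}
    (hx : x ∈ flowRegion B) :
    deriv R x * (1 + V x) + R x * deriv V x = -(n * speedProfile lam V ℓ x * R x) := by
  rw [← sub_eq_zero]
  have cV := h.sol.smooth_V.continuousOn
  have cR := h.sol.smooth_R.continuousOn
  have cV' := continuousOn_deriv_of_contDiffOn h.sol.smooth_V
  have cR' := continuousOn_deriv_of_contDiffOn h.sol.smooth_R
  have cw : ContinuousOn (speedProfile lam V ℓ) (flowRegion B) := fun y hy =>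
    (h.continuousAt_w ((mem_flowRegion_iff h.sol.B_pos).1 hy).1.ne'
      ((mem_flowRegion_iff h.sol.B_pos).1 hy).2).continuousWithinAt
  -- The same density argument with `D x = x`: the mass equation may be divided by x off the origin,
  -- and the quotient extends to x = 0 by continuity of the speed profile.
  refine eq_zero_of_interior_eq_empty (U := flowRegion B) (D := fun x => x)
    (f := fun x => deriv R x * (1 + V x) + R x * deriv V x
      - -(n * speedProfile lam V ℓ x * R x))
    (isOpen_flowRegion B) ?_ ?_ ?_ hx
  · fun_prop
  · simp
  · intro y hy hy0
    rw [speedProfile_of_ne hy0]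
    have := h.sol.ode_R y hy
    have hl := h.lam_pos.ne'
    field_simp at this ⊢
    linear_combination this

/-- Since λxw = -V, the product R(1+V) is Q - λxΦ for the mass law, with Q = R and Φ = Rw. -/
theorem hasDerivAt_massFlux (h : IsSimilarityShockFlow n γ lam B R V C ℓ L) {x : ℝ}
    (hx : x ∈ flowRegion B) : HasDerivAt (fun x => R x * (1 + V x))
      (-(n * speedProfile lam V ℓ x * R x)) x := by
  rw [← h.mass_eq hx]
  exact (hasDerivAt_of_contDiffOn h.sol.smooth_R hx).fun_mul
    ((hasDerivAt_of_contDiffOn h.sol.smooth_V hx).const_add 1)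

/-- This is Q - λxΦ for Q = Rw and Φ = Rw² + p, written in V and C for x ≠ 0. The conservative form
is a combination of the mass and momentum equations. -/
theorem hasDerivAt_momentumFlux (h : IsSimilarityShockFlow n γ lam B R V C ℓ L) {x : ℝ}
    (hx : x ∈ flowRegion B) (hx0 : x ≠ 0) :
    HasDerivAt (fun x => -(R x / (lam * x)) * (V x * (1 + V x) + C x ^ 2 / γ))
      (-(n + 1 - lam) * (R x * (V x / (lam * x)) ^ 2 + R x * (C x / (lam * x)) ^ 2 / γ)
        + (n - 1) * (R x * (C x / (lam * x)) ^ 2 / γ)) x := by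
  have dR := hasDerivAt_of_contDiffOn h.sol.smooth_R hx
  have dV := hasDerivAt_of_contDiffOn h.sol.smooth_V hx
  have dC := hasDerivAt_of_contDiffOn h.sol.smooth_C hx
  have hl := h.lam_pos.ne'
  have hg := h.γ_pos.ne'
  have e1 := h.sol.ode_R x hx
  have e2 := h.momentum_eq hx hx0
  refine (((dR.fun_div ((hasDerivAt_id x).const_mul lam) (by positivity)).fun_neg).fun_mul
    ((dV.fun_mul (dV.const_add 1)).fun_add ((dC.fun_pow 2).div_const γ))).congr_deriv ?_
  simp only [id]
  field_simp at e1 e2 ⊢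
  push_cast
  linear_combination (-γ * V x) * e1 + e2

/-- This is Q - λxΦ for Q = R(ε + w²/2) and Φ = (Q + p)w. The conservative form combines the mass,
momentum and entropy equations. -/
theorem hasDerivAt_energyFlux (h : IsSimilarityShockFlow n γ lam B R V C ℓ L) {x : ℝ}
    (hx : x ∈ flowRegion B) (hx0 : x ≠ 0) :
    HasDerivAt (fun x => R x / (lam * x) ^ 2 * ((C x ^ 2 / (γ * (γ - 1)) + V x ^ 2 / 2)
        * (1 + V x) + C x ^ 2 * V x / γ))
      ((n + 2 - 2 * lam) * (R x * (C x ^ 2 / (γ * (γ - 1)) + V x ^ 2 / 2) + R x * C x ^ 2 / γ)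
        * V x / (lam * x) ^ 3) x := by
  have dR := hasDerivAt_of_contDiffOn h.sol.smooth_R hx
  have dV := hasDerivAt_of_contDiffOn h.sol.smooth_V hx
  have dC := hasDerivAt_of_contDiffOn h.sol.smooth_C hx
  have hl := h.lam_pos.ne'
  have hg := h.γ_pos.ne'
  have hg1 : γ - 1 ≠ 0 := by linarith [h.one_lt_γ]
  have e1 := h.sol.ode_R x hx
  have e2 := h.momentum_eq hx hx0
  have e3 := h.entropy_eq hx hx0
  refine ((dR.fun_div (((hasDerivAt_id x).const_mul lam).fun_pow 2) (by positivity)).fun_mul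
    ((((dC.fun_pow 2).div_const _).fun_add ((dV.fun_pow 2).div_const 2)).fun_mul
      (dV.const_add 1) |>.fun_add (((dC.fun_pow 2).fun_mul dV).div_const γ))).congr_deriv ?_
  simp only [id]
  field_simp at e1 e2 e3 ⊢
  push_cast
  linear_combination x * (2 * C x ^ 2 + V x ^ 2 * γ * (γ - 1)) * e1
    - x * (2 * V x * (γ - 1)) * e2 + x * (2 * R x * C x) * e3

end IsSimilarityShockFlow

/-! ### Positivity of the density and bounds on the profiles. -/

namespace IsSimilarityShockFlow

variable {n : ℕ} {γ lam B : ℝ} {R V C : ℝ → ℝ} {ℓ L : ℝ}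

/-- Near 0 the speed profile is continuous; away from 0 it is a bounded function divided by x. The
second bound encodes decay like 1/|x|. -/
theorem exists_abs_w_le (h : IsSimilarityShockFlow n γ lam B R V C ℓ L) :
    ∃ K, ∀ x, |speedProfile lam V ℓ x| ≤ K ∧ |x * speedProfile lam V ℓ x| ≤ K := by
  obtain ⟨a, b, ha, hab⟩ := h.bounds
  have hl := h.lam_pos
  have hV : ∀ x, |V x| ≤ 1 + |b| := fun x => by
    rw [abs_le]
    constructor <;> linarith [hab x, le_abs_self b, abs_nonneg b]
  have hev := (h.continuousAt_w (x := 0) (by norm_num) h.sol.B_pos.ne).tendsto.eventually_abs_le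
  obtain ⟨δ, hδ, hev⟩ := Metric.eventually_nhds_iff.1 hev
  set K₁ := |speedProfile lam V ℓ 0| + 1
  have hb : 0 ≤ 1 + |b| := by positivity
  refine ⟨max ((1 + |b|) / lam) (max K₁ ((1 + |b|) / (lam * δ))), fun x => ⟨?_, ?_⟩⟩
  · rcases lt_or_ge |x| δ with hx | hx
    · exact (hev (by simpa using hx)).trans ((le_max_left _ _).trans (le_max_right _ _))
    · refine le_trans ?_ ((le_max_right _ _).trans (le_max_right _ _))
      have hx0 : x ≠ 0 := abs_pos.1 (hδ.trans_le hx)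
      rw [speedProfile_of_ne hx0, abs_div, abs_neg, abs_div, abs_of_pos hl, div_div, mul_comm lam]
      have := hV x
      gcongr
  · refine le_trans ?_ (le_max_left _ _)
    by_cases hx0 : x = 0
    · rw [hx0]; simp; positivity
    · rw [speedProfile_of_ne hx0, show x * (-(V x / x) / lam) = -(V x / lam) by field_simp, abs_neg,
        abs_div, abs_of_pos hl]
      have := hV x
      gcongr

/-- The mass flux M = R(1+V) satisfies M' = -(nw/(1+V)) M with a bounded coefficient, because 1+V
stays away from zero. -/
theorem exists_deriv_massFlux_le (h : IsSimilarityShockFlow n γ lam B R V C ℓ L) :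
    ∃ K, ∀ x, |-(n * speedProfile lam V ℓ x * R x)| ≤ K * |R x * (1 + V x)| := by
  obtain ⟨a, b, ha, hab⟩ := h.bounds
  obtain ⟨K, hK⟩ := h.exists_abs_w_le
  refine ⟨n * K / a, fun x => ?_⟩
  have h1 := (hab x).1
  have h2 := (hK x).1
  rw [abs_neg, abs_mul, abs_mul, abs_mul, Nat.abs_cast, abs_of_pos (h.one_add_V_pos x)]
  have h3 : 1 ≤ (1 + V x) / a := by rwa [one_le_div ha]
  calc (n : ℝ) * |speedProfile lam V ℓ x| * |R x| ≤ n * K * |R x| * 1 := by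
        rw [mul_one]; gcongr
    _ ≤ n * K * |R x| * ((1 + V x) / a) := by
        have : 0 ≤ K := (abs_nonneg _).trans h2
        gcongr
    _ = _ := by ring

theorem massFlux_pos_of_le (h : IsSimilarityShockFlow n γ lam B R V C ℓ L) {x y : ℝ}
    (hyx : y ≤ x) (hs : Icc y x ⊆ flowRegion B) (hy : 0 < R y * (1 + V y)) :
    0 < R x * (1 + V x) := by
  obtain ⟨K, hK⟩ := h.exists_deriv_massFlux_le
  exact pos_of_abs_deriv_le (M := fun x => R x * (1 + V x)) hyx
    (fun z hz => h.hasDerivAt_massFlux (hs hz)) (fun z _ => hK z) hy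

theorem massFlux_tendsto_neg_one (h : IsSimilarityShockFlow n γ lam B R V C ℓ L) :
    Tendsto (fun x => R x * (1 + V x)) (𝓝[>] (-1)) (𝓝 1) := by
  have := h.sol.init_R.mul (h.sol.init_V.const_add 1)
  have hg := h.one_lt_γ
  have h1 : (γ + 1) / (γ - 1) * (1 + -2 / (γ + 1)) = 1 := by
    have : γ - 1 ≠ 0 := by linarith
    have : γ + 1 ≠ 0 := by linarith
    field_simp
    ring
  rwa [h1] at this

/-- The mass flux tends to 1 at the converging shock, so it is positive at some point to the left of
`x`, and it cannot vanish on the way to `x`. -/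
theorem R_pos_left (h : IsSimilarityShockFlow n γ lam B R V C ℓ L) {x : ℝ}
    (hx : x ∈ Ioo (-1) B) : 0 < R x := by
  have h1 := (h.massFlux_tendsto_neg_one.eventually (lt_mem_nhds one_pos)).and
    (Ioo_mem_nhdsGT hx.1)
  obtain ⟨y, hy, hy1⟩ := h1.exists
  have := h.massFlux_pos_of_le hy1.2.le
    (fun z hz => Or.inl ⟨hy1.1.trans_le hz.1, hz.2.trans_lt hx.2⟩) hy
  exact pos_of_mul_pos_left this (h.one_add_V_pos x).le

/-- The one-sided limits at the reflected shock; the densities are positive. -/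
theorem reflected_pos (h : IsSimilarityShockFlow n γ lam B R V C ℓ L) :
    ∃ V₀ C₀ R₀ V₁ C₁ R₁ : ℝ,
    Tendsto V (𝓝[<] B) (𝓝 V₀) ∧ Tendsto C (𝓝[<] B) (𝓝 C₀) ∧ Tendsto R (𝓝[<] B) (𝓝 R₀) ∧
    Tendsto V (𝓝[>] B) (𝓝 V₁) ∧ Tendsto C (𝓝[>] B) (𝓝 C₁) ∧ Tendsto R (𝓝[>] B) (𝓝 R₁) ∧
    IsSimilarityJump γ V₀ C₀ R₀ V₁ C₁ R₁ ∧ 0 < 1 + V₀ ∧ 0 < 1 + V₁ ∧ 0 < R₁ * (1 + V₁) := by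
  obtain ⟨V₀, C₀, R₀, V₁, C₁, R₁, hV₀, hC₀, hR₀, hV₁, hC₁, hR₁, hj⟩ := h.sol.reflected
  obtain ⟨a, b, ha, hab⟩ := h.bounds
  have p0 : 0 < 1 + V₀ :=
    ha.trans_le (ge_of_tendsto (hV₀.const_add 1) (Eventually.of_forall fun x => (hab x).1))
  have p1 : 0 < 1 + V₁ :=
    ha.trans_le (ge_of_tendsto (hV₁.const_add 1) (Eventually.of_forall fun x => (hab x).1))
  refine ⟨V₀, C₀, R₀, V₁, C₁, R₁, hV₀, hC₀, hR₀, hV₁, hC₁, hR₁, hj, p0, p1, ?_⟩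
  rw [hj.density]
  have hB := h.sol.B_pos
  obtain ⟨K, hK⟩ := h.exists_deriv_massFlux_le
  have hR0 : 0 < R 0 := h.R_pos_left ⟨by norm_num, hB⟩
  -- Positivity on (-1, B) alone gives only R₀ ≥ 0. The monotone quantity is bounded below by its
  -- value at 0, and this excludes R₀ = 0 in the limit.
  have hlim : Tendsto (fun x => (R x * (1 + V x)) ^ 2 * Real.exp (2 * K * x)) (𝓝[<] B)
      (𝓝 ((R₀ * (1 + V₀)) ^ 2 * Real.exp (2 * K * B))) := by
    refine ((hR₀.mul (hV₀.const_add 1)).pow 2).mul ?_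
    have : Continuous fun x => Real.exp (2 * K * x) := by fun_prop
    exact this.continuousAt.tendsto.mono_left nhdsWithin_le_nhds
  have hle := ge_of_tendsto hlim (b := (R 0 * (1 + V 0)) ^ 2 * Real.exp (2 * K * 0)) (by
    filter_upwards [Ioo_mem_nhdsLT hB] with x hx
    exact sq_mul_exp_le_of_abs_deriv_le (M := fun x => R x * (1 + V x)) hx.1.le
      (fun z hz => h.hasDerivAt_massFlux
        (Or.inl ⟨by linarith [hz.1], hz.2.trans_lt hx.2⟩)) (fun z _ => hK z))
  have hV0 := h.one_add_V_pos 0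
  have hne : R₀ ≠ 0 := by
    rintro rfl
    have : 0 < (R 0 * (1 + V 0)) ^ 2 * Real.exp (2 * K * 0) := by positivity
    rw [zero_mul, zero_pow two_ne_zero, zero_mul] at hle
    exact absurd hle (not_le.2 this)
  have hnn : 0 ≤ R₀ := ge_of_tendsto hR₀ (by
    filter_upwards [Ioo_mem_nhdsLT hB] with x hx
    exact (h.R_pos_left ⟨by linarith [hx.1], hx.2⟩).le)
  have : 0 < R₀ := lt_of_le_of_ne hnn hne.symm
  positivity

theorem R_pos (h : IsSimilarityShockFlow n γ lam B R V C ℓ L) {x : ℝ}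
    (h1 : x ≠ -1) (h2 : x ≠ B) : 0 < R x := by
  rcases lt_or_gt_of_ne h1 with hx | hx
  · rw [(h.sol.quiescent x hx).1]; exact one_pos
  rcases lt_or_gt_of_ne h2 with hx' | hx'
  · exact h.R_pos_left ⟨hx, hx'⟩
  obtain ⟨V₀, C₀, R₀, V₁, C₁, R₁, -, -, -, hV₁, -, hR₁, -, -, -, hM⟩ := h.reflected_pos
  obtain ⟨y, hy, hy1⟩ := (((hR₁.mul (hV₁.const_add 1)).eventually (lt_mem_nhds hM)).and
    (Ioo_mem_nhdsGT hx')).exists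
  have := h.massFlux_pos_of_le hy1.2.le (fun z hz => Or.inr (hy1.1.trans_le hz.1)) hy
  exact pos_of_mul_pos_left this (h.one_add_V_pos x).le

theorem tendsto_left_neg_one {f : ℝ → ℝ} {c : ℝ}
    (hq : ∀ x < -1, f x = c) : Tendsto f (𝓝[<] (-1)) (𝓝 c) := by
  refine tendsto_const_nhds.congr' ?_
  filter_upwards [self_mem_nhdsWithin] with x hx using (hq x hx).symm

theorem exists_eventually_abs_R_le (h : IsSimilarityShockFlow n γ lam B R V C ℓ L) (x : ℝ) :
    ∃ K, ∀ᶠ y in 𝓝 x, |R y| ≤ K := by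
  by_cases h1 : x = -1
  · subst h1
    exact exists_eventually_abs_le_of_sides
      (tendsto_left_neg_one fun x hx => (h.sol.quiescent x hx).1) h.sol.init_R
  by_cases h2 : x = B
  · subst h2
    obtain ⟨V₀, C₀, R₀, V₁, C₁, R₁, -, -, hR₀, -, -, hR₁, -⟩ := h.reflected_pos
    exact exists_eventually_abs_le_of_sides hR₀ hR₁
  · exact ⟨_, (h.continuousAt_R h1 h2).tendsto.eventually_abs_le⟩

theorem tendsto_speedProfile {lam : ℝ} {W : ℝ → ℝ} {w x l : ℝ} {s : Set ℝ} (hx : x ≠ 0)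
    (hW : Tendsto W (𝓝[s] x) (𝓝 l)) :
    Tendsto (speedProfile lam W w) (𝓝[s] x) (𝓝 (-(l / x) / lam)) := by
  have : Tendsto (fun y => -(W y / y) / lam) (𝓝[s] x) (𝓝 (-(l / x) / lam)) :=
    ((hW.div (tendsto_id.mono_left nhdsWithin_le_nhds) hx).neg).div_const lam
  refine this.congr' ?_
  filter_upwards [mem_nhdsWithin_of_mem_nhds (isOpen_compl_singleton.mem_nhds hx)] with y hy
  exact (speedProfile_of_ne hy).symm

theorem exists_eventually_abs_k_le (h : IsSimilarityShockFlow n γ lam B R V C ℓ L) (x : ℝ) :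
    ∃ K, ∀ᶠ y in 𝓝 x, |speedProfile lam C L y| ≤ K := by
  by_cases h1 : x = -1
  · subst h1
    exact exists_eventually_abs_le_of_sides
      (tendsto_speedProfile (by norm_num)
        (tendsto_left_neg_one fun x hx => (h.sol.quiescent x hx).2.2))
      (tendsto_speedProfile (by norm_num) h.sol.init_C)
  by_cases h2 : x = B
  · subst h2
    obtain ⟨V₀, C₀, R₀, V₁, C₁, R₁, -, hC₀, -, -, hC₁, -⟩ := h.reflected_pos
    exact exists_eventually_abs_le_of_sides (tendsto_speedProfile h.sol.B_pos.ne' hC₀)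
      (tendsto_speedProfile h.sol.B_pos.ne' hC₁)
  · exact ⟨_, (h.continuousAt_k h1 h2).tendsto.eventually_abs_le⟩

/-- The limit of V at infinity is negative, so w > 0 for large x and the mass flux is nonincreasing
there; dividing by 1+V ≥ a bounds R. On the remaining compact interval local boundedness suffices.
-/
theorem exists_abs_R_le (h : IsSimilarityShockFlow n γ lam B R V C ℓ L) : ∃ K, ∀ x, |R x| ≤ K := by
  obtain ⟨a, b, ha, hab⟩ := h.bounds
  have hlim : -(2 * (lam - 1) / (n * γ)) < 0 := by
    have := h.dim_pos
    have := h.γ_pos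
    have : 0 < lam - 1 := by linarith [h.one_lt_lam]
    rw [neg_lt_zero]
    positivity
  obtain ⟨X, hX⟩ := eventually_atTop.1
    ((h.tendsto_V_atTop.eventually (gt_mem_nhds hlim)).and (eventually_gt_atTop B))
  have hX0 : 0 < X := h.sol.B_pos.trans (hX X le_rfl).2
  have hmem : ∀ x ∈ Ici X, x ∈ flowRegion B := fun x hx => Or.inr (hX x hx).2
  have hanti : AntitoneOn (fun x => R x * (1 + V x)) (Ici X) := by
    refine antitoneOn_of_hasDerivWithinAt_nonpos (convex_Ici X)
      (fun z hz => (h.hasDerivAt_massFlux (hmem z hz)).continuousAt.continuousWithinAt)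
      (fun z hz => (h.hasDerivAt_massFlux (hmem z (interior_subset hz))).hasDerivWithinAt)
      (fun z hz => ?_)
    have hz' : X ≤ z := interior_subset hz
    have hz0 : 0 < z := hX0.trans_le hz'
    have hR : 0 < R z := h.R_pos (by linarith) (hX z hz').2.ne'
    have hV := (hX z hz').1
    have hl := h.lam_pos
    rw [speedProfile_of_ne hz0.ne', neg_nonpos]
    have : 0 < -(V z / z) := by
      rw [← neg_div]
      exact div_pos (by linarith) hz0
    positivity
  obtain ⟨K, hK⟩ := exists_abs_le_on_Icc_of_eventually h.exists_eventually_abs_R_le (-1) X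
  have hXM : 0 ≤ R X * (1 + V X) := by
    have := h.R_pos (x := X) (by linarith) (hX X le_rfl).2.ne'
    have := h.one_add_V_pos X
    positivity
  refine ⟨max 1 (max K (R X * (1 + V X) / a)), fun x => ?_⟩
  rcases lt_or_ge x (-1) with hx | hx
  · rw [(h.sol.quiescent x hx).1]
    simp
  rcases le_or_gt x X with hx' | hx'
  · exact (hK x ⟨hx, hx'⟩).trans ((le_max_left _ _).trans (le_max_right _ _))
  · refine le_trans ?_ ((le_max_right _ _).trans (le_max_right _ _))
    have h1 : R x * (1 + V x) ≤ R X * (1 + V X) :=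
      hanti (mem_Ici.2 le_rfl) (mem_Ici.2 hx'.le) hx'.le
    have h2 : 0 < R x := h.R_pos (by linarith) (hX x hx'.le).2.ne'
    rw [abs_of_pos h2, le_div_iff₀ ha]
    nlinarith [(hab x).1]

/-- As C² → ∞, the quotient -G/D behaves like nV + 2(λ-1)/γ, and the limit of V is exactly the root
of this expression. -/
theorem tendsto_mul_deriv_V (h : IsSimilarityShockFlow n γ lam B R V C ℓ L) :
    Tendsto (fun x => x * deriv V x) atTop (𝓝 0) := by
  obtain ⟨a, b, ha, hab⟩ := h.bounds
  have hn := h.dim_pos.ne'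
  have hg := h.γ_pos.ne'
  have hl := h.lam_pos.ne'
  have hC2 : Tendsto (fun x => C x ^ 2) atTop atTop := by
    have := (tendsto_pow_atTop (α := ℝ) two_ne_zero).comp (tendsto_neg_atBot_atTop.comp
      h.tendsto_C_atTop)
    refine this.congr fun x => ?_
    simp
  have hinv : Tendsto (fun x => (C x ^ 2)⁻¹) atTop (𝓝 0) := tendsto_inv_atTop_zero.comp hC2
  set v := -(2 * (lam - 1) / (n * γ)) with hv
  have hV := h.tendsto_V_atTop
  have h1 : Tendsto (fun x => -(1 / lam) * (((n * V x + 2 * (lam - 1) / γ)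
      - V x * (1 + V x) * (lam + V x) * (C x ^ 2)⁻¹) / ((1 + V x) ^ 2 * (C x ^ 2)⁻¹ - 1))) atTop
      (𝓝 (-(1 / lam) * (((n * v + 2 * (lam - 1) / γ) - v * (1 + v) * (lam + v) * 0)
        / ((1 + v) ^ 2 * 0 - 1)))) := by
    refine Tendsto.const_mul _ (Tendsto.div ?_ ?_ (by norm_num))
    · exact ((hV.const_mul _).add_const _).sub
        (((hV.mul (hV.const_add 1)).mul (hV.const_add lam)).mul hinv)
    · exact (((hV.const_add 1).pow 2).mul hinv).sub_const 1
  have h0 : (n * v + 2 * (lam - 1) / γ) = 0 := by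
    rw [hv]; field_simp; ring
  rw [h0] at h1
  simp only [mul_zero, sub_zero, zero_div, mul_zero] at h1
  refine h1.congr' ?_
  filter_upwards [hC2.eventually_gt_atTop (b ^ 2), eventually_gt_atTop B] with x hx hxB
  have hx0 : x ≠ 0 := (h.sol.B_pos.trans hxB).ne'
  have hc : C x ^ 2 ≠ 0 := ((sq_nonneg b).trans_lt hx).ne'
  have hD : simD (V x) (C x) ≠ 0 := by
    have := hab x
    have : (1 + V x) ^ 2 ≤ b ^ 2 := pow_le_pow_left₀ (h.one_add_V_pos x).le this.2 2
    rw [simD]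
    exact (by linarith : (1 + V x) ^ 2 - C x ^ 2 < 0).ne
  rw [h.sol.ode_V x (Or.inr hxB) hx0 hD]
  have e : (1 + V x) ^ 2 * (C x ^ 2)⁻¹ - 1 = simD (V x) (C x) * (C x ^ 2)⁻¹ := by
    rw [simD, sub_mul, mul_inv_cancel₀ hc]
  have e' : (n * V x + 2 * (lam - 1) / γ) - V x * (1 + V x) * (lam + V x) * (C x ^ 2)⁻¹
      = simG n γ lam (V x) (C x) * (C x ^ 2)⁻¹ := by
    rw [simG, sub_mul, mul_comm (C x ^ 2), mul_inv_cancel_right₀ hc]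
  rw [e, e', mul_div_mul_right _ _ (inv_ne_zero hc)]
  field_simp

/-- Growth of the pressure along the flow: `R C²` is dominated by `x ^ q` for all `q > 2 / λ`. -/
theorem exists_pressure_growth (h : IsSimilarityShockFlow n γ lam B R V C ℓ L) {q : ℝ}
    (hq : 2 / lam < q) : ∃ K X : ℝ, B < X ∧ 1 ≤ X ∧ 0 ≤ K ∧
      ∀ x, X < x → R x * C x ^ 2 ≤ K * x ^ q := by
  have hn := h.dim_pos.ne'
  have hg := h.γ_pos.ne'
  have hl := h.lam_pos.ne'
  set v := -(2 * (lam - 1) / (n * γ)) with hv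
  have hV := h.tendsto_V_atTop
  obtain ⟨a, b, ha, hab⟩ := h.bounds
  have hv1 : 0 < 1 + v :=
    ha.trans_le (ge_of_tendsto (hV.const_add 1) (Eventually.of_forall fun x => (hab x).1))
  have hT : Tendsto (fun x => (γ * n / lam * V x + 2 + 2 / lam * V x - γ * (x * deriv V x))
      / (1 + V x)) atTop (𝓝 ((γ * n / lam * v + 2 + 2 / lam * v - γ * 0) / (1 + v))) :=
    ((((hV.const_mul _).add_const 2).add (hV.const_mul _)).sub
      (h.tendsto_mul_deriv_V.const_mul γ)).div (hV.const_add 1) hv1.ne'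
  -- The quotient in `hT` is the logarithmic derivative x(RC²)'/(RC²) wherever C ≠ 0. For this value
  -- of v the numerator factors as (2/λ)(1+v), so the limit does not depend on γ or n.
  have hlim : (γ * n / lam * v + 2 + 2 / lam * v - γ * 0) / (1 + v) = 2 / lam := by
    have : γ * n / lam * v = -(2 * (lam - 1) / lam) := by rw [hv]; field_simp
    rw [this, div_eq_iff hv1.ne']
    field_simp
    ring
  rw [hlim] at hT
  obtain ⟨X, hX⟩ := eventually_atTop.1 ((hT.eventually (gt_mem_nhds hq)).and
    ((eventually_gt_atTop B).and (eventually_ge_atTop 1)))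
  have hX1 := (hX X le_rfl).2
  have hmem : ∀ x ∈ Ici X, x ∈ flowRegion B := fun x hx => Or.inr (hX x hx).2.1
  have hd : ∀ x ∈ Ici X, HasDerivAt (fun x => R x * C x ^ 2 * x ^ (-q))
      ((deriv R x * C x ^ 2 + R x * (2 * C x * deriv C x)) * x ^ (-q)
        + R x * C x ^ 2 * (-q * x ^ (-q - 1))) x := by
    intro x hx
    have hx0 : 0 < x := one_pos.trans_le (hX x hx).2.2
    refine (((hasDerivAt_of_contDiffOn h.sol.smooth_R (hmem x hx)).fun_mul
      ((hasDerivAt_of_contDiffOn h.sol.smooth_C (hmem x hx)).fun_pow 2)).fun_mul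
      (Real.hasDerivAt_rpow_const (Or.inl hx0.ne'))).congr_deriv ?_
    push_cast
    ring
  have hanti : AntitoneOn (fun x => R x * C x ^ 2 * x ^ (-q)) (Ici X) := by
    refine antitoneOn_of_hasDerivWithinAt_nonpos (convex_Ici X)
      (fun z hz => (hd z hz).continuousAt.continuousWithinAt)
      (fun z hz => (hd z (interior_subset hz)).hasDerivWithinAt) (fun x hx => ?_)
    have hx' : X ≤ x := interior_subset hx
    have hx0 : 0 < x := one_pos.trans_le (hX x hx').2.2
    have hR : 0 < R x := h.R_pos (by linarith) (hX x hx').2.1.ne'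
    have hV1 := h.one_add_V_pos x
    have e1 := h.sol.ode_R x (hmem x hx')
    have e2 := h.entropy_eq (hmem x hx') hx0.ne'
    have hrate := (hX x hx').1
    rw [div_lt_iff₀ hV1] at hrate
    -- C² times the mass equation plus 2RC times the entropy equation.
    have key : x * (1 + V x) * (deriv R x * C x ^ 2 + R x * (2 * C x * deriv C x))
        = R x * C x ^ 2 * (γ * n / lam * V x + 2 + 2 / lam * V x - γ * (x * deriv V x)) := by
      linear_combination C x ^ 2 * e1 + 2 * R x * C x * e2
    have hle : x * (deriv R x * C x ^ 2 + R x * (2 * C x * deriv C x)) ≤ q * (R x * C x ^ 2) := by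
      refine le_of_mul_le_mul_left ?_ hV1
      have := mul_le_mul_of_nonneg_left hrate.le (by positivity : 0 ≤ R x * C x ^ 2)
      nlinarith
    have hp : x ^ (-q) = x * x ^ (-q - 1) := by
      rw [mul_comm, ← Real.rpow_add_one hx0.ne']; ring_nf
    rw [hp]
    have : 0 < x ^ (-q - 1) := Real.rpow_pos_of_pos hx0 _
    nlinarith
  refine ⟨R X * C X ^ 2 * X ^ (-q), X, hX1.1, hX1.2, ?_, fun x hx => ?_⟩
  · have := h.R_pos (x := X) (by linarith) hX1.1.ne'
    have := Real.rpow_nonneg (zero_le_one.trans hX1.2) (-q)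
    positivity
  · have hx0 : 0 < x := by linarith
    have := hanti (mem_Ici.2 le_rfl) (mem_Ici.2 hx.le) hx.le
    simp only at this
    rw [Real.rpow_neg hx0.le, ← div_eq_mul_inv,
      div_le_iff₀ (Real.rpow_pos_of_pos hx0 q)] at this
    exact this

end IsSimilarityShockFlow

/-- The properties of a self-similar flow `ρ = R(x)`, `u = r^(1-λ) w(x)`, `e = r^(2-2λ) ε(x)`,
`x = t / r^λ`, that make it a weak solution with amplitude blowup: regularity off `x = -1, B`,
bounds, and the conservation laws in the similarity variable. -/
structure IsSimilarityFlow (n : ℕ) (γ lam B : ℝ) (R w ε : ℝ → ℝ) : Prop where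
  dim : n = 2 ∨ n = 3
  one_lt_γ : 1 < γ
  one_lt_lam : 1 < lam
  lam_lt : lam < 1 + (n : ℝ) / 2
  B_pos : 0 < B
  continuousAt_R : ∀ x, x ≠ -1 → x ≠ B → ContinuousAt R x
  continuousAt_w : ∀ x, x ≠ -1 → x ≠ B → ContinuousAt w x
  continuousAt_ε : ∀ x, x ≠ -1 → x ≠ B → ContinuousAt ε x
  R_pos : ∀ x, x ≠ -1 → x ≠ B → 0 < R x
  ε_nonneg : ∀ x, 0 ≤ ε x
  w_zero : w 0 ≠ 0
  ε_zero : 0 < ε 0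
  R_le : ∃ K, ∀ x, |R x| ≤ K
  w_le : ∃ K, ∀ x, |w x| ≤ K ∧ |x * w x| ≤ K
  p_le : ∃ K, ∀ x, |idealPressure γ (R x) (ε x)| ≤ K ∧
    (x ≠ 0 → |idealPressure γ (R x) (ε x)| ≤ K * |x| ^ (-(3 * (lam - 1) / (2 * lam))))
  mass : HasWeakDeriv (fun x => R x - lam * x * (R x * w x)) (fun x => -(n * (R x * w x)))
  momentum : HasWeakDeriv
    (fun x => R x * w x - lam * x * (R x * w x ^ 2 + idealPressure γ (R x) (ε x)))
    (fun x => (n - 1) * idealPressure γ (R x) (ε x)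
      - (n + 1 - lam) * (R x * w x ^ 2 + idealPressure γ (R x) (ε x)))
  energy : HasWeakDeriv
    (fun x => R x * (ε x + w x ^ 2 / 2)
      - lam * x * ((R x * (ε x + w x ^ 2 / 2) + idealPressure γ (R x) (ε x)) * w x))
    (fun x => -((n + 2 - 2 * lam)
      * ((R x * (ε x + w x ^ 2 / 2) + idealPressure γ (R x) (ε x)) * w x)))

theorem locallyIntegrable_of_measurable_of_abs_le {h : ℝ → ℝ} (hm : Measurable h) {K : ℝ}
    (hK : ∀ x, |h x| ≤ K) : LocallyIntegrable h :=
  (locallyIntegrable_const K).mono hm.aestronglyMeasurable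
    (ae_of_all _ fun x => (hK x).trans (le_abs_self K))

/-! ### The Rankine–Hugoniot relations in conservative form. -/

namespace IsSimilarityJump

variable {γ V₀ C₀ R₀ V₁ C₁ R₁ : ℝ}

/-- The velocities on the two sides parametrize the jump: C₀², C₁² and R₁/R₀ are rational in V₀ and
V₁. The continuity of the fluxes thereby becomes an algebraic identity. -/
theorem sound_ahead (hj : IsSimilarityJump γ V₀ C₀ R₀ V₁ C₁ R₁) (hγ : 1 < γ) (h0 : 0 < 1 + V₀) :
    C₀ ^ 2 = (1 + V₀) * ((γ + 1) * (1 + V₁) - (γ - 1) * (1 + V₀)) / 2 := by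
  have e := hj.velocity
  have : γ + 1 ≠ 0 := by linarith
  rw [e]
  field_simp
  ring

theorem sound_behind (hj : IsSimilarityJump γ V₀ C₀ R₀ V₁ C₁ R₁) (hγ : 1 < γ) (h0 : 0 < 1 + V₀) :
    C₁ ^ 2 = (1 + V₁) * ((γ + 1) * (1 + V₀) - (γ - 1) * (1 + V₁)) / 2 := by
  rw [hj.sound, hj.sound_ahead hγ h0]
  ring

theorem density_behind (hj : IsSimilarityJump γ V₀ C₀ R₀ V₁ C₁ R₁) (h1 : 0 < 1 + V₁) :
    R₁ = R₀ * (1 + V₀) / (1 + V₁) := by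
  rw [eq_div_iff h1.ne', hj.density]

theorem momentum (hj : IsSimilarityJump γ V₀ C₀ R₀ V₁ C₁ R₁) (hγ : 1 < γ) (h0 : 0 < 1 + V₀)
    (h1 : 0 < 1 + V₁) : R₁ * (V₁ * (1 + V₁) + C₁ ^ 2 / γ) = R₀ * (V₀ * (1 + V₀) + C₀ ^ 2 / γ) := by
  rw [hj.sound_ahead hγ h0, hj.sound_behind hγ h0, hj.density_behind h1]
  have : γ ≠ 0 := by linarith
  field_simp
  ring

theorem energy (hj : IsSimilarityJump γ V₀ C₀ R₀ V₁ C₁ R₁) (hγ : 1 < γ) (h0 : 0 < 1 + V₀)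
    (h1 : 0 < 1 + V₁) :
    R₁ * ((C₁ ^ 2 / (γ * (γ - 1)) + V₁ ^ 2 / 2) * (1 + V₁) + C₁ ^ 2 * V₁ / γ)
      = R₀ * ((C₀ ^ 2 / (γ * (γ - 1)) + V₀ ^ 2 / 2) * (1 + V₀) + C₀ ^ 2 * V₀ / γ) := by
  rw [hj.sound_ahead hγ h0, hj.sound_behind hγ h0, hj.density_behind h1]
  have : γ ≠ 0 := by linarith
  have : γ - 1 ≠ 0 := by linarith
  field_simp
  ring

end IsSimilarityJump

/-! ### Weak conservation laws for the profiles on the whole line. -/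

namespace IsSimilarityShockFlow

variable {n : ℕ} {γ lam B : ℝ} {R V C : ℝ → ℝ} {ℓ L : ℝ}

/-- Only -1, 0 and B are exceptional. `g` is the form of `H` in V and C: it may be singular at 0,
where continuity is asked of `H` instead, and at the two shocks its one-sided limits must fit. -/
theorem hasWeakDeriv (h : IsSimilarityShockFlow n γ lam B R V C ℓ L) {H g h' : ℝ → ℝ} {c : ℝ}
    (hq : ∀ x < -1, H x = c) (hq' : ∀ x < -1, h' x = 0) (hg : ∀ x, x ≠ 0 → H x = g x)
    (hd : ∀ x ∈ flowRegion B, x ≠ 0 → HasDerivAt g (h' x) x) (h0 : ContinuousAt H 0)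
    (h1 : Tendsto g (𝓝[>] (-1)) (𝓝 c))
    (hB : ∃ l, Tendsto g (𝓝[<] B) (𝓝 l) ∧ Tendsto g (𝓝[>] B) (𝓝 l))
    (hm : Measurable h') {K : ℝ} (hK : ∀ x, |h' x| ≤ K) : HasWeakDeriv H h' := by
  have heq : ∀ x, x ≠ 0 → g =ᶠ[𝓝 x] H := fun x hx => by
    filter_upwards [isOpen_compl_singleton.mem_nhds hx] with y hy using (hg y hy).symm
  refine hasWeakDeriv_of_hasDerivAt_off_finite (s := {-1, 0, B}) (by simp) ?_ ?_
    (locallyIntegrable_of_measurable_of_abs_le hm hK)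
  · intro x hx
    simp only [mem_insert_iff, mem_singleton_iff, not_or] at hx
    rcases lt_or_gt_of_ne hx.1 with hx1 | hx1
    · have : H =ᶠ[𝓝 x] fun _ => c := by
        filter_upwards [Iio_mem_nhds hx1] with y hy using hq y hy
      rw [hq' x hx1]
      exact (hasDerivAt_const x c).congr_of_eventuallyEq this
    · exact (hd x ((mem_flowRegion_iff h.sol.B_pos).2 ⟨hx1, hx.2.2⟩) hx.2.1).congr_of_eventuallyEq
        (heq x hx.2.1).symm
  · intro x hx
    simp only [mem_insert_iff, mem_singleton_iff] at hx
    rcases hx with rfl | rfl | rfl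
    · refine ⟨c, ?_⟩
      rw [← nhdsLT_sup_nhdsGT, tendsto_sup]
      exact ⟨tendsto_left_neg_one hq,
        h1.congr' ((heq _ (by norm_num)).filter_mono nhdsWithin_le_nhds)⟩
    · exact ⟨_, h0.tendsto.mono_left nhdsWithin_le_nhds⟩
    · obtain ⟨l, hl1, hl2⟩ := hB
      refine ⟨l, ?_⟩
      have := heq x h.sol.B_pos.ne'
      rw [← nhdsLT_sup_nhdsGT, tendsto_sup]
      exact ⟨hl1.congr' (this.filter_mono nhdsWithin_le_nhds),
        hl2.congr' (this.filter_mono nhdsWithin_le_nhds)⟩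

theorem measurable_of_continuousAt {f : ℝ → ℝ} {B : ℝ}
    (hf : ∀ x, x ≠ -1 → x ≠ B → ContinuousAt f x) : Measurable f := by
  refine measurable_of_continuousAt_off_finite (s := {-1, B}) (by simp) fun x hx => ?_
  simp only [mem_insert_iff, mem_singleton_iff, not_or] at hx
  exact hf x hx.1 hx.2

theorem pressure_eq (h : IsSimilarityShockFlow n γ lam B R V C ℓ L) {x : ℝ} (hx : x ≠ 0) :
    idealPressure γ (R x) (speedProfile lam C L x ^ 2 / (γ * (γ - 1)))
      = R x * (C x / (lam * x)) ^ 2 / γ := by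
  rw [idealPressure, speedProfile_of_ne hx]
  have := h.lam_pos.ne'
  have := h.γ_pos.ne'
  have hg1 : γ - 1 ≠ 0 := by linarith [h.one_lt_γ]
  field_simp

theorem exists_abs_pressure_le (h : IsSimilarityShockFlow n γ lam B R V C ℓ L) :
    ∃ K, ∀ x, |idealPressure γ (R x) (speedProfile lam C L x ^ 2 / (γ * (γ - 1)))| ≤ K ∧
    (x ≠ 0 → |idealPressure γ (R x) (speedProfile lam C L x ^ 2 / (γ * (γ - 1)))|
      ≤ K * |x| ^ (-(3 * (lam - 1) / (2 * lam)))) := by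
  have hl := h.lam_pos
  have hl1 : 0 < lam - 1 := by linarith [h.one_lt_lam]
  have hg := h.γ_pos
  have hg1 : 0 < γ - 1 := by linarith [h.one_lt_γ]
  set θ := -(3 * (lam - 1) / (2 * lam)) with hθ
  have hθ0 : θ < 0 := by
    rw [hθ, neg_lt_zero]; positivity
  -- θ is three quarters of the limiting exponent -2(λ-1)/λ. The remaining quarter is the slack that
  -- the growth estimate for RC² needs; division by x² then gives the decay of the pressure.
  have hq : 2 / lam < 2 + θ := by
    rw [hθ, div_lt_iff₀ hl]
    field_simp
    linarith
  obtain ⟨K, X, hBX, hX1, hK0, hK⟩ := h.exists_pressure_growth hq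
  obtain ⟨KR, hKR⟩ := h.exists_abs_R_le
  obtain ⟨Kk, hKk⟩ := exists_abs_le_on_Icc_of_eventually h.exists_eventually_abs_k_le (-1) X
  have hX0 : 0 < X := by linarith
  have hKR0 : 0 ≤ KR := (abs_nonneg _).trans (hKR 0)
  set p := fun x => idealPressure γ (R x) (speedProfile lam C L x ^ 2 / (γ * (γ - 1))) with hp
  set K₁ := (γ - 1) * KR * (Kk ^ 2 / (γ * (γ - 1))) with hK₁
  have hK₁0 : 0 ≤ K₁ := by positivity
  have hlow : ∀ x ≤ X, |p x| ≤ K₁ := by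
    intro x hx
    rcases lt_or_ge x (-1) with hx1 | hx1
    · have : p x = 0 := by
        simp only [hp]
        rw [h.pressure_eq (by linarith), (h.sol.quiescent x hx1).2.2]
        simp
      rw [this, abs_zero]
      exact hK₁0
    · simp only [hp, idealPressure]
      rw [abs_mul, abs_mul, abs_of_pos hg1, abs_of_nonneg (by positivity :
        0 ≤ speedProfile lam C L x ^ 2 / (γ * (γ - 1)))]
      have h1 := hKR x
      have h2 : speedProfile lam C L x ^ 2 ≤ Kk ^ 2 := sq_le_sq' (by
        linarith [(abs_le.1 (hKk x ⟨hx1, hx⟩)).1]) (abs_le.1 (hKk x ⟨hx1, hx⟩)).2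
      rw [hK₁]
      gcongr
  have hhigh : ∀ x, X < x → |p x| ≤ K / (lam ^ 2 * γ) * |x| ^ θ := by
    intro x hx
    have hx0 : 0 < x := by linarith
    have hR := h.R_pos (x := x) (by linarith) (by linarith)
    simp only [hp]
    rw [h.pressure_eq hx0.ne', abs_of_nonneg (by positivity), abs_of_pos hx0]
    have e : x ^ (2 + θ) = x ^ 2 * x ^ θ := by
      rw [Real.rpow_add hx0, Real.rpow_two]
    have := hK x hx
    rw [e] at this
    calc R x * (C x / (lam * x)) ^ 2 / γ = (R x * C x ^ 2) / (lam ^ 2 * γ * x ^ 2) := by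
          field_simp
      _ ≤ (K * (x ^ 2 * x ^ θ)) / (lam ^ 2 * γ * x ^ 2) := by gcongr
      _ = _ := by field_simp
  have hXθ : 0 < X ^ θ := Real.rpow_pos_of_pos hX0 _
  have hXθ1 : X ^ θ ≤ 1 := Real.rpow_le_one_of_one_le_of_nonpos hX1 hθ0.le
  have h5 : K₁ ≤ K₁ / X ^ θ := by
    rw [le_div_iff₀ hXθ]
    exact mul_le_of_le_one_right hK₁0 hXθ1
  -- Since θ < 0, X^θ ≤ |x|^θ whenever |x| ≤ X. Dividing K₁ by X^θ ≤ 1 therefore lets one constant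
  -- serve both the uniform bound and the decay bound.
  refine ⟨max (K₁ / X ^ θ) (K / (lam ^ 2 * γ)), fun x => ?_⟩
  rcases le_or_gt x X with hx | hx
  · refine ⟨((hlow x hx).trans h5).trans (le_max_left _ _), fun hx0 => ?_⟩
    have hxpos : 0 < |x| := abs_pos.2 hx0
    rcases lt_or_ge x (-1) with hx1 | hx1
    · have : p x = 0 := by
        simp only [hp]
        rw [h.pressure_eq (by linarith), (h.sol.quiescent x hx1).2.2]
        simp
      change |p x| ≤ _
      rw [this, abs_zero]
      positivity
    · have hxX : |x| ≤ X := abs_le.2 ⟨by linarith, hx⟩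
      have h6 : X ^ θ ≤ |x| ^ θ := Real.rpow_le_rpow_of_nonpos hxpos hxX hθ0.le
      calc |p x| ≤ K₁ := hlow x hx
        _ = K₁ / X ^ θ * X ^ θ := by field_simp
        _ ≤ max (K₁ / X ^ θ) (K / (lam ^ 2 * γ)) * |x| ^ θ := by
          gcongr
          exact le_max_left _ _
  · have hx1 : 1 ≤ |x| := (hX1.trans hx.le).trans (le_abs_self x)
    have h7 : |x| ^ θ ≤ 1 := Real.rpow_le_one_of_one_le_of_nonpos hx1 hθ0.le
    have h8 : 0 ≤ |x| ^ θ := by positivity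
    have h9 : 0 ≤ K / (lam ^ 2 * γ) := by positivity
    refine ⟨(hhigh x hx).trans ((mul_le_of_le_one_right h9 h7).trans (le_max_right _ _)),
      fun _ => (hhigh x hx).trans ?_⟩
    gcongr
    exact le_max_right _ _

theorem isSimilarityFlow (h : IsSimilarityShockFlow n γ lam B R V C ℓ L) :
    IsSimilarityFlow n γ lam B R (speedProfile lam V ℓ)
      (fun x => speedProfile lam C L x ^ 2 / (γ * (γ - 1))) := by
  have hl := h.lam_pos
  have hl0 := hl.ne'
  have hg := h.γ_pos
  have hg0 := hg.ne'
  have hg1 : 0 < γ - 1 := by linarith [h.one_lt_γ]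
  have hg10 := hg1.ne'
  set w := speedProfile lam V ℓ with hw
  set ε := fun x => speedProfile lam C L x ^ 2 / (γ * (γ - 1)) with hε
  have cR : ∀ x, x ≠ -1 → x ≠ B → ContinuousAt R x := fun x h1 h2 => h.continuousAt_R h1 h2
  have cw : ∀ x, x ≠ -1 → x ≠ B → ContinuousAt w x := fun x h1 h2 => h.continuousAt_w h1 h2
  have cε : ∀ x, x ≠ -1 → x ≠ B → ContinuousAt ε x := fun x h1 h2 =>
    ((h.continuousAt_k h1 h2).pow 2).div_const _
  have mR : Measurable R := measurable_of_continuousAt cR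
  have mw : Measurable w := measurable_of_continuousAt cw
  have mε : Measurable ε := measurable_of_continuousAt cε
  have cR0 := cR 0 (by norm_num) h.sol.B_pos.ne
  have cw0 := cw 0 (by norm_num) h.sol.B_pos.ne
  have cε0 := cε 0 (by norm_num) h.sol.B_pos.ne
  have wq : ∀ x < -1, w x = 0 := fun x hx => by
    rw [hw, speedProfile_of_ne (by linarith), (h.sol.quiescent x hx).2.1]; simp
  have εq : ∀ x < -1, ε x = 0 := fun x hx => by
    simp only [hε]
    rw [speedProfile_of_ne (by linarith), (h.sol.quiescent x hx).2.2]; simp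
  have wx : ∀ x, x ≠ 0 → w x = -(V x / x) / lam := fun x hx => by rw [hw, speedProfile_of_ne hx]
  have εx : ∀ x, x ≠ 0 → ε x = (C x / (lam * x)) ^ 2 / (γ * (γ - 1)) := fun x hx => by
    simp only [hε]
    rw [speedProfile_of_ne hx]
    field_simp
  have px : ∀ x, x ≠ 0 → idealPressure γ (R x) (ε x) = R x * (C x / (lam * x)) ^ 2 / γ :=
    fun x hx => h.pressure_eq hx
  have hB0 := h.sol.B_pos.ne'
  obtain ⟨V₀, C₀, R₀, V₁, C₁, R₁, hV₀, hC₀, hR₀, hV₁, hC₁, hR₁, hj, p0, p1, -⟩ := h.reflected_pos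
  obtain ⟨Kw, hKw⟩ := h.exists_abs_w_le
  obtain ⟨KR, hKR⟩ := h.exists_abs_R_le
  obtain ⟨Kp, hKp⟩ := h.exists_abs_pressure_le
  have hKw0 : 0 ≤ Kw := (abs_nonneg _).trans (hKw 0).1
  have hKR0 : 0 ≤ KR := (abs_nonneg _).trans (hKR 0)
  have iV := h.sol.init_V
  have iC := h.sol.init_C
  have iR := h.sol.init_R
  have hinit : (Real.sqrt (2 * γ * (γ - 1)) / (γ + 1)) ^ 2 = 2 * γ * (γ - 1) / (γ + 1) ^ 2 := by
    rw [div_pow, Real.sq_sqrt (by positivity)]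
  have hgp : γ + 1 ≠ 0 := by linarith
  have hid : ∀ (a : ℝ) (s : Set ℝ), Tendsto (fun x : ℝ => lam * x) (𝓝[s] a) (𝓝 (lam * a)) :=
    fun a s => (tendsto_id.mono_left nhdsWithin_le_nhds).const_mul lam
  have bw : ∀ x, |w x| ≤ Kw := fun x => (hKw x).1
  have bRw : ∀ x, |R x * w x| ≤ KR * Kw := fun x => by
    rw [abs_mul]; exact mul_le_mul (hKR x) (bw x) (abs_nonneg _) hKR0
  have bRw2 : ∀ x, |R x * w x ^ 2| ≤ KR * Kw * Kw := fun x => by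
    rw [pow_two, ← mul_assoc, abs_mul]
    exact mul_le_mul (bRw x) (bw x) (abs_nonneg _) (by positivity)
  have bp : ∀ x, |idealPressure γ (R x) (ε x)| ≤ Kp := fun x => (hKp x).1
  have hKp0 : 0 ≤ Kp := (abs_nonneg _).trans (bp 0)
  have mp : Measurable fun x => idealPressure γ (R x) (ε x) := by
    unfold idealPressure; fun_prop
  have cp0 : ContinuousAt (fun x => idealPressure γ (R x) (ε x)) 0 := by
    unfold idealPressure; fun_prop
  refine ⟨h.dim, h.one_lt_γ, h.one_lt_lam, h.lam_lt, h.sol.B_pos, cR, cw, cε,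
    fun x h1 h2 => h.R_pos h1 h2, fun x => by positivity, ?_, ?_, ⟨KR, hKR⟩, ⟨Kw, hKw⟩,
    ⟨Kp, hKp⟩, ?_, ?_, ?_⟩
  · rw [hw, speedProfile_zero]
    have := h.ℓ_pos
    exact div_ne_zero (by linarith) hl0
  · simp only [hε]
    rw [speedProfile_zero]
    have := h.L_neg
    have : -L / lam ≠ 0 := div_ne_zero (by linarith) hl0
    positivity
  · refine h.hasWeakDeriv (g := fun x => R x * (1 + V x)) (c := 1) (K := n * (KR * Kw))
      ?_ ?_ ?_ ?_ ?_ h.massFlux_tendsto_neg_one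
      ⟨R₀ * (1 + V₀), hR₀.mul (hV₀.const_add 1), ?_⟩ (by fun_prop) ?_
    · intro x hx
      rw [wq x hx, (h.sol.quiescent x hx).1]; simp
    · intro x hx
      rw [wq x hx]; simp
    · intro x hx
      simp only [wx x hx]
      field_simp
      ring
    · intro x hx _
      refine (h.hasDerivAt_massFlux hx).congr_deriv ?_
      ring
    · fun_prop
    · rw [← hj.density]
      exact hR₁.mul (hV₁.const_add 1)
    · intro x
      rw [abs_neg, abs_mul, Nat.abs_cast]
      have := bRw x
      gcongr
  · refine h.hasWeakDeriv
      (g := fun x => -(R x / (lam * x)) * (V x * (1 + V x) + C x ^ 2 / γ)) (c := 0)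
      (K := |(n : ℝ) - 1| * Kp + |n + 1 - lam| * (KR * Kw * Kw + Kp)) ?_ ?_ ?_ ?_ ?_ ?_
      ⟨-(R₀ / (lam * B)) * (V₀ * (1 + V₀) + C₀ ^ 2 / γ), ?_, ?_⟩ (by fun_prop) ?_
    · intro x hx
      rw [wq x hx, εq x hx]; simp [idealPressure]
    · intro x hx
      rw [wq x hx, εq x hx]; simp [idealPressure]
    · intro x hx
      simp only [wx x hx, px x hx]
      field_simp
      ring
    · intro x hx hx0
      refine (h.hasDerivAt_momentumFlux hx hx0).congr_deriv ?_
      simp only [wx x hx0, px x hx0]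
      field_simp
      ring
    · fun_prop
    -- For the state behind the converging shock, V(1+V) = -2(γ-1)/(γ+1)² cancels C²/γ, in agreement
    -- with zero velocity and pressure ahead.
    · have := ((iR.div (hid (-1) _) (by simpa using hl0)).neg).mul
        ((iV.mul (iV.const_add 1)).add ((iC.pow 2).div_const γ))
      refine this.mono_right (le_of_eq (congrArg 𝓝 ?_))
      rw [hinit]
      field_simp
      ring
    · exact ((hR₀.div (hid B _) (by positivity)).neg).mul
        ((hV₀.mul (hV₀.const_add 1)).add ((hC₀.pow 2).div_const γ))
    · have := ((hR₁.div (hid B _) (by positivity)).neg).mul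
        ((hV₁.mul (hV₁.const_add 1)).add ((hC₁.pow 2).div_const γ))
      refine this.mono_right (le_of_eq (congrArg 𝓝 ?_))
      have e := hj.momentum h.one_lt_γ p0 p1
      rw [neg_mul, neg_mul, div_mul_eq_mul_div, div_mul_eq_mul_div, e]
    · intro x
      refine (abs_sub _ _).trans ?_
      rw [abs_mul, abs_mul]
      have h1 := bp x
      have h2 : |R x * w x ^ 2 + idealPressure γ (R x) (ε x)| ≤ KR * Kw * Kw + Kp :=
        (abs_add_le _ _).trans (add_le_add (bRw2 x) h1)
      gcongr
  -- The available bounds concern the product Rε, that is the pressure, and not ε alone, so the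
  -- enthalpy is written through p and the kinetic energy.
  · have hE : ∀ x, R x * (ε x + w x ^ 2 / 2) + idealPressure γ (R x) (ε x)
        = (1 / (γ - 1) + 1) * idealPressure γ (R x) (ε x) + R x * w x ^ 2 / 2 := fun x => by
      unfold idealPressure
      field_simp
      ring
    refine h.hasWeakDeriv
      (g := fun x => R x / (lam * x) ^ 2 * ((C x ^ 2 / (γ * (γ - 1)) + V x ^ 2 / 2)
        * (1 + V x) + C x ^ 2 * V x / γ)) (c := 0)
      (K := |n + 2 - 2 * lam| * (((1 / (γ - 1) + 1) * Kp + KR * Kw * Kw / 2) * Kw))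
      ?_ ?_ ?_ ?_ ?_ ?_
      ⟨R₀ / (lam * B) ^ 2 * ((C₀ ^ 2 / (γ * (γ - 1)) + V₀ ^ 2 / 2)
        * (1 + V₀) + C₀ ^ 2 * V₀ / γ), ?_, ?_⟩ (by fun_prop) ?_
    · intro x hx
      rw [wq x hx, εq x hx]; simp
    · intro x hx
      rw [wq x hx]; simp
    · intro x hx
      simp only [px x hx]
      simp only [wx x hx, εx x hx]
      field_simp
      ring
    · intro x hx hx0
      refine (h.hasDerivAt_energyFlux hx hx0).congr_deriv ?_
      simp only [px x hx0]
      simp only [wx x hx0, εx x hx0]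
      field_simp
    · fun_prop
    · have := (iR.div ((hid (-1) _).pow 2) (by simpa using hl0)).mul
        (((((iC.pow 2).div_const (γ * (γ - 1))).add ((iV.pow 2).div_const 2)).mul
          (iV.const_add 1)).add (((iC.pow 2).mul iV).div_const γ))
      refine this.mono_right (le_of_eq (congrArg 𝓝 ?_))
      rw [hinit]
      field_simp
      ring
    · exact (hR₀.div ((hid B _).pow 2) (by positivity)).mul
        (((((hC₀.pow 2).div_const (γ * (γ - 1))).add ((hV₀.pow 2).div_const 2)).mul
          (hV₀.const_add 1)).add (((hC₀.pow 2).mul hV₀).div_const γ))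
    · have := (hR₁.div ((hid B _).pow 2) (by positivity)).mul
        (((((hC₁.pow 2).div_const (γ * (γ - 1))).add ((hV₁.pow 2).div_const 2)).mul
          (hV₁.const_add 1)).add (((hC₁.pow 2).mul hV₁).div_const γ))
      refine this.mono_right (le_of_eq (congrArg 𝓝 ?_))
      have e := hj.energy h.one_lt_γ p0 p1
      rw [div_mul_eq_mul_div, div_mul_eq_mul_div, e]
    · intro x
      rw [abs_neg, abs_mul, abs_mul, hE]
      have h1 := bp x
      have h2 : |(1 / (γ - 1) + 1) * idealPressure γ (R x) (ε x) + R x * w x ^ 2 / 2|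
          ≤ (1 / (γ - 1) + 1) * Kp + KR * Kw * Kw / 2 := by
        refine (abs_add_le _ _).trans ?_
        rw [abs_mul, abs_div, abs_two, abs_of_pos (by positivity : 0 < 1 / (γ - 1) + 1)]
        have := bRw2 x
        gcongr
      have h3 := bw x
      gcongr

end IsSimilarityShockFlow

/-! ### Self-similar functions in radial Lebesgue spaces -/

theorem integrableOn_Ioc_rpow {p A : ℝ} (hp : -1 < p) (hA : 0 ≤ A) :
    IntegrableOn (fun r : ℝ => r ^ p) (Ioc 0 A) :=
  (intervalIntegrable_iff_integrableOn_Ioc_of_le hA).1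
    (intervalIntegral.intervalIntegrable_rpow' hp)

theorem integrableOn_Icc_abs_rpow {p T : ℝ} (hp : -1 < p) (hT : 0 ≤ T) :
    IntegrableOn (fun t : ℝ => |t| ^ p) (Icc (-T) T) := by
  have h1 : IntervalIntegrable (fun t : ℝ => |t| ^ p) volume 0 T := by
    rw [intervalIntegrable_iff_integrableOn_Ioc_of_le hT]
    refine (integrableOn_Ioc_rpow hp hT).congr_fun (fun x hx => ?_) measurableSet_Ioc
    simp only [abs_of_pos hx.1]
  have h2 : IntervalIntegrable (fun t : ℝ => |t| ^ p) volume (-T) 0 := by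
    have := (IntervalIntegrable.iff_comp_neg (f := fun t : ℝ => |t| ^ p) (a := 0) (b := T)).1 h1
    simp only [abs_neg, neg_zero] at this
    exact this.symm
  rw [integrableOn_Icc_iff_integrableOn_Ioc,
    ← intervalIntegrable_iff_integrableOn_Ioc_of_le (by linarith)]
  exact h2.trans h1

theorem volume_restrict_prod (s t : Set ℝ) :
    (volume : Measure (ℝ × ℝ)).restrict (s ×ˢ t) =
      (volume.restrict s).prod (volume.restrict t) := by
  rw [Measure.volume_eq_prod, Measure.prod_restrict]

theorem RadialL1Loc.congr {m : ℕ} {f g : ℝ → ℝ → ℝ} (hf : RadialL1Loc m f)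
    (h : ∀ t r, 0 < r → f t r = g t r) : RadialL1Loc m g := fun T A hT hA =>
  (hf T A hT hA).congr_fun (fun q hq => by simp only [h q.1 q.2 hq.2.1])
    (measurableSet_Icc.prod measurableSet_Ioc)

theorem ContInRadialL1Loc.congr {m : ℕ} {f g : ℝ → ℝ → ℝ} (hf : ContInRadialL1Loc m f)
    (h : ∀ t r, 0 < r → f t r = g t r) : ContInRadialL1Loc m g := by
  intro A hA
  refine ⟨fun t => ((hf A hA).1 t).congr_fun (fun r hr => by simp only [h t r hr.1])
    measurableSet_Ioc, fun t₀ => ((hf A hA).2 t₀).congr fun t => ?_⟩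
  exact setIntegral_congr_fun measurableSet_Ioc
    fun r hr => by simp only [h t r hr.1, h t₀ r hr.1]

/-- Inserting x = t/r^λ in the bound separates the variables: the integrand is dominated by K |t|^η
r^(β+m-λη), integrable when both exponents exceed -1. Decay in x, η < 0, buys integrability at r =
0. -/
theorem radialL1Loc_selfSimilar {m : ℕ} {lam β η K : ℝ} {Q : ℝ → ℝ} (hQ : Measurable Q)
    (hb : ∀ x, x ≠ 0 → |Q x| ≤ K * |x| ^ η) (hη : -1 < η) (hβ : -1 < β + m - lam * η) :
    RadialL1Loc m (fun t r => r ^ β * Q (t / r ^ lam)) := by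
  intro T A hT hA
  have hdom : IntegrableOn (fun q : ℝ × ℝ => |q.1| ^ η * (K * q.2 ^ (β + m - lam * η)))
      (Icc (-T) T ×ˢ Ioc 0 A) := by
    rw [IntegrableOn, volume_restrict_prod]
    exact (integrableOn_Icc_abs_rpow hη hT.le).mul_prod
      ((integrableOn_Ioc_rpow hβ hA.le).const_mul K)
  refine Integrable.mono' hdom (by fun_prop) ?_
  have h0 : ∀ᵐ q : ℝ × ℝ ∂(volume.restrict (Icc (-T) T ×ˢ Ioc 0 A)), q.1 ≠ 0 := by
    refine ae_restrict_of_ae ?_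
    rw [Measure.volume_eq_prod]
    exact Measure.quasiMeasurePreserving_fst.ae (Measure.ae_ne volume 0)
  filter_upwards [h0, ae_restrict_mem (measurableSet_Icc.prod measurableSet_Ioc)] with q hq hq'
  have hr : 0 < q.2 := hq'.2.1
  have ht : 0 < |q.1| := abs_pos.2 hq
  have hrl : 0 < q.2 ^ lam := Real.rpow_pos_of_pos hr _
  have h1 := hb (q.1 / q.2 ^ lam) (div_ne_zero hq hrl.ne')
  rw [abs_div, abs_of_pos hrl, Real.div_rpow ht.le hrl.le, ← Real.rpow_mul hr.le] at h1
  rw [Real.norm_eq_abs, abs_mul, abs_mul, abs_of_pos (Real.rpow_pos_of_pos hr _),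
    abs_of_pos (pow_pos hr _)]
  calc q.2 ^ β * |Q (q.1 / q.2 ^ lam)| * q.2 ^ m
      ≤ q.2 ^ β * (K * (|q.1| ^ η / q.2 ^ (lam * η))) * q.2 ^ m := by gcongr
    _ = _ := by
      rw [Real.rpow_sub hr, Real.rpow_add hr, Real.rpow_natCast]
      ring

/-- Dominated convergence with majorant 2K r^(α+m): for fixed t₀, at most two radii lie on the shock
curves, and at every other r > 0 the profile is continuous at t₀/r^λ. -/
theorem contInRadialL1Loc_selfSimilar {m : ℕ} {lam α B K : ℝ} {Q : ℝ → ℝ} (hlam : 0 < lam)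
    (hB : 0 < B)
    (hQ : Measurable Q) (hc : ∀ x, x ≠ -1 → x ≠ B → ContinuousAt Q x) (hb : ∀ x, |Q x| ≤ K)
    (hα : -1 < α + m) : ContInRadialL1Loc m (fun t r => r ^ α * Q (t / r ^ lam)) := by
  have hrm : ∀ r : ℝ, 0 < r → r ^ α * r ^ m = r ^ (α + m) := fun r hr => by
    rw [Real.rpow_add hr, Real.rpow_natCast]
  have hKe : ∀ (t r : ℝ), 0 < r → |r ^ α * Q (t / r ^ lam)| ≤ K * r ^ α := fun t r hr => by
    rw [abs_mul, abs_of_pos (Real.rpow_pos_of_pos hr _), mul_comm]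
    have := hb (t / r ^ lam)
    have := Real.rpow_pos_of_pos hr α
    gcongr
  intro A hA
  refine ⟨fun t => ?_, fun t₀ => ?_⟩
  · refine Integrable.mono' ((integrableOn_Ioc_rpow hα hA.le).const_mul K) (by fun_prop) ?_
    filter_upwards [ae_restrict_mem measurableSet_Ioc] with r hr
    rw [Real.norm_eq_abs, abs_mul, abs_of_pos (pow_pos hr.1 _), ← hrm r hr.1, ← mul_assoc]
    exact mul_le_mul_of_nonneg_right (hKe t r hr.1) (pow_pos hr.1 _).le
  · rw [show 𝓝 (0 : ℝ) = 𝓝 (∫ r in Ioc 0 A, (0 : ℝ)) by simp]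
    refine tendsto_integral_filter_of_dominated_convergence (fun r => 2 * K * r ^ (α + m))
      (Eventually.of_forall fun t => by fun_prop) (Eventually.of_forall fun t => ?_)
      ((integrableOn_Ioc_rpow hα hA.le).const_mul (2 * K)) ?_
    · filter_upwards [ae_restrict_mem measurableSet_Ioc] with r hr
      rw [Real.norm_eq_abs, abs_mul, abs_abs, abs_of_pos (pow_pos hr.1 _), ← hrm r hr.1,
        ← mul_assoc]
      refine mul_le_mul_of_nonneg_right ?_ (pow_pos hr.1 _).le
      refine (abs_sub _ _).trans ?_
      linarith [hKe t r hr.1, hKe t₀ r hr.1]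
    · have hbad : ∀ᵐ r : ℝ ∂(volume.restrict (Ioc 0 A)), r ≠ (-t₀) ^ (lam⁻¹) ∧
          r ≠ (t₀ / B) ^ (lam⁻¹) :=
        ae_restrict_of_ae ((Measure.ae_ne volume _).and (Measure.ae_ne volume _))
      filter_upwards [hbad, ae_restrict_mem measurableSet_Ioc] with r hr hr'
      have hrl : 0 < r ^ lam := Real.rpow_pos_of_pos hr'.1 _
      have hinv : (r ^ lam) ^ lam⁻¹ = r := Real.rpow_rpow_inv hr'.1.le hlam.ne'
      have h1 : t₀ / r ^ lam ≠ -1 := fun h => hr.1 (by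
        rw [div_eq_iff hrl.ne'] at h
        rw [h, neg_mul, one_mul, neg_neg, hinv])
      have h2 : t₀ / r ^ lam ≠ B := fun h => hr.2 (by
        rw [div_eq_iff hrl.ne'] at h
        rw [h, mul_div_cancel_left₀ _ hB.ne', hinv])
      have h3 : Tendsto (fun t => Q (t / r ^ lam)) (𝓝 t₀) (𝓝 (Q (t₀ / r ^ lam))) :=
        (hc _ h1 h2).tendsto.comp ((continuous_id.div_const _).tendsto t₀)
      have h4 := (((h3.const_mul (r ^ α)).sub_const (r ^ α * Q (t₀ / r ^ lam))).abs).mul_const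
        (r ^ m)
      simpa using h4

/-! ### Test functions -/

/-- A `C¹` function on `ℝ × (0, ∞)`, bounded with its derivatives and of bounded support. -/
structure IsBoundedTest (ψ : ℝ × ℝ → ℝ) (T A K : ℝ) : Prop where
  T_pos : 0 < T
  A_pos : 0 < A
  contDiffOn : ContDiffOn ℝ 1 ψ (univ ×ˢ Ioi (0 : ℝ))
  eq_zero : ∀ t r : ℝ, 0 < r → (T < |t| ∨ A < r) → ψ (t, r) = 0
  abs_le : ∀ t r : ℝ, 0 < r → |ψ (t, r)| ≤ K
  norm_fderiv_le : ∀ t r : ℝ, 0 < r → ‖fderiv ℝ ψ (t, r)‖ ≤ K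

theorem isOpen_upperHalf : IsOpen ((univ : Set ℝ) ×ˢ Ioi (0 : ℝ)) := isOpen_univ.prod isOpen_Ioi

namespace IsBoundedTest

variable {ψ : ℝ × ℝ → ℝ} {T A K : ℝ}

theorem hasFDerivAt (h : IsBoundedTest ψ T A K) {t r : ℝ} (hr : 0 < r) :
    HasFDerivAt ψ (fderiv ℝ ψ (t, r)) (t, r) := by
  have : DifferentiableAt ℝ ψ (t, r) := (h.contDiffOn.differentiableOn one_ne_zero).differentiableAt
    (isOpen_upperHalf.mem_nhds ⟨mem_univ _, hr⟩)
  exact this.hasFDerivAt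

theorem hasDerivAt_comp (h : IsBoundedTest ψ T A K) {f g : ℝ → ℝ} {f' g' s : ℝ} (hg0 : 0 < g s)
    (hf : HasDerivAt f f' s) (hg : HasDerivAt g g' s) :
    HasDerivAt (fun s => ψ (f s, g s)) (fderiv ℝ ψ (f s, g s) (1, 0) * f'
      + fderiv ℝ ψ (f s, g s) (0, 1) * g') s := by
  refine ((h.hasFDerivAt hg0).comp_hasDerivAt s (hf.prodMk hg)).congr_deriv ?_
  have : ((f', g') : ℝ × ℝ) = f' • ((1, 0) : ℝ × ℝ) + g' • ((0, 1) : ℝ × ℝ) := by simp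
  rw [this, map_add, map_smul, map_smul, smul_eq_mul, smul_eq_mul]
  ring

theorem deriv_fst (h : IsBoundedTest ψ T A K) (t : ℝ) {r : ℝ} (hr : 0 < r) :
    deriv (fun s => ψ (s, r)) t = fderiv ℝ ψ (t, r) (1, 0) := by
  have := (h.hasDerivAt_comp (g := fun _ => r) hr (hasDerivAt_id t) (hasDerivAt_const t r)).deriv
  simpa using this

theorem deriv_snd (h : IsBoundedTest ψ T A K) (t : ℝ) {r : ℝ} (hr : 0 < r) :
    deriv (fun s => ψ (t, s)) r = fderiv ℝ ψ (t, r) (0, 1) := by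
  have := (h.hasDerivAt_comp (f := fun _ => t) (g := fun s => s) hr (hasDerivAt_const r t)
    (hasDerivAt_id r)).deriv
  simpa using this

theorem abs_fderiv_fst_le (h : IsBoundedTest ψ T A K) (t : ℝ) {r : ℝ} (hr : 0 < r) :
    |fderiv ℝ ψ (t, r) (1, 0)| ≤ K := by
  have := (fderiv ℝ ψ (t, r)).le_opNorm (1, 0)
  rw [Real.norm_eq_abs] at this
  refine (this.trans (le_of_eq ?_)).trans (h.norm_fderiv_le t r hr)
  simp [Prod.norm_def]

theorem abs_fderiv_snd_le (h : IsBoundedTest ψ T A K) (t : ℝ) {r : ℝ} (hr : 0 < r) :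
    |fderiv ℝ ψ (t, r) (0, 1)| ≤ K := by
  have := (fderiv ℝ ψ (t, r)).le_opNorm (0, 1)
  rw [Real.norm_eq_abs] at this
  refine (this.trans (le_of_eq ?_)).trans (h.norm_fderiv_le t r hr)
  simp [Prod.norm_def]

theorem fderiv_eq_zero (h : IsBoundedTest ψ T A K) {t r : ℝ} (hr : 0 < r)
    (ho : T < |t| ∨ A < r) : fderiv ℝ ψ (t, r) = 0 := by
  have : ψ =ᶠ[𝓝 (t, r)] fun _ => 0 := by
    have hopen : IsOpen {q : ℝ × ℝ | 0 < q.2 ∧ (T < |q.1| ∨ A < q.2)} :=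
      (isOpen_lt continuous_const continuous_snd).inter
        ((isOpen_lt continuous_const continuous_fst.abs).union
          (isOpen_lt continuous_const continuous_snd))
    filter_upwards [hopen.mem_nhds ⟨hr, ho⟩] with q hq using h.eq_zero q.1 q.2 hq.1 hq.2
  rw [this.fderiv_eq]
  simp

theorem continuousOn_fderiv (h : IsBoundedTest ψ T A K) :
    ContinuousOn (fderiv ℝ ψ) (univ ×ˢ Ioi (0 : ℝ)) :=
  h.contDiffOn.continuousOn_fderiv_of_isOpen isOpen_upperHalf le_rfl

theorem continuousOn_fderiv_apply (h : IsBoundedTest ψ T A K) (v : ℝ × ℝ) :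
    ContinuousOn (fun q => fderiv ℝ ψ q v) (univ ×ˢ Ioi (0 : ℝ)) :=
  h.continuousOn_fderiv.clm_apply continuousOn_const

theorem K_nonneg (h : IsBoundedTest ψ T A K) : 0 ≤ K :=
  (abs_nonneg _).trans (h.abs_le 0 1 one_pos)

/-- The product of a locally integrable function with a bounded function that vanishes off the
support of a test function. -/
theorem integrableOn_mul {m : ℕ} {T A K : ℝ} (hT : 0 < T) (hA : 0 < A) {f g : ℝ → ℝ → ℝ}
    (hf : RadialL1Loc m f)
    (hg : ContinuousOn (fun q : ℝ × ℝ => g q.1 q.2) (univ ×ˢ Ioi (0 : ℝ)))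
    (hgK : ∀ t r : ℝ, 0 < r → |g t r| ≤ K)
    (hg0 : ∀ t r : ℝ, 0 < r → (T < |t| ∨ A < r) → g t r = 0) :
    IntegrableOn (fun q : ℝ × ℝ => f q.1 q.2 * g q.1 q.2 * q.2 ^ m) (univ ×ˢ Ioi (0 : ℝ)) := by
  have hsub : Icc (-T) T ×ˢ Ioc 0 A ⊆ (univ : Set ℝ) ×ˢ Ioi (0 : ℝ) :=
    prod_mono (subset_univ _) Ioc_subset_Ioi_self
  have h1 : IntegrableOn (fun q : ℝ × ℝ => f q.1 q.2 * g q.1 q.2 * q.2 ^ m)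
      (Icc (-T) T ×ˢ Ioc 0 A) := by
    have := Integrable.bdd_mul (hf T A hT hA) (f := fun q : ℝ × ℝ => g q.1 q.2) (c := K)
      ((hg.mono hsub).aestronglyMeasurable (measurableSet_Icc.prod measurableSet_Ioc))
      (by
        filter_upwards [ae_restrict_mem (measurableSet_Icc.prod measurableSet_Ioc)] with q hq
        exact hgK q.1 q.2 hq.2.1)
    refine this.congr (ae_of_all _ fun q => ?_)
    ring
  refine h1.of_forall_sdiff_eq_zero isOpen_upperHalf.measurableSet fun q hq => ?_
  have hr : 0 < q.2 := hq.1.2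
  have : T < |q.1| ∨ A < q.2 := by
    by_contra hcon
    push Not at hcon
    exact hq.2 ⟨_root_.abs_le.1 hcon.1, hr, hcon.2⟩
  rw [hg0 q.1 q.2 hr this]
  simp

end IsBoundedTest

theorem IsRadialTest.exists_isBoundedTest {ψ : ℝ × ℝ → ℝ} (h : IsRadialTest ψ) :
    ∃ T A K, IsBoundedTest ψ T A K ∧
      ((∀ t, ψ (t, 0) = 0) → ∀ t r, 0 < r → |ψ (t, r)| ≤ K * r) := by
  obtain ⟨hψ, T, A, hT, hA, h0⟩ := h
  set S : Set (ℝ × ℝ) := univ ×ˢ Ici (0 : ℝ) with hS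
  have hSc : Convex ℝ S := convex_univ.prod (convex_Ici 0)
  have huniq : UniqueDiffOn ℝ S := uniqueDiffOn_univ.prod (uniqueDiffOn_Ici 0)
  have hcd := hψ.continuousOn_fderivWithin huniq le_rfl
  set Bx : Set (ℝ × ℝ) := Icc (-T) T ×ˢ Icc 0 A with hBx
  have hBxS : Bx ⊆ S := prod_mono (subset_univ _) Icc_subset_Ici_self
  have hBxc : IsCompact Bx := isCompact_Icc.prod isCompact_Icc
  obtain ⟨K₁, hK₁⟩ := hBxc.exists_bound_of_continuousOn (hcd.mono hBxS)
  obtain ⟨K₂, hK₂⟩ := hBxc.exists_bound_of_continuousOn (hψ.continuousOn.mono hBxS)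
  have hK : 0 ≤ max K₁ K₂ := by
    have : ((0, 0) : ℝ × ℝ) ∈ Bx := ⟨⟨by simpa using hT.le, hT.le⟩, ⟨le_rfl, hA.le⟩⟩
    exact (norm_nonneg _).trans ((hK₂ _ this).trans (le_max_right _ _))
  have hmem : ∀ t r : ℝ, 0 < r → ¬(T < |t| ∨ A < r) → (t, r) ∈ Bx := fun t r hr hn => by
    push Not at hn
    exact ⟨abs_le.1 hn.1, hr.le, hn.2⟩
  have hopen : ∀ t r : ℝ, 0 < r → fderivWithin ℝ ψ S (t, r) = fderiv ℝ ψ (t, r) := fun t r hr => by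
    refine fderivWithin_of_mem_nhds (mem_of_superset
      (isOpen_upperHalf.mem_nhds ⟨mem_univ _, hr⟩) ?_)
    exact prod_mono le_rfl Ioi_subset_Ici_self
  have hbt : IsBoundedTest ψ T A (max K₁ K₂) := by
    have hev : ∀ t r : ℝ, 0 < r → (T < |t| ∨ A < r) → ψ (t, r) = 0 := fun t r hr => h0 t r hr.le
    refine ⟨hT, hA, hψ.mono (prod_mono le_rfl Ioi_subset_Ici_self), hev, fun t r hr => ?_,
      fun t r hr => ?_⟩
    · by_cases hc : T < |t| ∨ A < r
      · rw [hev t r hr hc, abs_zero]; exact hK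
      · exact (hK₂ _ (hmem t r hr hc)).trans (le_max_right _ _)
    · by_cases hc : T < |t| ∨ A < r
      · have : ψ =ᶠ[𝓝 (t, r)] fun _ => 0 := by
          have hopen : IsOpen {q : ℝ × ℝ | 0 < q.2 ∧ (T < |q.1| ∨ A < q.2)} :=
            (isOpen_lt continuous_const continuous_snd).inter
              ((isOpen_lt continuous_const continuous_fst.abs).union
                (isOpen_lt continuous_const continuous_snd))
          filter_upwards [hopen.mem_nhds ⟨hr, hc⟩] with q hq using hev q.1 q.2 hq.1 hq.2
        rw [this.fderiv_eq]
        simpa using hK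
      · rw [← hopen t r hr]
        exact (hK₁ _ (hmem t r hr hc)).trans (le_max_left _ _)
  refine ⟨T, A, max K₁ K₂, hbt, fun hz t r hr => ?_⟩
  by_cases hc : T < |t| ∨ A < r
  · rw [hbt.eq_zero t r hr hc, abs_zero]
    positivity
  -- Mean value inequality in the convex box, between the boundary point (t, 0), where ψ vanishes,
  -- and (t, r).
  · have hBxconv : Convex ℝ Bx := (convex_Icc _ _).prod (convex_Icc _ _)
    have m1 : ((t, 0) : ℝ × ℝ) ∈ Bx := ⟨(hmem t r hr hc).1, le_rfl, hA.le⟩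
    have := hBxconv.norm_image_sub_le_of_norm_hasFDerivWithin_le
      (f' := fun q => fderivWithin ℝ ψ S q)
      (fun q hq => ((hψ.differentiableOn one_ne_zero) q (hBxS hq)).hasFDerivWithinAt.mono hBxS)
      (fun q hq => (hK₁ q hq).trans (le_max_left K₁ K₂)) m1 (hmem t r hr hc)
    rw [hz t, sub_zero] at this
    have hn : ‖((t, r) : ℝ × ℝ) - (t, 0)‖ = r := by
      simp [Prod.norm_def, abs_of_pos hr, hr.le]
    rwa [hn, Real.norm_eq_abs] at this

theorem integrable_mul_of_hasCompactSupport {f g : ℝ → ℝ} {K : ℝ} (hf : Measurable f)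
    (hK : ∀ x, |f x| ≤ K) (hg : Continuous g) (hgc : HasCompactSupport g) :
    Integrable (fun x => f x * g x) :=
  (hg.integrable_of_hasCompactSupport hgc).bdd_mul hf.aestronglyMeasurable (ae_of_all _ hK)

theorem volume_restrict_upperHalf :
    (volume : Measure (ℝ × ℝ)).restrict (univ ×ˢ Ioi (0 : ℝ))
      = (volume : Measure ℝ).prod (volume.restrict (Ioi (0 : ℝ))) := by
  rw [volume_restrict_prod, Measure.restrict_univ]

/-! ### Reduction of self-similar balance laws to the similarity variable. -/

/-- In the variables `x = t / r^λ` and `r`, the radial derivative of `r^(β+1) ψ(x r^λ, r)`. -/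
noncomputable def radialDeriv (lam β : ℝ) (ψ : ℝ × ℝ → ℝ) (x r : ℝ) : ℝ :=
  r ^ β * ((β + 1) * ψ (x * r ^ lam, r) + r * fderiv ℝ ψ (x * r ^ lam, r) (0, 1)
    + lam * x * r ^ lam * fderiv ℝ ψ (x * r ^ lam, r) (1, 0))

namespace IsBoundedTest

variable {ψ : ℝ × ℝ → ℝ} {T A K : ℝ}

theorem hasDerivAt_radialDeriv (h : IsBoundedTest ψ T A K) (lam β x : ℝ) {r : ℝ} (hr : 0 < r) :
    HasDerivAt (fun r => r ^ (β + 1) * ψ (x * r ^ lam, r)) (radialDeriv lam β ψ x r) r := by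
  have h1 : HasDerivAt (fun r : ℝ => r ^ (β + 1)) ((β + 1) * r ^ (β + 1 - 1)) r :=
    Real.hasDerivAt_rpow_const (Or.inl hr.ne')
  have h2 : HasDerivAt (fun r : ℝ => x * r ^ lam) (x * (lam * r ^ (lam - 1))) r :=
    (Real.hasDerivAt_rpow_const (Or.inl hr.ne')).const_mul x
  refine (h1.fun_mul (h.hasDerivAt_comp (g := fun r => r) hr h2 (hasDerivAt_id r))).congr_deriv ?_
  rw [add_sub_cancel_right, Real.rpow_add_one hr.ne', Real.rpow_sub_one hr.ne', radialDeriv]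
  field_simp
  ring

/-- The integrand is an exact derivative whose primitive r^(β+1) ψ tends to 0 at r = 0, as β+1 > 0
and ψ is bounded, and vanishes for r > A. -/
theorem integral_radialDeriv (h : IsBoundedTest ψ T A K) {lam β : ℝ} (hβ : 0 < β + 1) (x : ℝ)
    (hi : IntegrableOn (radialDeriv lam β ψ x) (Ioi 0)) :
    ∫ r in Ioi 0, radialDeriv lam β ψ x r = 0 := by
  have h1 := integral_Ioi_of_hasDerivAt_of_tendsto (a := 0) (m := 0)
    (f := fun r => r ^ (β + 1) * ψ (x * r ^ lam, r)) ?_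
    (fun r hr => h.hasDerivAt_radialDeriv lam β x hr) hi ?_
  · rw [h1]
    simp [Real.zero_rpow hβ.ne']
  -- `K` bounds ψ only for r > 0; the maximum also covers the value at the endpoint r = 0.
  · have hlim : Tendsto (fun r : ℝ => r ^ (β + 1) * max K |ψ (x * 0 ^ lam, 0)|) (𝓝[≥] 0) (𝓝 0) := by
      have : Tendsto (fun r : ℝ => r ^ (β + 1)) (𝓝 0) (𝓝 (0 ^ (β + 1))) :=
        (Real.continuousAt_rpow_const 0 (β + 1) (Or.inr hβ.le)).tendsto
      rw [Real.zero_rpow hβ.ne'] at this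
      simpa using (this.mono_left nhdsWithin_le_nhds).mul_const _
    rw [ContinuousWithinAt, Real.zero_rpow hβ.ne', zero_mul]
    refine squeeze_zero_norm' ?_ hlim
    filter_upwards [self_mem_nhdsWithin] with r hr
    have hr : 0 ≤ r := hr
    rw [norm_mul, Real.norm_eq_abs, Real.norm_eq_abs, abs_of_nonneg (Real.rpow_nonneg hr _)]
    have := Real.rpow_nonneg hr (β + 1)
    gcongr
    rcases hr.eq_or_lt with rfl | hr'
    · exact le_max_right _ _
    · exact (h.abs_le _ _ hr').trans (le_max_left _ _)
  · refine tendsto_const_nhds.congr' ?_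
    filter_upwards [eventually_gt_atTop A] with r hr
    rw [h.eq_zero _ r (h.A_pos.trans hr) (Or.inr hr), mul_zero]

theorem contDiff_slice (h : IsBoundedTest ψ T A K) (a : ℝ) {r : ℝ} (hr : 0 < r) :
    ContDiff ℝ 1 (fun x => ψ (x * a, r)) :=
  h.contDiffOn.comp_contDiff (f := fun x => ((x * a, r) : ℝ × ℝ)) (by fun_prop)
    fun _ => ⟨mem_univ _, hr⟩

theorem abs_le_of_slice_ne_zero {a x : ℝ} (ha : 0 < a) (hx : ¬T < |x * a|) :
    x ∈ Icc (-(T / a)) (T / a) := by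
  rw [not_lt, abs_mul, abs_of_pos ha, ← le_div_iff₀ ha] at hx
  exact _root_.abs_le.1 hx

theorem hasCompactSupport_slice (h : IsBoundedTest ψ T A K) {a r : ℝ} (ha : 0 < a)
    (hr : 0 < r) : HasCompactSupport (fun x => ψ (x * a, r)) := by
  refine HasCompactSupport.of_support_subset_isCompact (isCompact_Icc (a := -(T / a)) (b := T / a))
    fun x hx => abs_le_of_slice_ne_zero ha fun hT => hx (h.eq_zero _ _ hr (Or.inl hT))

theorem hasCompactSupport_slice_fderiv (h : IsBoundedTest ψ T A K) {a r : ℝ} (ha : 0 < a)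
    (hr : 0 < r) (v : ℝ × ℝ) : HasCompactSupport (fun x => fderiv ℝ ψ (x * a, r) v) := by
  refine HasCompactSupport.of_support_subset_isCompact (isCompact_Icc (a := -(T / a)) (b := T / a))
    fun x hx => abs_le_of_slice_ne_zero ha fun hT => hx (by
      simp only
      rw [h.fderiv_eq_zero hr (Or.inl hT)]; simp)

theorem continuous_slice_fderiv (h : IsBoundedTest ψ T A K) (a : ℝ) {r : ℝ} (hr : 0 < r)
    (v : ℝ × ℝ) : Continuous (fun x => fderiv ℝ ψ (x * a, r) v) :=
  (h.continuousOn_fderiv_apply v).comp_continuous (f := fun x => ((x * a, r) : ℝ × ℝ))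
    (by fun_prop) fun _ => ⟨mem_univ _, hr⟩

end IsBoundedTest

/-- The integrand of a self-similar balance law with density `r^α Q(x)`, flux
`r^(α+1-λ) Φ(x)` and source `r^(α-λ) S(x)`. -/
noncomputable def balanceIntegrand (lam α : ℝ) (Q Φ S : ℝ → ℝ) (ψ : ℝ × ℝ → ℝ) (t r : ℝ) : ℝ :=
  r ^ α * Q (t / r ^ lam) * fderiv ℝ ψ (t, r) (1, 0)
    + r ^ (α + 1 - lam) * Φ (t / r ^ lam) * fderiv ℝ ψ (t, r) (0, 1)
    + r ^ (α - lam) * S (t / r ^ lam) * ψ (t, r)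

section Balance

variable {m : ℕ} {lam α K T A Kψ : ℝ} {Q Φ S : ℝ → ℝ} {ψ : ℝ × ℝ → ℝ}

/-- For fixed r substitute t = x r^λ and use the weak equation with χ(x) = ψ(x r^λ, r), for which χ'
= r^λ ψ_t. It trades Q and S for Φ, and the terms that remain are those of an exact r-derivative. -/
theorem integral_balanceIntegrand_slice (hψ : IsBoundedTest ψ T A Kψ)
    (mQ : Measurable Q) (mΦ : Measurable Φ) (mS : Measurable S)
    (bQ : ∀ x, |Q x| ≤ K) (bΦ : ∀ x, |Φ x| ≤ K) (bS : ∀ x, |S x| ≤ K)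
    (hw : HasWeakDeriv (fun x => Q x - lam * x * Φ x) (fun x => S x - (α + m + 1) * Φ x))
    {r : ℝ} (hr : 0 < r) :
    ∫ t, balanceIntegrand lam α Q Φ S ψ t r * r ^ m
      = ∫ x, Φ x * radialDeriv lam (α + m) ψ x r := by
  have ha : 0 < r ^ lam := Real.rpow_pos_of_pos hr _
  set a := r ^ lam with ha'
  have hχ := hψ.contDiff_slice a hr
  have hχc := hψ.hasCompactSupport_slice ha hr
  have hd : ∀ x, deriv (fun x => ψ (x * a, r)) x = fderiv ℝ ψ (x * a, r) (1, 0) * a := fun x => by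
    have := (hψ.hasDerivAt_comp (f := fun x => x * a) (g := fun _ => r) hr
      ((hasDerivAt_id x).mul_const a) (hasDerivAt_const x r)).deriv
    simpa using this
  have ct := hψ.continuous_slice_fderiv a hr (1, 0)
  have kt := hψ.hasCompactSupport_slice_fderiv ha hr (1, 0)
  have cr := hψ.continuous_slice_fderiv a hr (0, 1)
  have kr := hψ.hasCompactSupport_slice_fderiv ha hr (0, 1)
  have i1 := integrable_mul_of_hasCompactSupport mQ bQ ct kt
  have i2 : Integrable (fun x => Φ x * (x * fderiv ℝ ψ (x * a, r) (1, 0))) :=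
    integrable_mul_of_hasCompactSupport mΦ bΦ (continuous_id.mul ct) (kt.mul_left (f := id))
  have i3 := integrable_mul_of_hasCompactSupport mΦ bΦ cr kr
  have i4 := integrable_mul_of_hasCompactSupport mS bS hχ.continuous hχc
  have i5 := integrable_mul_of_hasCompactSupport mΦ bΦ hχ.continuous hχc
  have i53 : Integrable (fun x => (α + m + 1) * (Φ x * ψ (x * a, r))
      + r * (Φ x * fderiv ℝ ψ (x * a, r) (0, 1))) := (i5.const_mul _).add (i3.const_mul _)
  have i13 : Integrable (fun x => a * (Q x * fderiv ℝ ψ (x * a, r) (1, 0))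
      + r * (Φ x * fderiv ℝ ψ (x * a, r) (0, 1))) := (i1.const_mul _).add (i3.const_mul _)
  have e1 : ∫ x, (Q x - lam * x * Φ x) * deriv (fun x => ψ (x * a, r)) x
      = a * (∫ x, Q x * fderiv ℝ ψ (x * a, r) (1, 0))
        - lam * a * ∫ x, Φ x * (x * fderiv ℝ ψ (x * a, r) (1, 0)) := by
    rw [← integral_const_mul, ← integral_const_mul,
      ← integral_sub (i1.const_mul _) (i2.const_mul _)]
    refine integral_congr_ae (ae_of_all _ fun x => ?_)
    simp only [hd]
    ring
  have e2 : ∫ x, (S x - (α + m + 1) * Φ x) * ψ (x * a, r)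
      = (∫ x, S x * ψ (x * a, r)) - (α + m + 1) * ∫ x, Φ x * ψ (x * a, r) := by
    rw [← integral_const_mul, ← integral_sub i4 (i5.const_mul _)]
    refine integral_congr_ae (ae_of_all _ fun x => ?_)
    ring
  have e3 : ∫ x, Φ x * radialDeriv lam (α + m) ψ x r
      = r ^ (α + m) * ((α + m + 1) * (∫ x, Φ x * ψ (x * a, r))
        + r * (∫ x, Φ x * fderiv ℝ ψ (x * a, r) (0, 1))
        + lam * a * ∫ x, Φ x * (x * fderiv ℝ ψ (x * a, r) (1, 0))) := by
    rw [← integral_const_mul, ← integral_const_mul, ← integral_const_mul,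
      ← integral_add (i5.const_mul _) (i3.const_mul _),
      ← integral_add i53 (i2.const_mul _),
      ← integral_const_mul]
    refine integral_congr_ae (ae_of_all _ fun x => ?_)
    simp only [radialDeriv]
    ring
  have e4 : ∫ t, balanceIntegrand lam α Q Φ S ψ t r * r ^ m
      = r ^ (α + m) * (a * (∫ x, Q x * fderiv ℝ ψ (x * a, r) (1, 0))
        + r * (∫ x, Φ x * fderiv ℝ ψ (x * a, r) (0, 1))
        + ∫ x, S x * ψ (x * a, r)) := by
    have h1 := Measure.integral_comp_mul_right
      (fun t => balanceIntegrand lam α Q Φ S ψ t r * r ^ m) a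
    rw [smul_eq_mul, abs_of_pos (inv_pos.2 ha), eq_inv_mul_iff_mul_eq₀ ha.ne'] at h1
    rw [← h1, ← integral_const_mul, ← integral_const_mul, ← integral_const_mul,
      ← integral_add (i1.const_mul _) (i3.const_mul _),
      ← integral_add i13 i4,
      ← integral_const_mul]
    refine integral_congr_ae (ae_of_all _ fun x => ?_)
    simp only [balanceIntegrand]
    rw [← ha', mul_div_cancel_right₀ _ ha.ne', Real.rpow_add hr, Real.rpow_natCast,
      Real.rpow_sub hr, Real.rpow_sub hr, Real.rpow_add hr, Real.rpow_one, ← ha']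
    field_simp
  have e5 := hw _ hχ hχc
  rw [e1, e2] at e5
  rw [e3, e4]
  linear_combination r ^ (α + m) * e5

/-- On the support |x| r^λ ≤ T, so a factor |x|^s r^(λs) is bounded. It turns |Φ| r^β into at most a
constant times |x|^(η-s) r^(β-λs) for large |x|, and s is chosen so that η-s < -1 gives
integrability at infinity and β-λs > -1 gives it at r = 0. -/
theorem integrable_mul_radialDeriv {s η : ℝ} (hψ : IsBoundedTest ψ T A Kψ) (hlam : 0 < lam)
    (mΦ : Measurable Φ) (bΦ : ∀ x, |Φ x| ≤ K) (dΦ : ∀ x, x ≠ 0 → |Φ x| ≤ K * |x| ^ η)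
    (hs0 : 0 ≤ s) (hs1 : 1 + η < s) {β : ℝ} (hs2 : lam * s < β + 1) :
    Integrable (fun q : ℝ × ℝ => Φ q.1 * radialDeriv lam β ψ q.1 q.2)
      ((volume : Measure ℝ).prod (volume.restrict (Ioi (0 : ℝ)))) := by
  have hK : 0 ≤ K := (abs_nonneg _).trans (bΦ 0)
  have hKψ := hψ.K_nonneg
  have hA := hψ.A_pos
  have hT := hψ.T_pos
  set c := s - η with hc
  have hc1 : 1 < c := by rw [hc]; linarith
  set M := |β + 1| * Kψ + A * Kψ + lam * T * Kψ with hM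
  have hM0 : 0 ≤ M := by positivity
  -- The first entry bounds r^(λs) for |x| ≤ 1, the second |x|^s r^(λs) for |x| > 1. The factor 2^c
  -- in the majorant comes from 1+|x| ≤ 2 max(1, |x|).
  set N := max (A ^ (lam * s)) (T ^ s) with hN
  have hN0 : 0 ≤ N := le_max_of_le_right (by positivity)
  have hdom : Integrable (fun q : ℝ × ℝ => (1 + ‖q.1‖) ^ (-c)
      * (2 ^ c * K * M * N * (Ioc 0 A).indicator (fun r => r ^ (β - lam * s)) q.2))
      ((volume : Measure ℝ).prod (volume.restrict (Ioi (0 : ℝ)))) := by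
    refine (integrable_one_add_norm (by simpa using hc1)).mul_prod (Integrable.const_mul ?_ _)
    rw [integrable_indicator_iff measurableSet_Ioc, IntegrableOn,
      Measure.restrict_restrict measurableSet_Ioc,
      inter_eq_left.2 (Ioc_subset_Ioi_self : Ioc 0 A ⊆ Ioi (0 : ℝ))]
    exact integrableOn_Ioc_rpow (by linarith) hA.le
  have hcont : ContinuousOn (fun q : ℝ × ℝ => radialDeriv lam β ψ q.1 q.2)
      (univ ×ˢ Ioi (0 : ℝ)) := by
    have hp : ∀ p : ℝ, ContinuousOn (fun q : ℝ × ℝ => q.2 ^ p) (univ ×ˢ Ioi (0 : ℝ)) :=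
      fun p => continuousOn_snd.rpow_const fun q hq => Or.inl (ne_of_gt hq.2)
    have hmap : ContinuousOn (fun q : ℝ × ℝ => ((q.1 * q.2 ^ lam, q.2) : ℝ × ℝ))
        (univ ×ˢ Ioi (0 : ℝ)) := (continuousOn_fst.mul (hp lam)).prodMk continuousOn_snd
    have hmaps : MapsTo (fun q : ℝ × ℝ => ((q.1 * q.2 ^ lam, q.2) : ℝ × ℝ))
        (univ ×ˢ Ioi (0 : ℝ)) (univ ×ˢ Ioi (0 : ℝ)) := fun q hq => ⟨mem_univ _, hq.2⟩
    have c0 := hψ.contDiffOn.continuousOn.comp hmap hmaps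
    have c1 := (hψ.continuousOn_fderiv_apply (0, 1)).comp hmap hmaps
    have c2 := (hψ.continuousOn_fderiv_apply (1, 0)).comp hmap hmaps
    unfold radialDeriv
    exact (hp β).mul (((c0.const_mul _).add (continuousOn_snd.mul c1)).add
      (((continuousOn_fst.const_mul lam).mul (hp lam)).mul c2))
  refine Integrable.mono' hdom ?_ ?_
  · refine AEStronglyMeasurable.mul (mΦ.comp measurable_fst).aestronglyMeasurable ?_
    rw [← volume_restrict_upperHalf]
    exact hcont.aestronglyMeasurable isOpen_upperHalf.measurableSet
  · rw [← volume_restrict_upperHalf]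
    filter_upwards [ae_restrict_mem isOpen_upperHalf.measurableSet] with q hq
    obtain ⟨x, r⟩ := q
    have hr : 0 < r := hq.2
    have ha : 0 < r ^ lam := Real.rpow_pos_of_pos hr _
    have hx1 : (0 : ℝ) < 1 + ‖x‖ := by positivity
    have hrhs : 0 ≤ (1 + ‖x‖) ^ (-c)
        * (2 ^ c * K * M * N * (Ioc 0 A).indicator (fun r => r ^ (β - lam * s)) r) := by
      have : 0 ≤ (Ioc 0 A).indicator (fun r : ℝ => r ^ (β - lam * s)) r :=
        indicator_nonneg (fun r hr => Real.rpow_nonneg hr.1.le _) r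
      positivity
    simp only
    by_cases ho : T < |x * r ^ lam| ∨ A < r
    · have : radialDeriv lam β ψ x r = 0 := by
        rw [radialDeriv, hψ.eq_zero _ r hr ho, hψ.fderiv_eq_zero hr ho]
        simp
      rw [this, mul_zero, norm_zero]
      exact hrhs
    push Not at ho
    obtain ⟨hxT, hrA⟩ := ho
    rw [indicator_of_mem (show r ∈ Ioc 0 A from ⟨hr, hrA⟩)]
    have hZ : |radialDeriv lam β ψ x r| ≤ r ^ β * M := by
      rw [radialDeriv, abs_mul, abs_of_pos (Real.rpow_pos_of_pos hr _)]
      have := Real.rpow_pos_of_pos hr β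
      gcongr
      refine (abs_add_three _ _ _).trans ?_
      rw [abs_mul, abs_mul, abs_mul, mul_assoc lam, abs_mul lam, abs_of_pos hr, abs_of_pos hlam, hM]
      have h1 := hψ.abs_le (x * r ^ lam) r hr
      have h2 := hψ.abs_fderiv_fst_le (x * r ^ lam) hr
      have h3 := hψ.abs_fderiv_snd_le (x * r ^ lam) hr
      gcongr
    have hΦN : |Φ x| * r ^ β ≤ (1 + ‖x‖) ^ (-c) * (2 ^ c * K * N * r ^ (β - lam * s)) := by
      have hrs : 0 < r ^ (lam * s) := Real.rpow_pos_of_pos hr _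
      have hsplit : r ^ β = r ^ (β - lam * s) * r ^ (lam * s) := by
        rw [← Real.rpow_add hr]; ring_nf
      have hbs : 0 < r ^ (β - lam * s) := Real.rpow_pos_of_pos hr _
      suffices |Φ x| * r ^ (lam * s) ≤ (1 + ‖x‖) ^ (-c) * (2 ^ c * K * N) by
        rw [hsplit]
        calc |Φ x| * (r ^ (β - lam * s) * r ^ (lam * s))
            = |Φ x| * r ^ (lam * s) * r ^ (β - lam * s) := by ring
          _ ≤ (1 + ‖x‖) ^ (-c) * (2 ^ c * K * N) * r ^ (β - lam * s) := by gcongr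
          _ = _ := by ring
      rcases le_or_gt |x| 1 with hx | hx
      · have h1 : 1 ≤ (1 + ‖x‖) ^ (-c) * 2 ^ c := by
          rw [Real.rpow_neg hx1.le, inv_mul_eq_div, one_le_div (Real.rpow_pos_of_pos hx1 _)]
          refine Real.rpow_le_rpow hx1.le ?_ (by linarith)
          rw [Real.norm_eq_abs]; linarith
        have h2 : r ^ (lam * s) ≤ N :=
          (Real.rpow_le_rpow hr.le hrA (by positivity)).trans (le_max_left _ _)
        calc |Φ x| * r ^ (lam * s) ≤ K * N := by
              have := bΦ x
              gcongr
          _ ≤ (K * N) * ((1 + ‖x‖) ^ (-c) * 2 ^ c) := le_mul_of_one_le_right (by positivity) h1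
          _ = _ := by ring
      · have hx0 : 0 < |x| := by linarith
        have h1 : |x| ^ (-c) ≤ (1 + ‖x‖) ^ (-c) * 2 ^ c := by
          rw [Real.rpow_neg hx1.le, Real.rpow_neg hx0.le, inv_mul_eq_div,
            le_div_iff₀ (Real.rpow_pos_of_pos hx1 _), inv_mul_eq_div,
            div_le_iff₀ (Real.rpow_pos_of_pos hx0 _), ← Real.mul_rpow zero_le_two hx0.le]
          refine Real.rpow_le_rpow hx1.le ?_ (by linarith)
          rw [Real.norm_eq_abs]; linarith
        have h2 : |x| ^ s * r ^ (lam * s) ≤ N := by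
          rw [Real.rpow_mul hr.le, ← Real.mul_rpow hx0.le ha.le]
          refine le_trans ?_ (le_max_right _ _)
          refine Real.rpow_le_rpow (by positivity) ?_ hs0
          rwa [abs_mul, abs_of_pos ha] at hxT
        have h3 : |x| ^ η = |x| ^ (-c) * |x| ^ s := by
          rw [← Real.rpow_add hx0, hc]; ring_nf
        calc |Φ x| * r ^ (lam * s) ≤ K * |x| ^ η * r ^ (lam * s) := by
              have := dΦ x (abs_pos.1 hx0)
              gcongr
          _ = K * |x| ^ (-c) * (|x| ^ s * r ^ (lam * s)) := by rw [h3]; ring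
          _ ≤ K * ((1 + ‖x‖) ^ (-c) * 2 ^ c) * N := by gcongr
          _ = _ := by ring
    rw [norm_mul, Real.norm_eq_abs, Real.norm_eq_abs]
    calc |Φ x| * |radialDeriv lam β ψ x r| ≤ |Φ x| * (r ^ β * M) := by gcongr
      _ = |Φ x| * r ^ β * M := by ring
      _ ≤ (1 + ‖x‖) ^ (-c) * (2 ^ c * K * N * r ^ (β - lam * s)) * M := by gcongr
      _ = _ := by ring

/-- A self-similar balance law holds weakly on `ℝ × (0, ∞)` if it holds in the similarity
variable and the flux decays fast enough. -/
theorem integral_balanceIntegrand_eq_zero {s η : ℝ} (hψ : IsBoundedTest ψ T A Kψ) (hlam : 0 < lam)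
    (mQ : Measurable Q) (mΦ : Measurable Φ) (mS : Measurable S)
    (bQ : ∀ x, |Q x| ≤ K) (bΦ : ∀ x, |Φ x| ≤ K) (bS : ∀ x, |S x| ≤ K)
    (dΦ : ∀ x, x ≠ 0 → |Φ x| ≤ K * |x| ^ η)
    (hs0 : 0 ≤ s) (hs1 : 1 + η < s) (hs2 : lam * s < α + m + 1)
    (hw : HasWeakDeriv (fun x => Q x - lam * x * Φ x) (fun x => S x - (α + m + 1) * Φ x))
    (hint : IntegrableOn (fun q : ℝ × ℝ => balanceIntegrand lam α Q Φ S ψ q.1 q.2 * q.2 ^ m)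
      (univ ×ˢ Ioi (0 : ℝ))) :
    ∫ t, ∫ r in Ioi 0, balanceIntegrand lam α Q Φ S ψ t r * r ^ m = 0 := by
  rw [IntegrableOn, volume_restrict_upperHalf] at hint
  have hj := integrable_mul_radialDeriv hψ hlam mΦ bΦ dΦ hs0 hs1 hs2
  rw [integral_integral_swap (f := fun t r => balanceIntegrand lam α Q Φ S ψ t r * r ^ m) hint,
    setIntegral_congr_fun measurableSet_Ioi
      fun r hr => integral_balanceIntegrand_slice hψ mQ mΦ mS bQ bΦ bS hw hr,
    ← integral_integral_swap (f := fun x r => Φ x * radialDeriv lam (α + m) ψ x r) hj]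
  -- Fubini gives integrability of the slice only together with the factor `Φ x`, which is divided
  -- out where it is nonzero.
  have h0 : ∀ᵐ x : ℝ, ∫ r in Ioi 0, Φ x * radialDeriv lam (α + m) ψ x r = 0 := by
    filter_upwards [hj.prod_right_ae] with x hx
    by_cases hΦ : Φ x = 0
    · simp [hΦ]
    · have h2 : IntegrableOn (radialDeriv lam (α + m) ψ x) (Ioi 0) := by
        refine (hx.const_mul (Φ x)⁻¹).congr (ae_of_all _ fun r => ?_)
        simp only
        rw [inv_mul_cancel_left₀ hΦ]
      rw [integral_const_mul, hψ.integral_radialDeriv ?_ x h2, mul_zero]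
      have : 0 ≤ lam * s := by positivity
      linarith
  rw [integral_congr_ae h0]
  simp

end Balance

/-- A graph is null because each of its sections in the first variable is a point. -/
theorem ae_fst_ne_comp_snd {Y : Type*} [MeasurableSpace Y] (ν : Measure Y) [SFinite ν]
    {g : Y → ℝ} (hg : Measurable g) :
    ∀ᵐ q : ℝ × Y ∂((volume : Measure ℝ).prod ν), q.1 ≠ g q.2 := by
  have hm : MeasurableSet {q : ℝ × Y | q.1 = g q.2} :=
    measurableSet_eq_fun measurable_fst (hg.comp measurable_snd)
  rw [ae_iff]
  simp only [ne_eq, not_not]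
  rw [Measure.prod_apply_symm hm]
  simp

/-- The fields of a self-similar flow, for `r > 0`. -/
structure IsSelfSimilarFields (lam : ℝ) (R w ε : ℝ → ℝ) (ρ u e : ℝ → ℝ → ℝ) : Prop where
  density : ∀ t r, 0 < r → ρ t r = R (t / r ^ lam)
  velocity : ∀ t r, 0 < r → u t r = r ^ (1 - lam) * w (t / r ^ lam)
  energy : ∀ t r, 0 < r → e t r = r ^ (2 - 2 * lam) * ε (t / r ^ lam)

section Balance

variable {m : ℕ} {lam α : ℝ} {Q Φ S : ℝ → ℝ} {ψ : ℝ × ℝ → ℝ} {T A Kψ : ℝ}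

theorem radialIntegralZero_of_balance {s η : ℝ} {F : ℝ → ℝ → ℝ} (hψ : IsBoundedTest ψ T A Kψ)
    (hlam : 0 < lam) (mQ : Measurable Q) (mΦ : Measurable Φ) (mS : Measurable S)
    (bQ : ∃ K, ∀ x, |Q x| ≤ K) (bΦ : ∃ K, ∀ x, |Φ x| ≤ K) (bS : ∃ K, ∀ x, |S x| ≤ K)
    (dΦ : ∃ K, ∀ x, x ≠ 0 → |Φ x| ≤ K * |x| ^ η)
    (hs0 : 0 ≤ s) (hs1 : 1 + η < s) (hs2 : lam * s < α + m + 1)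
    (hw : HasWeakDeriv (fun x => Q x - lam * x * Φ x) (fun x => S x - (α + m + 1) * Φ x))
    (iQ : RadialL1Loc m (fun t r => r ^ α * Q (t / r ^ lam)))
    (iΦ : RadialL1Loc m (fun t r => r ^ (α + 1 - lam) * Φ (t / r ^ lam)))
    (iS : IntegrableOn (fun q : ℝ × ℝ => q.2 ^ (α - lam) * S (q.1 / q.2 ^ lam) * ψ q * q.2 ^ m)
      (univ ×ˢ Ioi (0 : ℝ)))
    (hF : ∀ t r, 0 < r → F t r = balanceIntegrand lam α Q Φ S ψ t r) :
    RadialIntegralZero m F := by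
  obtain ⟨K₁, bQ⟩ := bQ
  obtain ⟨K₂, bΦ⟩ := bΦ
  obtain ⟨K₃, bS⟩ := bS
  obtain ⟨K₄, dΦ⟩ := dΦ
  set K := max (max K₁ K₂) (max K₃ K₄)
  have h1 : K₁ ≤ K := (le_max_left _ _).trans (le_max_left _ _)
  have h2 : K₂ ≤ K := (le_max_right _ _).trans (le_max_left _ _)
  have h3 : K₃ ≤ K := (le_max_left _ _).trans (le_max_right _ _)
  have h4 : K₄ ≤ K := (le_max_right _ _).trans (le_max_right _ _)
  have j1 := IsBoundedTest.integrableOn_mul (g := fun t r => fderiv ℝ ψ (t, r) (1, 0)) hψ.T_pos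
    hψ.A_pos iQ (hψ.continuousOn_fderiv_apply (1, 0)) (fun t r hr => hψ.abs_fderiv_fst_le t hr)
    (fun t r hr ho => by simp only [hψ.fderiv_eq_zero hr ho, zero_apply])
  have j2 := IsBoundedTest.integrableOn_mul (g := fun t r => fderiv ℝ ψ (t, r) (0, 1)) hψ.T_pos
    hψ.A_pos iΦ (hψ.continuousOn_fderiv_apply (0, 1)) (fun t r hr => hψ.abs_fderiv_snd_le t hr)
    (fun t r hr ho => by simp only [hψ.fderiv_eq_zero hr ho, zero_apply])
  have hint : IntegrableOn (fun q : ℝ × ℝ => balanceIntegrand lam α Q Φ S ψ q.1 q.2 * q.2 ^ m)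
      (univ ×ˢ Ioi (0 : ℝ)) := by
    refine ((j1.add j2).add iS).congr (ae_of_all _ fun q => ?_)
    simp only [balanceIntegrand, Pi.add_apply]
    ring
  refine ⟨hint.congr_fun (fun q hq => by simp only [hF q.1 q.2 hq.2])
    isOpen_upperHalf.measurableSet, ?_⟩
  refine Eq.trans ?_ (integral_balanceIntegrand_eq_zero (K := K) hψ hlam mQ mΦ mS
    (fun x => (bQ x).trans h1) (fun x => (bΦ x).trans h2) (fun x => (bS x).trans h3)
    (fun x hx => (dΦ x hx).trans (by gcongr)) hs0 hs1 hs2 hw hint)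
  refine integral_congr_ae (ae_of_all _ fun t => ?_)
  exact setIntegral_congr_fun measurableSet_Ioi fun r hr => by simp only [hF t r hr]

end Balance

/-! ### The radial weak solution defined by a self-similar flow. -/

namespace IsSimilarityFlow

variable {n : ℕ} {γ lam B : ℝ} {R w ε : ℝ → ℝ} {ρ u e : ℝ → ℝ → ℝ}

theorem lam_pos (h : IsSimilarityFlow n γ lam B R w ε) : 0 < lam := by linarith [h.one_lt_lam]

theorem lam_lt_three (h : IsSimilarityFlow n γ lam B R w ε) : lam < 3 := by
  have := h.lam_lt
  rcases h.dim with rfl | rfl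
  · norm_num at this; linarith
  · norm_num at this; linarith

theorem two_le (h : IsSimilarityFlow n γ lam B R w ε) : (2 : ℝ) ≤ n := by
  rcases h.dim with rfl | rfl <;> norm_num

theorem cast_sub_one (h : IsSimilarityFlow n γ lam B R w ε) : ((n - 1 : ℕ) : ℝ) = n - 1 := by
  rcases h.dim with rfl | rfl <;> norm_num

theorem measurable_R (h : IsSimilarityFlow n γ lam B R w ε) : Measurable R :=
  IsSimilarityShockFlow.measurable_of_continuousAt h.continuousAt_R

theorem measurable_w (h : IsSimilarityFlow n γ lam B R w ε) : Measurable w :=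
  IsSimilarityShockFlow.measurable_of_continuousAt h.continuousAt_w

theorem measurable_ε (h : IsSimilarityFlow n γ lam B R w ε) : Measurable ε :=
  IsSimilarityShockFlow.measurable_of_continuousAt h.continuousAt_ε

/-- The uniform bound is used for |x| ≤ 1 and the 1/|x| decay for |x| > 1; every intermediate
exponent follows. -/
theorem exists_abs_w_le_rpow (h : IsSimilarityFlow n γ lam B R w ε) {p : ℝ} (hp1 : -1 ≤ p)
    (hp0 : p ≤ 0) : ∃ K, ∀ x, x ≠ 0 → |w x| ≤ K * |x| ^ p := by
  obtain ⟨K, hK⟩ := h.w_le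
  refine ⟨K, fun x hx => ?_⟩
  have hx0 : 0 < |x| := abs_pos.2 hx
  have hK0 : 0 ≤ K := (abs_nonneg _).trans (hK x).1
  rcases le_or_gt |x| 1 with hx1 | hx1
  · exact (hK x).1.trans (le_mul_of_one_le_right hK0
      (Real.one_le_rpow_of_pos_of_le_one_of_nonpos hx0 hx1 hp0))
  · have h1 : |w x| ≤ K * |x| ^ (-1 : ℝ) := by
      rw [Real.rpow_neg_one, ← div_eq_mul_inv, le_div_iff₀ hx0, mul_comm, ← abs_mul]
      exact (hK x).2
    refine h1.trans ?_
    have := Real.rpow_le_rpow_of_exponent_le hx1.le hp1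
    gcongr

/-- The exponent of decay of the pressure profile. -/
noncomputable abbrev decayRate (lam : ℝ) : ℝ := -(3 * (lam - 1) / (2 * lam))

theorem lam_mul_decayRate (h : IsSimilarityFlow n γ lam B R w ε) :
    lam * decayRate lam = -(3 * (lam - 1) / 2) := by
  have := h.lam_pos.ne'
  rw [decayRate]
  field_simp

theorem decayRate_neg (h : IsSimilarityFlow n γ lam B R w ε) : decayRate lam < 0 := by
  have := h.lam_pos
  have : 0 < lam - 1 := by linarith [h.one_lt_lam]
  rw [decayRate, neg_lt_zero]
  positivity

theorem neg_one_lt_decayRate (h : IsSimilarityFlow n γ lam B R w ε) : -1 < decayRate lam := by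
  have := h.lam_pos
  have := h.lam_lt_three
  rw [decayRate, neg_lt_neg_iff, div_lt_one (by positivity)]
  linarith

theorem exists_abs_mul_le {f g : ℝ → ℝ} (hf : ∃ K, ∀ x, |f x| ≤ K) (hg : ∃ K, ∀ x, |g x| ≤ K) :
    ∃ K, ∀ x, |f x * g x| ≤ K := by
  obtain ⟨K, hK⟩ := hf
  obtain ⟨K', hK'⟩ := hg
  exact ⟨K * K', fun x => by
    rw [abs_mul]
    exact mul_le_mul (hK x) (hK' x) (abs_nonneg _) ((abs_nonneg _).trans (hK x))⟩

theorem exists_abs_add_le {f g : ℝ → ℝ} (hf : ∃ K, ∀ x, |f x| ≤ K) (hg : ∃ K, ∀ x, |g x| ≤ K) :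
    ∃ K, ∀ x, |f x + g x| ≤ K := by
  obtain ⟨K, hK⟩ := hf
  obtain ⟨K', hK'⟩ := hg
  exact ⟨K + K', fun x => (abs_add_le _ _).trans (add_le_add (hK x) (hK' x))⟩

theorem exists_abs_le_rpow_of_bounded {f g : ℝ → ℝ} {p : ℝ} (hf : ∃ K, ∀ x, |f x| ≤ K)
    (hg : ∃ K, ∀ x, x ≠ 0 → |g x| ≤ K * |x| ^ p) :
    ∃ K, ∀ x, x ≠ 0 → |f x * g x| ≤ K * |x| ^ p := by
  obtain ⟨K, hK⟩ := hf
  obtain ⟨K', hK'⟩ := hg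
  refine ⟨K * K', fun x hx => ?_⟩
  rw [abs_mul, mul_assoc]
  exact mul_le_mul (hK x) (hK' x hx) (abs_nonneg _) ((abs_nonneg _).trans (hK x))

theorem exists_abs_w_le (h : IsSimilarityFlow n γ lam B R w ε) : ∃ K, ∀ x, |w x| ≤ K := by
  obtain ⟨K, hK⟩ := h.w_le
  exact ⟨K, fun x => (hK x).1⟩

theorem exists_abs_p_le (h : IsSimilarityFlow n γ lam B R w ε) :
    ∃ K, ∀ x, |idealPressure γ (R x) (ε x)| ≤ K := by
  obtain ⟨K, hK⟩ := h.p_le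
  exact ⟨K, fun x => (hK x).1⟩

theorem exists_abs_momentum_le (h : IsSimilarityFlow n γ lam B R w ε) :
    ∃ K, ∀ x, |R x * w x| ≤ K := exists_abs_mul_le h.R_le h.exists_abs_w_le

theorem exists_abs_kinetic_le (h : IsSimilarityFlow n γ lam B R w ε) :
    ∃ K, ∀ x, |R x * w x ^ 2| ≤ K := by
  obtain ⟨K, hK⟩ := exists_abs_mul_le h.exists_abs_momentum_le h.exists_abs_w_le
  exact ⟨K, fun x => by rw [pow_two, ← mul_assoc]; exact hK x⟩

theorem exists_abs_momentumFlux_le (h : IsSimilarityFlow n γ lam B R w ε) :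
    ∃ K, ∀ x, |R x * w x ^ 2 + idealPressure γ (R x) (ε x)| ≤ K :=
  exists_abs_add_le h.exists_abs_kinetic_le h.exists_abs_p_le

theorem energy_eq (h : IsSimilarityFlow n γ lam B R w ε) (x : ℝ) : R x * (ε x + w x ^ 2 / 2)
    = 1 / (γ - 1) * idealPressure γ (R x) (ε x) + 1 / 2 * (R x * w x ^ 2) := by
  have : γ - 1 ≠ 0 := by linarith [h.one_lt_γ]
  rw [idealPressure]
  field_simp

theorem exists_abs_energy_le (h : IsSimilarityFlow n γ lam B R w ε) :
    ∃ K, ∀ x, |R x * (ε x + w x ^ 2 / 2)| ≤ K := by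
  simp only [h.energy_eq]
  exact exists_abs_add_le (exists_abs_mul_le ⟨_, fun _ => le_rfl⟩ h.exists_abs_p_le)
    (exists_abs_mul_le ⟨_, fun _ => le_rfl⟩ h.exists_abs_kinetic_le)

theorem exists_abs_energyFlux_le (h : IsSimilarityFlow n γ lam B R w ε) :
    ∃ K, ∀ x, |(R x * (ε x + w x ^ 2 / 2) + idealPressure γ (R x) (ε x)) * w x| ≤ K :=
  exists_abs_mul_le (exists_abs_add_le h.exists_abs_energy_le h.exists_abs_p_le) h.exists_abs_w_le

theorem exists_abs_kinetic_le_rpow (h : IsSimilarityFlow n γ lam B R w ε) :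
    ∃ K, ∀ x, x ≠ 0 → |R x * w x ^ 2| ≤ K * |x| ^ decayRate lam := by
  obtain ⟨K, hK⟩ := exists_abs_le_rpow_of_bounded h.exists_abs_momentum_le
    (h.exists_abs_w_le_rpow h.neg_one_lt_decayRate.le h.decayRate_neg.le)
  exact ⟨K, fun x hx => by rw [pow_two, ← mul_assoc]; exact hK x hx⟩

theorem exists_abs_add_le_rpow {f g : ℝ → ℝ} {p : ℝ}
    (hf : ∃ K, ∀ x, x ≠ 0 → |f x| ≤ K * |x| ^ p) (hg : ∃ K, ∀ x, x ≠ 0 → |g x| ≤ K * |x| ^ p) :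
    ∃ K, ∀ x, x ≠ 0 → |f x + g x| ≤ K * |x| ^ p := by
  obtain ⟨K, hK⟩ := hf
  obtain ⟨K', hK'⟩ := hg
  exact ⟨K + K', fun x hx => (abs_add_le _ _).trans
    ((add_le_add (hK x hx) (hK' x hx)).trans (by rw [add_mul]))⟩

theorem exists_abs_p_le_rpow (h : IsSimilarityFlow n γ lam B R w ε) :
    ∃ K, ∀ x, x ≠ 0 → |idealPressure γ (R x) (ε x)| ≤ K * |x| ^ decayRate lam := by
  obtain ⟨K, hK⟩ := h.p_le
  exact ⟨K, fun x => (hK x).2⟩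

theorem exists_abs_enthalpy_le_rpow (h : IsSimilarityFlow n γ lam B R w ε) :
    ∃ K, ∀ x, x ≠ 0 → |R x * (ε x + w x ^ 2 / 2) + idealPressure γ (R x) (ε x)|
      ≤ K * |x| ^ decayRate lam := by
  simp only [h.energy_eq]
  exact exists_abs_add_le_rpow (exists_abs_add_le_rpow
    (exists_abs_le_rpow_of_bounded ⟨_, fun _ => le_rfl⟩ h.exists_abs_p_le_rpow)
    (exists_abs_le_rpow_of_bounded ⟨_, fun _ => le_rfl⟩ h.exists_abs_kinetic_le_rpow))
    h.exists_abs_p_le_rpow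

theorem exists_abs_energyFlux_le_rpow (h : IsSimilarityFlow n γ lam B R w ε) :
    ∃ K, ∀ x, x ≠ 0 → |(R x * (ε x + w x ^ 2 / 2) + idealPressure γ (R x) (ε x)) * w x|
      ≤ K * |x| ^ (decayRate lam - 1) := by
  obtain ⟨K, hK⟩ := h.exists_abs_enthalpy_le_rpow
  obtain ⟨K', hK'⟩ := h.exists_abs_w_le_rpow le_rfl (by norm_num)
  refine ⟨K * K', fun x hx => ?_⟩
  have hx0 : 0 < |x| := abs_pos.2 hx
  rw [abs_mul, sub_eq_add_neg, Real.rpow_add hx0, mul_mul_mul_comm]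
  exact mul_le_mul (hK x hx) (hK' x hx) (abs_nonneg _) ((abs_nonneg _).trans (hK x hx))

theorem radialL1Loc_of_bounded {m : ℕ} {lam β : ℝ} {Q : ℝ → ℝ} (hQ : Measurable Q)
    (hb : ∃ K, ∀ x, |Q x| ≤ K) (hβ : -1 < β + m) :
    RadialL1Loc m (fun t r => r ^ β * Q (t / r ^ lam)) := by
  obtain ⟨K, hK⟩ := hb
  exact radialL1Loc_selfSimilar (K := K) (η := 0) hQ (fun x _ => by simpa using hK x) (by norm_num)
    (by simpa using hβ)

theorem measurable_p (h : IsSimilarityFlow n γ lam B R w ε) :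
    Measurable fun x => idealPressure γ (R x) (ε x) := by
  have := h.measurable_R
  have := h.measurable_ε
  unfold idealPressure
  fun_prop

theorem momentum_field (hf : IsSelfSimilarFields lam R w ε ρ u e) {t r : ℝ} (hr : 0 < r) :
    ρ t r * u t r = r ^ (1 - lam) * (R (t / r ^ lam) * w (t / r ^ lam)) := by
  rw [hf.density t r hr, hf.velocity t r hr]
  ring

theorem rpow_sq_velocity {r : ℝ} (hr : 0 < r) : (r ^ (1 - lam)) ^ 2 = r ^ (2 - 2 * lam) := by
  rw [← Real.rpow_natCast, ← Real.rpow_mul hr.le]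
  congr 1
  push_cast
  ring

theorem kinetic_field (hf : IsSelfSimilarFields lam R w ε ρ u e) {t r : ℝ} (hr : 0 < r) :
    ρ t r * u t r ^ 2 = r ^ (2 - 2 * lam) * (R (t / r ^ lam) * w (t / r ^ lam) ^ 2) := by
  rw [hf.density t r hr, hf.velocity t r hr, mul_pow, rpow_sq_velocity hr]
  ring

theorem pressure_field (hf : IsSelfSimilarFields lam R w ε ρ u e) {t r : ℝ} (hr : 0 < r) :
    idealPressure γ (ρ t r) (e t r)
      = r ^ (2 - 2 * lam) * idealPressure γ (R (t / r ^ lam)) (ε (t / r ^ lam)) := by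
  rw [hf.density t r hr, hf.energy t r hr, idealPressure, idealPressure]
  ring

theorem energy_field (hf : IsSelfSimilarFields lam R w ε ρ u e) {t r : ℝ} (hr : 0 < r) :
    ρ t r * (e t r + u t r ^ 2 / 2) = r ^ (2 - 2 * lam)
      * (R (t / r ^ lam) * (ε (t / r ^ lam) + w (t / r ^ lam) ^ 2 / 2)) := by
  rw [hf.density t r hr, hf.velocity t r hr, hf.energy t r hr, mul_pow, rpow_sq_velocity hr]
  ring

theorem energyFlux_field (hf : IsSelfSimilarFields lam R w ε ρ u e) {t r : ℝ} (hr : 0 < r) :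
    (ρ t r * (e t r + u t r ^ 2 / 2) + idealPressure γ (ρ t r) (e t r)) * u t r
      = r ^ (3 - 3 * lam) * ((R (t / r ^ lam) * (ε (t / r ^ lam) + w (t / r ^ lam) ^ 2 / 2)
        + idealPressure γ (R (t / r ^ lam)) (ε (t / r ^ lam))) * w (t / r ^ lam)) := by
  rw [energy_field hf hr, pressure_field hf hr, hf.velocity t r hr,
    show 3 - 3 * lam = (2 - 2 * lam) + (1 - lam) by ring, Real.rpow_add hr]
  ring

theorem loc_kinetic (h : IsSimilarityFlow n γ lam B R w ε)
    (hf : IsSelfSimilarFields lam R w ε ρ u e) :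
    RadialL1Loc (n - 1) (fun t r => ρ t r * u t r ^ 2) := by
  have := h.measurable_R
  have := h.measurable_w
  refine RadialL1Loc.congr (radialL1Loc_of_bounded (by fun_prop) h.exists_abs_kinetic_le ?_)
    fun t r hr => (kinetic_field hf hr).symm
  rw [h.cast_sub_one]
  linarith [h.lam_lt]

theorem loc_pressure (h : IsSimilarityFlow n γ lam B R w ε)
    (hf : IsSelfSimilarFields lam R w ε ρ u e) :
    RadialL1Loc (n - 1) (fun t r => idealPressure γ (ρ t r) (e t r)) := by
  refine RadialL1Loc.congr (radialL1Loc_of_bounded h.measurable_p h.exists_abs_p_le ?_)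
    fun t r hr => (pressure_field hf hr).symm
  rw [h.cast_sub_one]
  linarith [h.lam_lt]

/-- Boundedness of the profile would require λ < 1+n/3. Using the decay of w with exponent η =
-1+1/λ replaces the power r^(3-3λ) by r^(2-2λ), for which λ < 1+n/2 is enough. -/
theorem loc_energyFlux (h : IsSimilarityFlow n γ lam B R w ε)
    (hf : IsSelfSimilarFields lam R w ε ρ u e) :
    RadialL1Loc (n - 1) (fun t r =>
      (ρ t r * (e t r + u t r ^ 2 / 2) + idealPressure γ (ρ t r) (e t r)) * u t r) := by
  have := h.measurable_R
  have := h.measurable_w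
  have := h.measurable_ε
  have := h.measurable_p
  have hl := h.lam_pos
  have hη1 : -1 < -1 + 1 / lam := by
    have : 0 < 1 / lam := by positivity
    linarith
  have hη0 : -1 + 1 / lam ≤ 0 := by
    have : 1 / lam ≤ 1 := by
      rw [div_le_one hl]; exact h.one_lt_lam.le
    linarith
  obtain ⟨K, hK⟩ := exists_abs_le_rpow_of_bounded
    (exists_abs_add_le h.exists_abs_energy_le h.exists_abs_p_le)
    (h.exists_abs_w_le_rpow hη1.le hη0)
  refine RadialL1Loc.congr (radialL1Loc_selfSimilar (by fun_prop) hK hη1 ?_)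
    fun t r hr => (energyFlux_field hf hr).symm
  rw [h.cast_sub_one]
  have : lam * (-1 + 1 / lam) = 1 - lam := by field_simp; ring
  rw [this]
  linarith [h.lam_lt]

theorem cont_mass (h : IsSimilarityFlow n γ lam B R w ε)
    (hf : IsSelfSimilarFields lam R w ε ρ u e) : ContInRadialL1Loc (n - 1) ρ := by
  obtain ⟨K, hK⟩ := h.R_le
  refine ContInRadialL1Loc.congr (contInRadialL1Loc_selfSimilar (α := 0) h.lam_pos h.B_pos
    h.measurable_R h.continuousAt_R hK ?_) fun t r hr => ?_
  · rw [h.cast_sub_one]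
    linarith [h.two_le]
  · simp [hf.density t r hr]

theorem cont_momentum (h : IsSimilarityFlow n γ lam B R w ε)
    (hf : IsSelfSimilarFields lam R w ε ρ u e) :
    ContInRadialL1Loc (n - 1) (fun t r => ρ t r * u t r) := by
  obtain ⟨K, hK⟩ := h.exists_abs_momentum_le
  refine ContInRadialL1Loc.congr (contInRadialL1Loc_selfSimilar (α := 1 - lam) h.lam_pos h.B_pos
    (h.measurable_R.mul h.measurable_w)
    (fun x h1 h2 => (h.continuousAt_R x h1 h2).mul (h.continuousAt_w x h1 h2)) hK ?_)
    fun t r hr => (momentum_field hf hr).symm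
  rw [h.cast_sub_one]
  linarith [h.two_le, h.lam_lt]

theorem cont_energy (h : IsSimilarityFlow n γ lam B R w ε)
    (hf : IsSelfSimilarFields lam R w ε ρ u e) :
    ContInRadialL1Loc (n - 1) (fun t r => ρ t r * (e t r + u t r ^ 2 / 2)) := by
  obtain ⟨K, hK⟩ := h.exists_abs_energy_le
  refine ContInRadialL1Loc.congr (contInRadialL1Loc_selfSimilar (α := 2 - 2 * lam) h.lam_pos
    h.B_pos (h.measurable_R.mul (h.measurable_ε.add ((h.measurable_w.pow_const 2).div_const 2)))
    (fun x h1 h2 => (h.continuousAt_R x h1 h2).mul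
      ((h.continuousAt_ε x h1 h2).add (((h.continuousAt_w x h1 h2).pow 2).div_const 2))) hK ?_)
    fun t r hr => (energy_field hf hr).symm
  rw [h.cast_sub_one]
  linarith [h.two_le, h.lam_lt]

theorem isRadialWeakSolution (h : IsSimilarityFlow n γ lam B R w ε)
    (hf : IsSelfSimilarFields lam R w ε ρ u e) :
    IsRadialWeakSolution (n - 1) (idealPressure γ) ρ u e := by
  have mR := h.measurable_R
  have mw := h.measurable_w
  have mε := h.measurable_ε
  have mp := h.measurable_p
  have hl := h.lam_pos
  have hn := h.two_le
  have hl1 := h.lam_lt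
  have hl3 := h.lam_lt_three
  have hlone := h.one_lt_lam
  have hmem := ae_restrict_mem (μ := volume) isOpen_upperHalf.measurableSet
  refine ⟨?_, ?_, ?_, ?_, h.cont_mass hf, h.cont_momentum hf, h.cont_energy hf, h.loc_kinetic hf,
    h.loc_pressure hf, h.loc_energyFlux hf, fun ψ hψ => ?_, fun ψ hψ => ?_, fun ψ hψ => ?_⟩
  · refine AEMeasurable.congr (f := fun q : ℝ × ℝ => R (q.1 / q.2 ^ lam)) (by fun_prop) ?_
    filter_upwards [hmem] with q hq using (hf.density q.1 q.2 hq.2).symm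
  · refine AEMeasurable.congr (f := fun q : ℝ × ℝ => q.2 ^ (1 - lam) * w (q.1 / q.2 ^ lam))
      (by fun_prop) ?_
    filter_upwards [hmem] with q hq using (hf.velocity q.1 q.2 hq.2).symm
  · refine AEMeasurable.congr (f := fun q : ℝ × ℝ => q.2 ^ (2 - 2 * lam) * ε (q.1 / q.2 ^ lam))
      (by fun_prop) ?_
    filter_upwards [hmem] with q hq using (hf.energy q.1 q.2 hq.2).symm
  -- The two shock curves, where no sign of the density is known, are null.
  · have h1 := ae_fst_ne_comp_snd (volume.restrict (Ioi (0 : ℝ))) (g := fun r => -1 * r ^ lam)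
      (by fun_prop)
    have h2 := ae_fst_ne_comp_snd (volume.restrict (Ioi (0 : ℝ))) (g := fun r => B * r ^ lam)
      (by fun_prop)
    rw [← volume_restrict_upperHalf] at h1 h2
    filter_upwards [hmem, h1, h2] with q hq hq1 hq2
    have hr : 0 < q.2 := hq.2
    have hrl : q.2 ^ lam ≠ 0 := (Real.rpow_pos_of_pos hr _).ne'
    have hR : 0 < ρ q.1 q.2 := by
      rw [hf.density q.1 q.2 hr]
      exact h.R_pos _ (fun hc => hq1 ((div_eq_iff hrl).1 hc))
        (fun hc => hq2 ((div_eq_iff hrl).1 hc))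
    have hε : 0 ≤ e q.1 q.2 := by
      rw [hf.energy q.1 q.2 hr]
      have := h.ε_nonneg (q.1 / q.2 ^ lam)
      have := Real.rpow_pos_of_pos hr (2 - 2 * lam)
      positivity
    refine ⟨hR, hε, ?_⟩
    have : 0 < γ - 1 := by linarith [h.one_lt_γ]
    rw [idealPressure]
    positivity
  · obtain ⟨T, A, K, hb, -⟩ := hψ.exists_isBoundedTest
    -- Here 1+η = 0, so any s strictly between 0 and n/λ is admissible; the midpoint is taken.
    refine radialIntegralZero_of_balance (lam := lam) (α := 0) (Q := R) (Φ := fun x => R x * w x)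
      (S := fun _ => 0) (s := n / (2 * lam)) (η := -1) hb hl mR (mR.mul mw) measurable_const
      h.R_le h.exists_abs_momentum_le ⟨0, by simp⟩
      (exists_abs_le_rpow_of_bounded h.R_le (h.exists_abs_w_le_rpow le_rfl (by norm_num)))
      (by positivity) (by norm_num; positivity) ?_ ?_
      (radialL1Loc_of_bounded mR h.R_le ?_)
      (radialL1Loc_of_bounded (mR.mul mw) h.exists_abs_momentum_le ?_) (by simp) ?_
    · rw [h.cast_sub_one]
      field_simp
      linarith
    · have := h.mass
      convert this using 2 with x
      rw [h.cast_sub_one]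
      ring
    · rw [h.cast_sub_one]; linarith
    · rw [h.cast_sub_one]; linarith
    · intro t r hr
      rw [hb.deriv_fst t hr, hb.deriv_snd t hr, momentum_field hf hr, hf.density t r hr,
        balanceIntegrand, Real.rpow_zero, zero_add]
      ring
  · obtain ⟨T, A, K, hb, hz⟩ := hψ.1.exists_isBoundedTest
    have hz := hz hψ.2
    have hg : ∀ t r : ℝ, 0 < r → |ψ (t, r) / r| ≤ K := fun t r hr => by
      rw [abs_div, abs_of_pos hr, div_le_iff₀ hr]
      exact hz t r hr
    -- The source carries the power r^(1-2λ), one less than the pressure. The missing factor r is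
    -- supplied by ψ, which vanishes at r = 0, so that ψ/r is bounded.
    have hiS := IsBoundedTest.integrableOn_mul (g := fun t r => ψ (t, r) / r) hb.T_pos hb.A_pos
      (radialL1Loc_of_bounded (m := n - 1) (lam := lam) (β := 2 - 2 * lam)
        (Q := fun x => (n - 1) * idealPressure γ (R x) (ε x)) (mp.const_mul _)
        (exists_abs_mul_le ⟨_, fun _ => le_rfl⟩ h.exists_abs_p_le)
        (by rw [h.cast_sub_one]; linarith))
      (hb.contDiffOn.continuousOn.div continuousOn_snd fun q hq => ne_of_gt hq.2) hg
      (fun t r hr ho => by simp only [hb.eq_zero t r hr ho, zero_div])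
    -- λs is the midpoint of λ(1+η) = (3-λ)/2 and α+m+1 = n+1-λ. The order of these endpoints needs
    -- λ < 2n-1, which follows from λ < 1+n/2 and n ≥ 2.
    refine radialIntegralZero_of_balance (lam := lam) (α := 1 - lam) (Q := fun x => R x * w x)
      (Φ := fun x => R x * w x ^ 2 + idealPressure γ (R x) (ε x))
      (S := fun x => (n - 1) * idealPressure γ (R x) (ε x))
      (s := ((3 - lam) / 2 + (n + 1 - lam)) / (2 * lam)) (η := decayRate lam) hb hl
      (mR.mul mw) (by fun_prop) (mp.const_mul _) h.exists_abs_momentum_le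
      h.exists_abs_momentumFlux_le (exists_abs_mul_le ⟨_, fun _ => le_rfl⟩ h.exists_abs_p_le)
      (exists_abs_add_le_rpow h.exists_abs_kinetic_le_rpow h.exists_abs_p_le_rpow)
      ?_ ?_ ?_ ?_ (radialL1Loc_of_bounded (mR.mul mw) h.exists_abs_momentum_le ?_)
      (radialL1Loc_of_bounded (by fun_prop) h.exists_abs_momentumFlux_le ?_) ?_ ?_
    · apply div_nonneg _ (by positivity)
      linarith
    · refine lt_of_mul_lt_mul_left ?_ hl.le
      have e : lam * (((3 - lam) / 2 + (n + 1 - lam)) / (2 * lam))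
          = ((3 - lam) / 2 + (n + 1 - lam)) / 2 := by field_simp
      rw [e, mul_add, h.lam_mul_decayRate]
      linarith
    · have e : lam * (((3 - lam) / 2 + (n + 1 - lam)) / (2 * lam))
          = ((3 - lam) / 2 + (n + 1 - lam)) / 2 := by field_simp
      rw [e, h.cast_sub_one]
      linarith
    · have := h.momentum
      convert this using 2 with x
      rw [h.cast_sub_one]
      ring
    · rw [h.cast_sub_one]; linarith
    · rw [h.cast_sub_one]; linarith
    · refine hiS.congr_fun (fun q hq => ?_) isOpen_upperHalf.measurableSet
      have hr : 0 < q.2 := hq.2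
      simp only
      rw [show 2 - 2 * lam = (1 - lam - lam) + 1 by ring, Real.rpow_add_one hr.ne']
      field_simp
    · intro t r hr
      rw [hb.deriv_fst t hr, hb.deriv_snd t hr, momentum_field hf hr, kinetic_field hf hr,
        pressure_field hf hr, balanceIntegrand, h.cast_sub_one,
        show 1 - lam + 1 - lam = 2 - 2 * lam by ring,
        show 2 - 2 * lam = (1 - lam - lam) + 1 by ring, Real.rpow_add_one hr.ne']
      field_simp
      ring
  · obtain ⟨T, A, K, hb, -⟩ := hψ.exists_isBoundedTest
    have hflux := h.loc_energyFlux (ρ := fun t r => R (t / r ^ lam))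
      (u := fun t r => r ^ (1 - lam) * w (t / r ^ lam))
      (e := fun t r => r ^ (2 - 2 * lam) * ε (t / r ^ lam))
      ⟨fun _ _ _ => rfl, fun _ _ _ => rfl, fun _ _ _ => rfl⟩
    -- The extra factor w makes the flux decay with exponent η < -1, so s = 0 is allowed; the
    -- condition at r = 0 is then exactly λ < 1+n/2.
    refine radialIntegralZero_of_balance (lam := lam) (α := 2 - 2 * lam)
      (Q := fun x => R x * (ε x + w x ^ 2 / 2))
      (Φ := fun x => (R x * (ε x + w x ^ 2 / 2) + idealPressure γ (R x) (ε x)) * w x)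
      (S := fun _ => 0)
      (s := 0) (η := decayRate lam - 1) hb hl
      (by fun_prop) (by fun_prop) measurable_const h.exists_abs_energy_le
      h.exists_abs_energyFlux_le ⟨0, by simp⟩ h.exists_abs_energyFlux_le_rpow
      le_rfl (by linarith [h.decayRate_neg]) ?_ ?_
      (radialL1Loc_of_bounded (by fun_prop) h.exists_abs_energy_le ?_)
      (hflux.congr fun t r hr => ?_) (by simp) ?_
    · rw [h.cast_sub_one]; linarith
    · have := h.energy
      convert this using 2 with x
      rw [h.cast_sub_one]
      ring
    · rw [h.cast_sub_one]; linarith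
    · rw [energyFlux_field ⟨fun _ _ _ => rfl, fun _ _ _ => rfl, fun _ _ _ => rfl⟩ hr,
        show 2 - 2 * lam + 1 - lam = 3 - 3 * lam by ring]
    · intro t r hr
      rw [hb.deriv_fst t hr, hb.deriv_snd t hr, energy_field hf hr, ← energy_field hf hr,
        energyFlux_field hf hr, energy_field hf hr, balanceIntegrand,
        show 2 - 2 * lam + 1 - lam = 3 - 3 * lam by ring]
      ring

end IsSimilarityFlow

/-! ### Polar coordinates and spherical means -/

section Polar

/-- Integration in polar coordinates. -/
theorem integral_eq_integral_toSphere {E : Type*} [NormedAddCommGroup E] [NormedSpace ℝ E]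
    [FiniteDimensional ℝ E] [Nontrivial E] [MeasurableSpace E] [BorelSpace E] (μ : Measure E)
    [μ.IsAddHaarMeasure] {F : E → ℝ} (hF : Integrable F μ) :
    ∫ z, F z ∂μ = ∫ r in Ioi (0 : ℝ),
      r ^ (Module.finrank ℝ E - 1) * ∫ ω, F (r • ω.1) ∂μ.toSphere := by
  have hmp := μ.measurePreserving_homeomorphUnitSphereProd
  have hemb := (homeomorphUnitSphereProd E).measurableEmbedding
  set G : Metric.sphere (0 : E) 1 × Ioi (0 : ℝ) → ℝ := fun q => F (q.2.1 • q.1.1) with hG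
  have hGF : ∀ z : ({0}ᶜ : Set E), G (homeomorphUnitSphereProd E z) = F z := fun z => by
    rw [hG]
    have := congrArg Subtype.val ((homeomorphUnitSphereProd E).symm_apply_apply z)
    rw [homeomorphUnitSphereProd_symm_apply_coe] at this
    simp only [this]
  have hGi : Integrable G (μ.toSphere.prod (Measure.volumeIoiPow (Module.finrank ℝ E - 1))) := by
    rw [← hmp.integrable_comp_emb hemb]
    have h1 : IntegrableOn F ({0}ᶜ : Set E) μ := hF.integrableOn
    rw [integrableOn_iff_comap_subtypeVal (by measurability)] at h1
    exact h1.congr (ae_of_all _ fun z => (hGF z).symm)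
  calc ∫ z, F z ∂μ = ∫ z : ({0}ᶜ : Set E), F z ∂(μ.comap (↑)) := by
        rw [integral_subtype_comap (measurableSet_singleton _).compl F, restrict_compl_singleton]
    _ = ∫ q, G q ∂(μ.toSphere.prod (Measure.volumeIoiPow (Module.finrank ℝ E - 1))) := by
        rw [← hmp.integral_comp hemb]
        exact integral_congr_ae (ae_of_all _ fun z => (hGF z).symm)
    _ = ∫ r : Ioi (0 : ℝ), (∫ ω, F (r.1 • ω.1) ∂μ.toSphere)
          ∂(Measure.volumeIoiPow (Module.finrank ℝ E - 1)) :=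
        integral_prod_symm G hGi
    _ = _ := by
        simp only [Measure.volumeIoiPow, ENNReal.ofReal]
        rw [integral_withDensity_eq_integral_smul,
          integral_subtype_comap measurableSet_Ioi fun r : ℝ =>
            Real.toNNReal (r ^ (Module.finrank ℝ E - 1)) • ∫ ω, F (r • ω.1) ∂μ.toSphere]
        · refine setIntegral_congr_fun measurableSet_Ioi fun r hr => ?_
          rw [NNReal.smul_def, Real.coe_toNNReal _ (pow_nonneg (le_of_lt hr) _), smul_eq_mul]
        · exact (measurable_subtype_coe.pow_const _).real_toNNReal

variable {n : ℕ}

/-- The surface measure of the unit sphere. -/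
noncomputable abbrev sphereMeasure (n : ℕ) :
    Measure (Metric.sphere (0 : EuclideanSpace ℝ (Fin n)) 1) :=
  (volume : Measure (EuclideanSpace ℝ (Fin n))).toSphere

theorem integral_eq_integral_sphere [Nontrivial (EuclideanSpace ℝ (Fin n))]
    {F : EuclideanSpace ℝ (Fin n) → ℝ} (hF : Integrable F) :
    ∫ z, F z = ∫ r in Ioi (0 : ℝ), r ^ (n - 1) * ∫ ω, F (r • ω.1) ∂(sphereMeasure n) := by
  rw [integral_eq_integral_toSphere volume hF, finrank_euclideanSpace_fin]

/-- The weighted spherical mean `∫ a(ω) φ(t, r ω) dω`. -/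
noncomputable def sphericalMean (n : ℕ) (a : EuclideanSpace ℝ (Fin n) → ℝ)
    (φ : ℝ × EuclideanSpace ℝ (Fin n) → ℝ) (q : ℝ × ℝ) : ℝ :=
  ∫ ω, a ω.1 * φ (q.1, q.2 • ω.1) ∂(sphereMeasure n)

/-- The linear map `(t, r) ↦ (t, r z)`. -/
noncomputable def rayMap (z : EuclideanSpace ℝ (Fin n)) :
    ℝ × ℝ →L[ℝ] ℝ × EuclideanSpace ℝ (Fin n) :=
  (ContinuousLinearMap.id ℝ ℝ).prodMap (ContinuousLinearMap.toSpanSingleton ℝ z)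

theorem rayMap_apply (z : EuclideanSpace ℝ (Fin n)) (q : ℝ × ℝ) : rayMap z q = (q.1, q.2 • z) := rfl

theorem continuous_rayMap :
    Continuous (fun z : EuclideanSpace ℝ (Fin n) => rayMap z) := by
  rw [continuous_clm_apply]
  intro q
  simp only [rayMap_apply]
  fun_prop

theorem continuous_sphericalMean_deriv {a : EuclideanSpace ℝ (Fin n) → ℝ}
    {φ : ℝ × EuclideanSpace ℝ (Fin n) → ℝ} (ha : Continuous a) (hφ : ContDiff ℝ 1 φ) :
    Continuous fun p : (ℝ × ℝ) × Metric.sphere (0 : EuclideanSpace ℝ (Fin n)) 1 =>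
      a p.2.1 • (fderiv ℝ φ (rayMap p.2.1 p.1)).comp (rayMap p.2.1) := by
  have h1 : Continuous fun p : (ℝ × ℝ) × Metric.sphere (0 : EuclideanSpace ℝ (Fin n)) 1 =>
    rayMap p.2.1 := continuous_rayMap.comp (by fun_prop)
  have h2 := (hφ.continuous_fderiv one_ne_zero).comp (h1.clm_apply continuous_fst)
  exact (ha.comp (by fun_prop)).smul (h2.clm_comp h1)

theorem hasFDerivAt_sphericalMean {a : EuclideanSpace ℝ (Fin n) → ℝ}
    {φ : ℝ × EuclideanSpace ℝ (Fin n) → ℝ} (ha : Continuous a) (hφ : ContDiff ℝ 1 φ) (q : ℝ × ℝ) :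
    HasFDerivAt (sphericalMean n a φ)
      (∫ ω, a ω.1 • (fderiv ℝ φ (rayMap ω.1 q)).comp (rayMap ω.1) ∂(sphereMeasure n)) q := by
  have hcont := continuous_sphericalMean_deriv ha hφ
  have hcφ : ∀ x : ℝ × ℝ, Continuous fun ω : Metric.sphere (0 : EuclideanSpace ℝ (Fin n)) 1 =>
      a ω.1 * φ (x.1, x.2 • ω.1) := fun x =>
    (ha.comp continuous_subtype_val).mul (hφ.continuous.comp (by fun_prop))
  obtain ⟨K, hK⟩ := IsCompact.exists_bound_of_continuousOn ((isCompact_closedBall q 1).prod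
    (isCompact_univ (X := Metric.sphere (0 : EuclideanSpace ℝ (Fin n)) 1))) hcont.continuousOn
  refine hasFDerivAt_integral_of_dominated_of_fderiv_le (bound := fun _ => K)
    (s := Metric.closedBall q 1)
    (F' := fun x (ω : Metric.sphere (0 : EuclideanSpace ℝ (Fin n)) 1) =>
      a ω.1 • (fderiv ℝ φ (rayMap ω.1 x)).comp (rayMap ω.1))
    (Metric.closedBall_mem_nhds q one_pos) (Eventually.of_forall fun x => ?_) ?_ ?_ ?_ ?_ ?_
  · exact (hcφ x).aestronglyMeasurable
  · exact (hcφ q).integrable_of_hasCompactSupport (HasCompactSupport.of_compactSpace _)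
  · exact (hcont.comp (by fun_prop : Continuous fun ω => (q, ω))).aestronglyMeasurable
  · exact ae_of_all _ fun ω x hx => hK (x, ω) ⟨hx, mem_univ _⟩
  · exact integrable_const _
  · refine ae_of_all _ fun ω x _ => ?_
    have := ((hφ.differentiable one_ne_zero _).hasFDerivAt (x := rayMap ω.1 x)).comp x
      (rayMap ω.1).hasFDerivAt
    exact this.const_mul (a ω.1)

theorem integral_clm_sphere_apply {a : EuclideanSpace ℝ (Fin n) → ℝ}
    {φ : ℝ × EuclideanSpace ℝ (Fin n) → ℝ} (ha : Continuous a) (hφ : ContDiff ℝ 1 φ) (q v : ℝ × ℝ) :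
    (∫ ω, a ω.1 • (fderiv ℝ φ (rayMap ω.1 q)).comp (rayMap ω.1) ∂(sphereMeasure n)) v =
      ∫ ω, a ω.1 * fderiv ℝ φ (q.1, q.2 • ω.1) (v.1, v.2 • ω.1) ∂(sphereMeasure n) := by
  rw [ContinuousLinearMap.integral_apply]
  · rfl
  · exact ((continuous_sphericalMean_deriv ha hφ).comp
      (by fun_prop : Continuous fun ω => (q, ω))).integrable_of_hasCompactSupport
      (HasCompactSupport.of_compactSpace _)

theorem contDiff_sphericalMean {a : EuclideanSpace ℝ (Fin n) → ℝ}
    {φ : ℝ × EuclideanSpace ℝ (Fin n) → ℝ} (ha : Continuous a) (hφ : ContDiff ℝ 1 φ) :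
    ContDiff ℝ 1 (sphericalMean n a φ) := by
  rw [contDiff_one_iff_hasFDerivAt]
  refine ⟨_, ?_, hasFDerivAt_sphericalMean ha hφ⟩
  have := continuous_parametric_integral_of_continuous (μ := sphereMeasure n)
    (f := fun (q : ℝ × ℝ) (ω : Metric.sphere (0 : EuclideanSpace ℝ (Fin n)) 1) =>
      a ω.1 • (fderiv ℝ φ (rayMap ω.1 q)).comp (rayMap ω.1))
    (continuous_sphericalMean_deriv ha hφ) isCompact_univ
  simpa using this

theorem deriv_sphericalMean_fst {a : EuclideanSpace ℝ (Fin n) → ℝ}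
    {φ : ℝ × EuclideanSpace ℝ (Fin n) → ℝ} (ha : Continuous a) (hφ : ContDiff ℝ 1 φ) (t r : ℝ) :
    deriv (fun s => sphericalMean n a φ (s, r)) t =
      ∫ ω, a ω.1 * fderiv ℝ φ (t, r • ω.1) (1, 0) ∂(sphereMeasure n) := by
  have h := (hasFDerivAt_sphericalMean ha hφ (t, r)).comp_hasDerivAt t
    ((hasDerivAt_id t).prodMk (hasDerivAt_const t r))
  refine h.deriv.trans ?_
  rw [integral_clm_sphere_apply ha hφ]
  simp

theorem hasDerivAt_sphericalMean_snd {a : EuclideanSpace ℝ (Fin n) → ℝ}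
    {φ : ℝ × EuclideanSpace ℝ (Fin n) → ℝ} (ha : Continuous a) (hφ : ContDiff ℝ 1 φ) (t r : ℝ) :
    HasDerivAt (fun s => sphericalMean n a φ (t, s))
      (∫ ω, a ω.1 * fderiv ℝ φ (t, r • ω.1) (0, ω.1) ∂(sphereMeasure n)) r := by
  have h := (hasFDerivAt_sphericalMean ha hφ (t, r)).comp_hasDerivAt r
    ((hasDerivAt_const r t).prodMk (hasDerivAt_id r))
  refine h.congr_deriv ?_
  rw [integral_clm_sphere_apply ha hφ]
  simp

theorem isRadialTest_sphericalMean {a : EuclideanSpace ℝ (Fin n) → ℝ}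
    {φ : ℝ × EuclideanSpace ℝ (Fin n) → ℝ} (ha : Continuous a) (hφ : ContDiff ℝ 1 φ)
    (hc : HasCompactSupport φ) : IsRadialTest (sphericalMean n a φ) := by
  obtain ⟨K, hK⟩ := hc.isCompact.isBounded.subset_closedBall (0 : ℝ × EuclideanSpace ℝ (Fin n))
  refine ⟨(contDiff_sphericalMean ha hφ).contDiffOn, max K 1, max K 1, by positivity, by positivity,
    fun t r hr ho => ?_⟩
  rw [sphericalMean]
  refine (integral_congr_ae (ae_of_all _ fun ω => ?_)).trans (integral_zero _ _)
  have hω : ‖ω.1‖ = 1 := mem_sphere_zero_iff_norm.1 ω.2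
  have h0 : φ (t, r • ω.1) = 0 := by
    refine image_eq_zero_of_notMem_tsupport fun hm => ?_
    have := hK hm
    rw [mem_closedBall_zero_iff, Prod.norm_def, sup_le_iff, norm_smul, hω, mul_one,
      Real.norm_eq_abs, Real.norm_eq_abs, abs_of_nonneg hr] at this
    rcases ho with h | h
    · exact absurd (this.1.trans (le_max_left _ _)) h.not_ge
    · exact absurd (this.2.trans (le_max_left _ _)) h.not_ge
  simp only [h0, mul_zero]

end Polar

/-! ### The divergence of a radial field through spherical means -/

theorem hasFDerivAt_norm_of_ne_zero {E : Type*} [NormedAddCommGroup E] [InnerProductSpace ℝ E]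
    {z : E} (hz : z ≠ 0) : HasFDerivAt (fun z : E => ‖z‖) (‖z‖⁻¹ • innerSL ℝ z) z := by
  have h := (hasStrictFDerivAt_norm_sq z).hasFDerivAt.sqrt (by positivity)
  simp only [Real.sqrt_sq (norm_nonneg _)] at h
  refine h.congr_fderiv ?_
  ext y
  simp only [smul_apply, smul_eq_mul, nsmul_eq_mul, one_div, mul_inv, coe_innerSL_apply]
  push_cast
  ring

section Bump

variable {E : Type*} [NormedAddCommGroup E] [InnerProductSpace ℝ E] {g : ℝ → ℝ}

theorem eventuallyEq_zero_of_tsupport_subset_Ioi (hg : tsupport g ⊆ Ioi 0) : g =ᶠ[𝓝 0] 0 :=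
  notMem_tsupport_iff_eventuallyEq.1 fun h => lt_irrefl _ (mem_Ioi.1 (hg h))

theorem comp_norm_eventuallyEq_zero {E : Type*} [NormedAddCommGroup E] (hg : tsupport g ⊆ Ioi 0) :
    (fun z : E => g ‖z‖) =ᶠ[𝓝 0] 0 := by
  have : Tendsto (fun z : E => ‖z‖) (𝓝 0) (𝓝 0) := tendsto_norm_zero
  exact this.eventually (eventuallyEq_zero_of_tsupport_subset_Ioi hg)

theorem hasFDerivAt_comp_norm (hg : tsupport g ⊆ Ioi 0) (hd : Differentiable ℝ g) (z : E) :
    HasFDerivAt (fun z : E => g ‖z‖) (deriv g ‖z‖ • ‖z‖⁻¹ • innerSL ℝ z) z := by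
  rcases eq_or_ne z 0 with rfl | hz
  · rw [map_zero, smul_zero, smul_zero]
    exact (hasFDerivAt_const (0 : ℝ) (0 : E)).congr_of_eventuallyEq (comp_norm_eventuallyEq_zero hg)
  · exact (hd ‖z‖).hasDerivAt.comp_hasFDerivAt z (hasFDerivAt_norm_of_ne_zero hz)

theorem contDiff_comp_norm (hg : tsupport g ⊆ Ioi 0) (hd : ContDiff ℝ 1 g) :
    ContDiff ℝ 1 (fun z : E => g ‖z‖) := by
  refine contDiff_iff_contDiffAt.2 fun z => ?_
  rcases eq_or_ne z 0 with rfl | hz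
  · exact contDiffAt_const.congr_of_eventuallyEq (comp_norm_eventuallyEq_zero hg)
  · exact hd.contDiffAt.comp z (contDiffAt_norm ℝ hz)

theorem hasCompactSupport_comp_norm [FiniteDimensional ℝ E] (hg : HasCompactSupport g) :
    HasCompactSupport (fun z : E => g ‖z‖) := by
  obtain ⟨K, hK⟩ := hg.isCompact.isBounded.subset_closedBall (0 : ℝ)
  refine HasCompactSupport.intro (isCompact_closedBall (0 : E) K) fun z hz => ?_
  refine image_eq_zero_of_notMem_tsupport fun hm => hz ?_
  simpa using hK hm

end Bump

theorem setIntegral_mul_of_tsupport_subset_Ioi {g F : ℝ → ℝ} (hg : tsupport g ⊆ Ioi 0) :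
    ∫ r in Ioi (0 : ℝ), g r * F r = ∫ r, g r * F r := by
  refine setIntegral_eq_integral_of_forall_compl_eq_zero fun r hr => ?_
  rw [image_eq_zero_of_notMem_tsupport fun h => hr (hg h), zero_mul]

section Sphere

variable {n : ℕ}

theorem fderiv_slice_apply {E : Type*} [NormedAddCommGroup E] [NormedSpace ℝ E] {φ : ℝ × E → ℝ}
    (hφ : ContDiff ℝ 1 φ) (t : ℝ) (z v : E) :
    fderiv ℝ (fun y => φ (t, y)) z v = fderiv ℝ φ (t, z) (0, v) := by
  have h : HasFDerivAt (fun y => φ (t, y)) _ z :=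
    ((hφ.differentiable one_ne_zero (t, z)).hasFDerivAt).comp z
      ((hasFDerivAt_const t z).prodMk (hasFDerivAt_id z))
  rw [h.fderiv]
  simp

theorem deriv_slice {E : Type*} [NormedAddCommGroup E] [NormedSpace ℝ E] {φ : ℝ × E → ℝ}
    (hφ : ContDiff ℝ 1 φ) (t : ℝ) (z : E) :
    deriv (fun s => φ (s, z)) t = fderiv ℝ φ (t, z) (1, 0) := by
  have h : HasDerivAt (fun s => φ (s, z)) _ t :=
    ((hφ.differentiable one_ne_zero (t, z)).hasFDerivAt).comp_hasDerivAt t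
      ((hasDerivAt_id t).prodMk (hasDerivAt_const t z))
  exact h.deriv

theorem continuous_sphere_integral {φ : ℝ × EuclideanSpace ℝ (Fin n) → ℝ} (hφ : ContDiff ℝ 1 φ)
    (t : ℝ) (v : EuclideanSpace ℝ (Fin n)) :
    Continuous fun r : ℝ => ∫ ω, fderiv ℝ φ (t, r • ω.1) (0, v) ∂(sphereMeasure n) := by
  have := continuous_parametric_integral_of_continuous (μ := sphereMeasure n)
    (f := fun (r : ℝ) (ω : Metric.sphere (0 : EuclideanSpace ℝ (Fin n)) 1) =>
      fderiv ℝ φ (t, r • ω.1) (0, v))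
    (((hφ.continuous_fderiv one_ne_zero).comp (by fun_prop)).clm_apply continuous_const)
    isCompact_univ
  simpa using this

/-- The divergence theorem on spheres. -/
theorem sphere_integral_fderiv_single [Nontrivial (EuclideanSpace ℝ (Fin n))]
    {φ : ℝ × EuclideanSpace ℝ (Fin n) → ℝ} (hφ : ContDiff ℝ 1 φ) (t : ℝ) (i : Fin n) :
    ∀ᵐ r : ℝ, r ∈ Ioi (0 : ℝ) →
      ∫ ω, fderiv ℝ φ (t, r • ω.1) (0, EuclideanSpace.single i 1) ∂(sphereMeasure n) =
        deriv (fun s => sphericalMean n (fun z => z i) φ (t, s)) r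
          + ((n - 1 : ℕ) : ℝ) * sphericalMean n (fun z => z i) φ (t, r) / r := by
  have ha : Continuous fun z : EuclideanSpace ℝ (Fin n) => z i := by fun_prop
  set J : ℝ → ℝ := fun r =>
    ∫ ω, fderiv ℝ φ (t, r • ω.1) (0, EuclideanSpace.single i 1) ∂(sphereMeasure n) with hJ
  set P : ℝ → ℝ := fun r => sphericalMean n (fun z => z i) φ (t, r) with hP
  have hPd : ContDiff ℝ 1 P := (contDiff_sphericalMean ha hφ).comp (by fun_prop)
  have hJc : Continuous J := continuous_sphere_integral hφ t _
  set N : ℝ → ℝ := fun r => r ^ (n - 1) * P r with hN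
  have hNd : ContDiff ℝ 1 N := (contDiff_id.pow _).mul hPd
  have hNd' : ∀ r, HasDerivAt N
      (((n - 1 : ℕ) : ℝ) * r ^ (n - 1 - 1) * P r + r ^ (n - 1) * deriv P r) r := fun r =>
    (hasDerivAt_pow (n - 1) r).mul (hPd.differentiable one_ne_zero r).hasDerivAt
  -- Tested against smooth g compactly supported in (0,∞): integration by parts in ℝⁿ moves ∂_i from
  -- φ onto g(|z|), polar coordinates turn this into -∫ g'N dr, and a second integration by parts in
  -- r gives ∫ gN' dr.
  have key : ∀ᵐ r : ℝ, r ∈ Ioi (0 : ℝ) → r ^ (n - 1) * J r - deriv N r = 0 := by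
    refine isOpen_Ioi.ae_eq_zero_of_integral_contDiff_smul_eq_zero
      ((((by fun_prop : Continuous fun r : ℝ => r ^ (n - 1) * J r).sub
        (hNd.continuous_deriv le_rfl)).locallyIntegrable).locallyIntegrableOn _) ?_
    intro g hg hgc hgs
    have hg1 : ContDiff ℝ 1 g := hg.of_le (by exact_mod_cast le_top)
    set f : EuclideanSpace ℝ (Fin n) → ℝ := fun z => φ (t, z) with hf
    have hfd : ContDiff ℝ 1 f := hφ.comp (by fun_prop)
    have hff : ∀ z v, fderiv ℝ f z v = fderiv ℝ φ (t, z) (0, v) := fderiv_slice_apply hφ t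
    set v : EuclideanSpace ℝ (Fin n) := EuclideanSpace.single i 1 with hv
    set Γ : EuclideanSpace ℝ (Fin n) → ℝ := fun z => g ‖z‖ with hΓ
    have hΓd : ContDiff ℝ 1 Γ := contDiff_comp_norm hgs hg1
    have hΓc : HasCompactSupport Γ := hasCompactSupport_comp_norm hgc
    have cΓ' : Continuous fun z => fderiv ℝ Γ z v :=
      (hΓd.continuous_fderiv one_ne_zero).clm_apply continuous_const
    have cf' : Continuous fun z => fderiv ℝ f z v :=
      (hfd.continuous_fderiv one_ne_zero).clm_apply continuous_const
    have i1 : Integrable (fun z => Γ z * fderiv ℝ f z v) :=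
      (hΓd.continuous.mul cf').integrable_of_hasCompactSupport hΓc.mul_right
    have i2 : Integrable (fun z => fderiv ℝ Γ z v * f z) :=
      (cΓ'.mul hfd.continuous).integrable_of_hasCompactSupport (hΓc.fderiv_apply ℝ v).mul_right
    have i3 : Integrable (fun z => Γ z * f z) :=
      (hΓd.continuous.mul hfd.continuous).integrable_of_hasCompactSupport hΓc.mul_right
    have hibp := integral_mul_fderiv_eq_neg_fderiv_mul_of_integrable i2 i1 i3
      (fun z _ => hΓd.differentiable one_ne_zero z) (fun z _ => hfd.differentiable one_ne_zero z)
    rw [integral_eq_integral_sphere i1, integral_eq_integral_sphere i2] at hibp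
    have e1 : ∫ r in Ioi (0 : ℝ), r ^ (n - 1) * ∫ ω, Γ (r • ω.1) * fderiv ℝ f (r • ω.1) v
        ∂(sphereMeasure n) = ∫ r, g r * (r ^ (n - 1) * J r) := by
      rw [← setIntegral_mul_of_tsupport_subset_Ioi hgs]
      refine setIntegral_congr_fun measurableSet_Ioi fun r hr => ?_
      have : ∀ ω : Metric.sphere (0 : EuclideanSpace ℝ (Fin n)) 1, Γ (r • ω.1) = g r := fun ω => by
        rw [hΓ]
        simp only [norm_smul, mem_sphere_zero_iff_norm.1 ω.2, mul_one, Real.norm_of_nonneg hr.le]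
      simp only [this, hff, integral_const_mul, hJ]
      ring
    have e2 : ∫ r in Ioi (0 : ℝ), r ^ (n - 1) * ∫ ω, fderiv ℝ Γ (r • ω.1) v * f (r • ω.1)
        ∂(sphereMeasure n) = ∫ r, deriv g r * N r := by
      rw [← setIntegral_mul_of_tsupport_subset_Ioi ((tsupport_deriv_subset (f := g)).trans hgs)]
      refine setIntegral_congr_fun measurableSet_Ioi fun r hr => ?_
      -- At z = rω the i-th derivative of g(|z|) is g'(r) ω_i, which is where the weight of the
      -- spherical mean comes from.
      have : ∀ ω : Metric.sphere (0 : EuclideanSpace ℝ (Fin n)) 1,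
          fderiv ℝ Γ (r • ω.1) v * f (r • ω.1) = deriv g r * (ω.1 i * φ (t, r • ω.1)) := fun ω => by
        have hr0 : r ≠ 0 := (mem_Ioi.1 hr).ne'
        rw [hΓ, (hasFDerivAt_comp_norm hgs (hg1.differentiable one_ne_zero) _).fderiv]
        simp only [norm_smul, mem_sphere_zero_iff_norm.1 ω.2, mul_one,
          Real.norm_of_nonneg (le_of_lt hr), smul_apply, coe_innerSL_apply, smul_eq_mul,
          inner_smul_left, hv, EuclideanSpace.inner_single_right, hf]
        simp
        field_simp
      simp only [this, integral_const_mul, hN, hP, sphericalMean]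
      ring
    rw [e1, e2] at hibp
    have hN' : ∀ r, HasDerivAt N (deriv N r) r := fun r =>
      (hNd.differentiable one_ne_zero r).hasDerivAt
    have cN' : Continuous (deriv N) := hNd.continuous_deriv le_rfl
    have cg' : Continuous (deriv g) := hg1.continuous_deriv le_rfl
    have j1 : Integrable (g * deriv N) :=
      (hg1.continuous.mul cN').integrable_of_hasCompactSupport hgc.mul_right
    have hibp2 := integral_mul_deriv_eq_deriv_mul_of_integrable
      (fun r _ => (hg1.differentiable one_ne_zero r).hasDerivAt) (fun r _ => hN' r) j1
      ((cg'.mul hNd.continuous).integrable_of_hasCompactSupport hgc.deriv.mul_right)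
      ((hg1.continuous.mul hNd.continuous).integrable_of_hasCompactSupport hgc.mul_right)
    have j2 : Integrable fun r => g r * (r ^ (n - 1) * J r) :=
      (hg1.continuous.mul (by fun_prop)).integrable_of_hasCompactSupport hgc.mul_right
    simp only [smul_eq_mul, mul_sub]
    refine (integral_sub j2 j1).trans ?_
    simp only [Pi.mul_apply]
    rw [hibp, ← hibp2]
    exact sub_self _
  filter_upwards [key] with r hr hr0
  have h1 := hr hr0
  have hr' : (0 : ℝ) < r := hr0
  rw [(hNd' r).deriv] at h1
  have h2 : r ^ (n - 1) * J r = r ^ (n - 1) * (deriv P r + ((n - 1 : ℕ) : ℝ) * P r / r) := by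
    -- The exponent `n - 1 - 1` is truncated when n-1 = 0, but then its coefficient vanishes.
    rcases Nat.eq_zero_or_pos (n - 1) with h0 | h0
    · simp only [h0] at h1 ⊢
      simpa [sub_eq_zero] using h1
    · obtain ⟨k, hk⟩ := Nat.exists_eq_succ_of_ne_zero h0.ne'
      rw [hk] at h1 ⊢
      simp only [Nat.succ_sub_one] at h1
      rw [sub_eq_zero.1 h1, pow_succ]
      field_simp
      ring
  exact mul_left_cancel₀ (pow_pos hr' _).ne' h2

/-- The coordinates have mean zero on the unit sphere. -/
theorem integral_coord_sphere_eq_zero [Nontrivial (EuclideanSpace ℝ (Fin n))] (i : Fin n)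
    (hn : 2 ≤ n) :
    ∫ ω, ω.1 i ∂(sphereMeasure n) = 0 := by
  -- For φ = 1 all derivatives drop out and the identity reads 0 = (n-1)/r times the mean of ω_i, at
  -- almost every r > 0.
  have h := sphere_integral_fderiv_single (φ := fun _ => (1 : ℝ)) contDiff_const 0 i
  have h2 : ∀ᵐ r ∂(volume.restrict (Ioi (0 : ℝ))), _ :=
    (ae_restrict_iff' measurableSet_Ioi).2 h
  have : NeZero (volume.restrict (Ioi (0 : ℝ))) := ⟨by
    rw [Ne, Measure.restrict_eq_zero]; simp⟩
  obtain ⟨r, hr, hr0⟩ := (h2.and (ae_restrict_mem measurableSet_Ioi)).exists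
  have hr' : r ≠ 0 := (mem_Ioi.1 hr0).ne'
  have hn' : ((n - 1 : ℕ) : ℝ) ≠ 0 := by
    norm_cast; omega
  simp only [sphericalMean, fderiv_fun_const, Pi.zero_apply, zero_apply, integral_zero, mul_one,
    deriv_const', zero_add] at hr
  have := (div_eq_zero_iff.1 hr.symm).resolve_right hr'
  exact (mul_eq_zero.1 this).resolve_left hn'

theorem isRadialTestZero_sphericalMean_coord [Nontrivial (EuclideanSpace ℝ (Fin n))] (hn : 2 ≤ n)
    {φ : ℝ × EuclideanSpace ℝ (Fin n) → ℝ} (hφ : ContDiff ℝ 1 φ) (hc : HasCompactSupport φ)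
    (i : Fin n) : IsRadialTestZero (sphericalMean n (fun z => z i) φ) := by
  refine ⟨isRadialTest_sphericalMean (by fun_prop) hφ hc, fun t => ?_⟩
  simp only [sphericalMean, zero_smul, integral_mul_const, integral_coord_sphere_eq_zero i hn,
    zero_mul]

end Sphere

/-! ### From radial to multi-dimensional integrability -/

section RadialLift

variable {n : ℕ} [Nontrivial (EuclideanSpace ℝ (Fin n))]

/-- In polar coordinates, the volume of {z : |z| ∈ s} is a multiple of the integral of r^(n-1) over
s ∩ (0,∞). -/
theorem absolutelyContinuous_map_norm :
    (volume : Measure (EuclideanSpace ℝ (Fin n))).map (fun z => ‖z‖) ≪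
      volume.restrict (Ioi (0 : ℝ)) := by
  refine Measure.AbsolutelyContinuous.mk fun s hs h0 => ?_
  rw [Measure.map_apply measurable_norm hs]
  set f : ℝ → ℝ := s.indicator 1
  have hf0 : f =ᵐ[volume.restrict (Ioi (0 : ℝ))] 0 := indicator_ae_eq_zero.2
    (measure_mono_null inter_subset_left h0)
  have hy : (fun y : ℝ => y ^ (Module.finrank ℝ (EuclideanSpace ℝ (Fin n)) - 1) • f y)
      =ᵐ[volume.restrict (Ioi (0 : ℝ))] 0 := by
    filter_upwards [hf0] with y hy
    rw [hy, Pi.zero_apply, smul_zero]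
  have hi : Integrable (fun z : EuclideanSpace ℝ (Fin n) => f ‖z‖) := by
    rw [integrable_fun_norm_addHaar]
    exact (integrable_zero _ _ _).congr hy.symm
  have h2 : ∫ z : EuclideanSpace ℝ (Fin n), f ‖z‖ = 0 := by
    rw [integral_fun_norm_addHaar, integral_congr_ae hy]
    simp
  have h3 := (integral_eq_zero_iff_of_nonneg
    (fun z => indicator_nonneg (fun _ _ => zero_le_one) _) hi).1 h2
  refine measure_mono_null (fun z hz => ?_) (ae_iff.1 h3)
  have : ‖z‖ ∈ s := hz
  simp [this]

theorem quasiMeasurePreserving_prod_norm : Measure.QuasiMeasurePreserving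
    (fun q : ℝ × EuclideanSpace ℝ (Fin n) => (q.1, ‖q.2‖)) volume
    (volume.restrict (univ ×ˢ Ioi (0 : ℝ))) := by
  refine ⟨by fun_prop, ?_⟩
  rw [volume_restrict_upperHalf]
  have h := Measure.map_prod_map (volume : Measure ℝ) (volume : Measure (EuclideanSpace ℝ (Fin n)))
    measurable_id measurable_norm
  have h2 : (volume : Measure (ℝ × EuclideanSpace ℝ (Fin n))).map
      (fun q : ℝ × EuclideanSpace ℝ (Fin n) => (q.1, ‖q.2‖)) = _ := h.symm
  rw [h2, Measure.map_id]
  exact Measure.AbsolutelyContinuous.rfl.prod absolutelyContinuous_map_norm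

theorem ae_snd_ne_zero : ∀ᵐ q : ℝ × EuclideanSpace ℝ (Fin n), q.2 ≠ 0 := by
  refine (quasiMeasurePreserving_prod_norm.ae (ae_restrict_mem isOpen_upperHalf.measurableSet)).mono
    fun q hq => norm_pos_iff.1 hq.2

theorem integrable_slice_norm_iff {f : ℝ → ℝ} :
    Integrable (fun z : EuclideanSpace ℝ (Fin n) => f ‖z‖) ↔
      IntegrableOn (fun r => f r * r ^ (n - 1)) (Ioi 0) := by
  rw [integrable_fun_norm_addHaar, finrank_euclideanSpace_fin]
  simp only [smul_eq_mul, mul_comm]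

theorem integral_slice_norm (f : ℝ → ℝ) : ∫ z : EuclideanSpace ℝ (Fin n), f ‖z‖ =
    (n * (volume : Measure (EuclideanSpace ℝ (Fin n))).real (Metric.ball 0 1)) *
      ∫ r in Ioi (0 : ℝ), f r * r ^ (n - 1) := by
  rw [integral_fun_norm_addHaar, finrank_euclideanSpace_fin]
  simp only [smul_eq_mul, nsmul_eq_mul, mul_comm (f _), mul_assoc]

/-- Tonelli in t and polar coordinates on each slice. Measurability of `f` itself is recovered by
dividing out r^(n-1). -/
theorem integrable_comp_prod_norm {f : ℝ × ℝ → ℝ}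
    (hf : IntegrableOn (fun q : ℝ × ℝ => f q * q.2 ^ (n - 1)) (univ ×ˢ Ioi (0 : ℝ))) :
    Integrable (fun q : ℝ × EuclideanSpace ℝ (Fin n) => f (q.1, ‖q.2‖)) := by
  have hm : AEStronglyMeasurable f (volume.restrict (univ ×ˢ Ioi (0 : ℝ))) := by
    have h1 : AEStronglyMeasurable (fun q : ℝ × ℝ => (q.2 ^ (n - 1))⁻¹)
        (volume.restrict (univ ×ˢ Ioi (0 : ℝ))) :=
      (measurable_snd.pow_const _).inv.aestronglyMeasurable
    refine (hf.aestronglyMeasurable.mul h1).congr ?_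
    filter_upwards [ae_restrict_mem isOpen_upperHalf.measurableSet] with q hq
    exact mul_inv_cancel_right₀ (pow_pos (mem_Ioi.1 hq.2) _).ne' _
  have hm2 : AEStronglyMeasurable (fun q : ℝ × EuclideanSpace ℝ (Fin n) => f (q.1, ‖q.2‖)) :=
    hm.comp_quasiMeasurePreserving quasiMeasurePreserving_prod_norm
  rw [IntegrableOn, volume_restrict_upperHalf] at hf
  refine (integrable_prod_iff hm2).2 ⟨?_, ?_⟩
  · filter_upwards [hf.prod_right_ae] with t ht
    exact integrable_slice_norm_iff.2 ht
  · have h1 := hf.norm.integral_prod_left.const_mul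
      (n * (volume : Measure (EuclideanSpace ℝ (Fin n))).real (Metric.ball 0 1))
    refine h1.congr (ae_of_all _ fun t => ?_)
    simp only
    rw [integral_slice_norm (fun r => ‖f (t, r)‖)]
    congr 1
    refine setIntegral_congr_fun measurableSet_Ioi fun r hr => ?_
    simp only [norm_mul, norm_pow, Real.norm_of_nonneg (le_of_lt (mem_Ioi.1 hr))]

/-- A cutoff to a box in (t,r) reduces to global integrability; the box omits r = 0, which
corresponds to a null set. -/
theorem RadialL1Loc.locallyIntegrable {f : ℝ → ℝ → ℝ} (hf : RadialL1Loc (n - 1) f) :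
    LocallyIntegrable (fun q : ℝ × EuclideanSpace ℝ (Fin n) => f q.1 ‖q.2‖) := by
  refine locallyIntegrable_iff.2 fun K hK => ?_
  obtain ⟨A, hA⟩ := hK.isBounded.subset_closedBall (0 : ℝ × EuclideanSpace ℝ (Fin n))
  set A' := max A 1
  have hA' : 0 < A' := by positivity
  set s : Set (ℝ × ℝ) := Icc (-A') A' ×ˢ Ioc 0 A' with hs
  have hsm : MeasurableSet s := measurableSet_Icc.prod measurableSet_Ioc
  have h1 : Integrable (s.indicator fun q : ℝ × ℝ => f q.1 q.2 * q.2 ^ (n - 1)) :=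
    (integrable_indicator_iff hsm).2 (hf A' A' hA' hA')
  have h2 := integrable_comp_prod_norm (n := n) (f := s.indicator fun q => f q.1 q.2)
    (h1.integrableOn.congr (ae_of_all _ fun q => by
      by_cases hq : q ∈ s <;> simp [hq]))
  refine h2.integrableOn.congr ?_
  filter_upwards [ae_restrict_mem hK.measurableSet, ae_restrict_of_ae ae_snd_ne_zero] with q hq hq0
  have hqA := hA hq
  rw [mem_closedBall_zero_iff, Prod.norm_def, sup_le_iff] at hqA
  have : (q.1, ‖q.2‖) ∈ s := ⟨abs_le.1 (hqA.1.trans (le_max_left _ _)), norm_pos_iff.2 hq0,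
    hqA.2.trans (le_max_left _ _)⟩
  rw [indicator_of_mem this]

/-- The norms of the time slices depend continuously on t by the reverse triangle inequality, hence
are integrable over compact time intervals. -/
theorem ContInRadialL1Loc.radialL1Loc {m : ℕ} {g : ℝ → ℝ → ℝ} (hg : ContInRadialL1Loc m g)
    (hm : AEMeasurable (fun q : ℝ × ℝ => g q.1 q.2) (volume.restrict (univ ×ˢ Ioi (0 : ℝ)))) :
    RadialL1Loc m g := by
  intro T A hT hA
  have hm2 : AEStronglyMeasurable (fun q : ℝ × ℝ => g q.1 q.2 * q.2 ^ m)
      (volume.restrict (Icc (-T) T ×ˢ Ioc 0 A)) :=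
    ((hm.mono_measure (Measure.restrict_mono (Set.prod_mono (subset_univ _) Ioc_subset_Ioi_self)
      le_rfl)).mul (measurable_snd.pow_const _).aemeasurable).aestronglyMeasurable
  rw [IntegrableOn]
  rw [volume_restrict_prod] at hm2 ⊢
  refine (integrable_prod_iff hm2).2 ⟨ae_of_all _ fun t => (hg A hA).1 t, ?_⟩
  refine ContinuousOn.integrableOn_compact isCompact_Icc (Continuous.continuousOn ?_)
  refine continuous_iff_continuousAt.2 fun t₀ => ?_
  rw [ContinuousAt, tendsto_iff_norm_sub_tendsto_zero]
  refine squeeze_zero (fun _ => norm_nonneg _) (fun t => ?_) ((hg A hA).2 t₀)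
  have i1 := (hg A hA).1 t
  have i2 := (hg A hA).1 t₀
  rw [← integral_sub i1.norm i2.norm]
  refine (norm_integral_le_integral_norm _).trans ?_
  have i3 : IntegrableOn (fun r => |g t r - g t₀ r| * r ^ m) (Ioc 0 A) := by
    refine IntegrableOn.congr_fun (i1.sub i2).norm (fun r hr => ?_) measurableSet_Ioc
    simp only [Pi.sub_apply]
    rw [← sub_mul, norm_mul, norm_pow, Real.norm_of_nonneg hr.1.le, Real.norm_eq_abs]
  refine setIntegral_mono_on (i1.norm.sub i2.norm).norm i3 measurableSet_Ioc fun r hr => ?_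
  refine (abs_norm_sub_norm_le _ _).trans_eq ?_
  rw [← sub_mul, norm_mul, norm_pow, Real.norm_of_nonneg hr.1.le, Real.norm_eq_abs]

/-- Radial fields `f(t, |z|) v(z)`, with `|v| = 1`, inherit continuity in time from `f`. -/
theorem ContInRadialL1Loc.contInL1Loc {F : Type} [NormedAddCommGroup F] [NormedSpace ℝ F]
    {g : ℝ → ℝ → ℝ} (hg : ContInRadialL1Loc (n - 1) g) {f : ℝ → EuclideanSpace ℝ (Fin n) → F}
    {v : EuclideanSpace ℝ (Fin n) → F} (hv : AEStronglyMeasurable v)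
    (hv1 : ∀ z, z ≠ 0 → ‖v z‖ = 1) (hf : ∀ t z, z ≠ 0 → f t z = g t ‖z‖ • v z) :
    ContInL1Loc f := by
  intro K hK
  obtain ⟨A, hA⟩ := hK.isBounded.subset_closedBall (0 : EuclideanSpace ℝ (Fin n))
  set A' := max A 1
  have hA' : 0 < A' := by positivity
  obtain ⟨hi, hc⟩ := hg A' hA'
  have hne : ∀ᵐ z : EuclideanSpace ℝ (Fin n), z ≠ 0 := by
    simp [ae_iff]
  have hind : ∀ (k : ℝ → ℝ), (Ioi (0 : ℝ)).indicator
      (fun r => (Ioc 0 A').indicator k r * r ^ (n - 1)) =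
      (Ioc 0 A').indicator fun r => k r * r ^ (n - 1) := fun k => by
    ext r
    by_cases hr : r ∈ Ioc 0 A'
    · simp [hr, hr.1]
    · by_cases hr0 : r ∈ Ioi (0 : ℝ) <;> simp [hr, hr0]
  have lift : ∀ k : ℝ → ℝ, IntegrableOn (fun r => k r * r ^ (n - 1)) (Ioc 0 A') →
      Integrable (fun z : EuclideanSpace ℝ (Fin n) => (Ioc 0 A').indicator k ‖z‖) := fun k hk => by
    rw [integrable_slice_norm_iff, ← integrable_indicator_iff measurableSet_Ioi, hind]
    exact (integrable_indicator_iff measurableSet_Ioc).2 hk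
  have hmem : ∀ z ∈ K, z ≠ 0 → ‖z‖ ∈ Ioc 0 A' := fun z hz hz0 =>
    ⟨norm_pos_iff.2 hz0, (mem_closedBall_zero_iff.1 (hA hz)).trans (le_max_left _ _)⟩
  have hfi : ∀ t, IntegrableOn (f t) K := fun t => by
    refine (((lift _ (hi t)).smul_bdd 1 hv ?_).integrableOn (s := K)).congr ?_
    · filter_upwards [hne] with z hz using (hv1 z hz).le
    · filter_upwards [ae_restrict_mem hK.measurableSet, ae_restrict_of_ae hne] with z hz hz0
      rw [Pi.smul_apply', indicator_of_mem (hmem z hz hz0), hf t z hz0]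
  refine ⟨hfi, fun t₀ => ?_⟩
  have hd : ∀ t, IntegrableOn (fun r => |g t r - g t₀ r| * r ^ (n - 1)) (Ioc 0 A') := fun t => by
    refine IntegrableOn.congr_fun ((hi t).sub (hi t₀)).norm (fun r hr => ?_) measurableSet_Ioc
    simp only [Pi.sub_apply]
    rw [← sub_mul, norm_mul, norm_pow, Real.norm_of_nonneg hr.1.le, Real.norm_eq_abs]
  have hz := (hc t₀).const_mul (n * (volume : Measure (EuclideanSpace ℝ (Fin n))).real
    (Metric.ball 0 1))
  rw [mul_zero] at hz
  refine squeeze_zero (fun t => integral_nonneg fun _ => norm_nonneg _) (fun t => ?_) hz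
  rw [← integral_indicator measurableSet_Ioc, ← hind, integral_indicator measurableSet_Ioi,
    ← integral_slice_norm]
  have hnn : ∀ r, 0 ≤ (Ioc 0 A').indicator (fun r => |g t r - g t₀ r|) r := fun r =>
    indicator_nonneg (fun _ _ => abs_nonneg _) _
  refine le_trans (integral_mono_ae ((hfi t).sub (hfi t₀)).norm (lift _ (hd t)).integrableOn ?_)
    (setIntegral_le_integral (lift _ (hd t)) (ae_of_all _ fun z => hnn _))
  filter_upwards [ae_restrict_mem hK.measurableSet, ae_restrict_of_ae hne] with z hz hz0
  rw [indicator_of_mem (hmem z hz hz0), hf t z hz0, hf t₀ z hz0, ← sub_smul,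
    norm_smul, hv1 z hz0, mul_one, Real.norm_eq_abs]

end RadialLift

/-! ### Radial weak solutions are weak solutions of the multi-dimensional system -/

section Lift

variable {n : ℕ}

/-- The radial unit vector, with value `0` at the origin. -/
noncomputable def radialUnit (z : EuclideanSpace ℝ (Fin n)) : EuclideanSpace ℝ (Fin n) := ‖z‖⁻¹ • z

theorem measurable_radialUnit :
    Measurable (radialUnit : EuclideanSpace ℝ (Fin n) → EuclideanSpace ℝ (Fin n)) :=
  measurable_norm.inv.smul measurable_id

theorem norm_radialUnit {z : EuclideanSpace ℝ (Fin n)} (hz : z ≠ 0) : ‖radialUnit z‖ = 1 := by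
  rw [radialUnit, norm_smul, norm_inv, norm_norm, inv_mul_cancel₀ (norm_ne_zero_iff.2 hz)]

theorem norm_radialUnit_le (z : EuclideanSpace ℝ (Fin n)) : ‖radialUnit z‖ ≤ 1 := by
  rcases eq_or_ne z 0 with rfl | hz
  · simp [radialUnit]
  · exact (norm_radialUnit hz).le

theorem radialVector_eq (f : ℝ → ℝ → ℝ) (t : ℝ) (z : EuclideanSpace ℝ (Fin n)) :
    radialVector n f t z = f t ‖z‖ • radialUnit z := by
  rw [radialVector, radialUnit, smul_smul, div_eq_mul_inv]

theorem norm_radialVector (f : ℝ → ℝ → ℝ) (t : ℝ) {z : EuclideanSpace ℝ (Fin n)} (hz : z ≠ 0) :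
    ‖radialVector n f t z‖ = |f t ‖z‖| := by
  rw [radialVector_eq, norm_smul, norm_radialUnit hz, mul_one, Real.norm_eq_abs]

theorem sq_norm_radialVector (f : ℝ → ℝ → ℝ) (t : ℝ) {z : EuclideanSpace ℝ (Fin n)} (hz : z ≠ 0) :
    ‖radialVector n f t z‖ ^ 2 = f t ‖z‖ ^ 2 := by
  rw [norm_radialVector f t hz, sq_abs]

theorem radialUnit_smul_sphere {r : ℝ} (hr : 0 < r)
    (ω : Metric.sphere (0 : EuclideanSpace ℝ (Fin n)) 1) : radialUnit (r • ω.1) = ω.1 := by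
  rw [radialUnit, norm_smul, mem_sphere_zero_iff_norm.1 ω.2, mul_one, Real.norm_of_nonneg hr.le,
    smul_smul, inv_mul_cancel₀ hr.ne', one_smul]

theorem norm_smul_sphere {r : ℝ} (hr : 0 < r)
    (ω : Metric.sphere (0 : EuclideanSpace ℝ (Fin n)) 1) : ‖r • ω.1‖ = r := by
  rw [norm_smul, mem_sphere_zero_iff_norm.1 ω.2, mul_one, Real.norm_of_nonneg hr.le]

/-- Pairing of a locally integrable function with the derivative of a test function in a bounded
direction. -/
theorem integrable_mul_fderiv_apply {f : ℝ × EuclideanSpace ℝ (Fin n) → ℝ}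
    (hf : LocallyIntegrable f) {φ : ℝ × EuclideanSpace ℝ (Fin n) → ℝ} (hφ : ContDiff ℝ 1 φ)
    (hc : HasCompactSupport φ)
    {W : ℝ × EuclideanSpace ℝ (Fin n) → ℝ × EuclideanSpace ℝ (Fin n)} (hW : Measurable W)
    (hW1 : ∀ q, ‖W q‖ ≤ 1) : Integrable fun q => f q * fderiv ℝ φ q (W q) := by
  have hcd : Continuous (fderiv ℝ φ) := hφ.continuous_fderiv one_ne_zero
  have h1 : Integrable fun q => ‖fderiv ℝ φ q‖ • f q :=
    hf.integrable_smul_left_of_hasCompactSupport hcd.norm (hc.fderiv (𝕜 := ℝ)).norm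
  refine h1.mono (hf.aestronglyMeasurable.mul ?_) (ae_of_all _ fun q => ?_)
  · exact (isBoundedBilinearMap_apply (𝕜 := ℝ) (E := ℝ × EuclideanSpace ℝ (Fin n))
      (F := ℝ)).continuous.comp_aestronglyMeasurable
      (hcd.aestronglyMeasurable.prodMk hW.aestronglyMeasurable)
  · rw [norm_mul, norm_smul, norm_norm, mul_comm]
    gcongr
    exact ((fderiv ℝ φ q).le_opNorm _).trans
      (mul_le_of_le_one_right (norm_nonneg _) (hW1 q))

theorem LocallyIntegrable.smul_of_norm_le_one {X F : Type*} [TopologicalSpace X]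
    [MeasurableSpace X] [NormedAddCommGroup F] [NormedSpace ℝ F] {μ : Measure X} {f : X → ℝ}
    (hf : LocallyIntegrable f μ) {v : X → F} (hv : AEStronglyMeasurable v μ)
    (hv1 : ∀ x, ‖v x‖ ≤ 1) : LocallyIntegrable (fun x => f x • v x) μ := fun x => by
  obtain ⟨s, hs, hi⟩ := hf x
  exact ⟨s, hs, Integrable.smul_bdd hi 1 hv.restrict (ae_of_all _ hv1)⟩

theorem clm_apply_zero_smul {E : Type*} [NormedAddCommGroup E] [NormedSpace ℝ E]
    (L : ℝ × E →L[ℝ] ℝ) (c : ℝ) (v : E) : L (0, c • v) = c * L (0, v) := by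
  rw [← smul_eq_mul, ← map_smul, Prod.smul_mk, smul_zero]

theorem integrable_sphere_fderiv {a : EuclideanSpace ℝ (Fin n) → ℝ} (ha : Continuous a)
    {φ : ℝ × EuclideanSpace ℝ (Fin n) → ℝ} (hφ : ContDiff ℝ 1 φ) (t r : ℝ)
    {v : EuclideanSpace ℝ (Fin n) → ℝ × EuclideanSpace ℝ (Fin n)} (hv : Continuous v) :
    Integrable (fun ω => a ω.1 * fderiv ℝ φ (t, r • ω.1) (v ω.1)) (sphereMeasure n) :=
  Continuous.integrable_of_hasCompactSupport
    ((ha.comp continuous_subtype_val).mul (((hφ.continuous_fderiv one_ne_zero).comp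
      (by fun_prop)).clm_apply (hv.comp continuous_subtype_val)))
    (HasCompactSupport.of_compactSpace _)

/-- Polar coordinates in each time slice. Agreement at almost every radius is all that is asked,
because the divergence theorem on spheres is available only in that form. -/
theorem integral_radial_polar [Nontrivial (EuclideanSpace ℝ (Fin n))]
    {F : ℝ → EuclideanSpace ℝ (Fin n) → ℝ} {f : ℝ → ℝ → ℝ}
    (hF : Integrable fun q : ℝ × EuclideanSpace ℝ (Fin n) => F q.1 q.2)
    (hf : RadialIntegralZero (n - 1) f)
    (h : ∀ t, ∀ᵐ r : ℝ, r ∈ Ioi (0 : ℝ) → ∫ ω, F t (r • ω.1) ∂(sphereMeasure n) = f t r) :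
    IntegralZero F := by
  refine ⟨hF, Eq.trans ?_ hf.2⟩
  refine integral_congr_ae ?_
  filter_upwards [hF.prod_right_ae] with t ht
  rw [integral_eq_integral_sphere ht]
  refine setIntegral_congr_ae measurableSet_Ioi ((h t).mono fun r hr hr0 => ?_)
  rw [hr hr0, mul_comm]

/-- On a sphere the fields are constant up to the direction ω, so integrating over ω leaves the
radial integrand with ψ a spherical mean of φ: unweighted for mass and energy, weighted by ω_i for
the i-th momentum component. -/
theorem IsRadialWeakSolution.isWeakSolution (hn : 2 ≤ n) {p ρ u e : ℝ → ℝ → ℝ}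
    (h : IsRadialWeakSolution (n - 1) p ρ u e) :
    IsWeakSolution n p (radialScalar n ρ) (radialVector n u) (radialScalar n e) := by
  have : Nontrivial (EuclideanSpace ℝ (Fin n)) :=
    Module.nontrivial_of_finrank_pos (R := ℝ) (by rw [finrank_euclideanSpace_fin]; omega)
  have hqmp := quasiMeasurePreserving_prod_norm (n := n)
  have hne := ae_snd_ne_zero (n := n)
  have Lρ := (h.cont_mass.radialL1Loc h.meas_density).locallyIntegrable
  have Lm := (h.cont_momentum.radialL1Loc (h.meas_density.mul h.meas_velocity)).locallyIntegrable
  have Le := (h.cont_energy.radialL1Loc (h.meas_density.mul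
    (h.meas_energy.add ((h.meas_velocity.pow_const 2).div_const 2)))).locallyIntegrable
  have Lk := h.loc_kinetic.locallyIntegrable
  have Lp := h.loc_pressure.locallyIntegrable
  have Lf := h.loc_energyFlux.locallyIntegrable
  have Wt : ∀ q : ℝ × EuclideanSpace ℝ (Fin n), ‖((1 : ℝ), (0 : EuclideanSpace ℝ (Fin n)))‖ ≤ 1 :=
    fun q => by simp [Prod.norm_def]
  have Wr : ∀ q : ℝ × EuclideanSpace ℝ (Fin n), ‖((0 : ℝ), radialUnit q.2)‖ ≤ 1 := fun q => by
    simpa [Prod.norm_def] using norm_radialUnit_le q.2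
  have mWr : Measurable fun q : ℝ × EuclideanSpace ℝ (Fin n) => ((0 : ℝ), radialUnit q.2) :=
    measurable_const.prodMk (measurable_radialUnit.comp measurable_snd)
  refine ⟨?_, ?_, ?_, ?_, ?_, ?_, ?_, ?_, ?_, ?_, ?_, ?_, ?_⟩
  · exact h.meas_density.comp_quasiMeasurePreserving hqmp
  · simp only [radialVector_eq]
    exact (h.meas_velocity.comp_quasiMeasurePreserving hqmp).smul
      (measurable_radialUnit.comp measurable_snd).aemeasurable
  · exact h.meas_energy.comp_quasiMeasurePreserving hqmp
  · exact hqmp.ae h.pos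
  · exact h.cont_mass.contInL1Loc (v := fun _ => (1 : ℝ)) aestronglyMeasurable_const
      (fun _ _ => norm_one) fun t z _ => by simp [radialScalar]
  · refine h.cont_momentum.contInL1Loc (v := radialUnit)
      measurable_radialUnit.aestronglyMeasurable (fun _ => norm_radialUnit) fun t z _ => ?_
    rw [radialVector_eq, radialScalar, smul_smul]
  · refine h.cont_energy.contInL1Loc (v := fun _ => (1 : ℝ)) aestronglyMeasurable_const
      (fun _ _ => norm_one) fun t z hz => ?_
    rw [sq_norm_radialVector u t hz, smul_eq_mul, mul_one, radialScalar, radialScalar]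
  · refine Lk.congr ?_
    filter_upwards [hne] with q hq
    rw [sq_norm_radialVector u _ hq, radialScalar]
  · exact Lp
  · refine (LocallyIntegrable.smul_of_norm_le_one Lf (v := fun q => radialUnit q.2)
      (measurable_radialUnit.comp measurable_snd).aestronglyMeasurable
      fun q => norm_radialUnit_le q.2).congr ?_
    filter_upwards [hne] with q hq
    rw [sq_norm_radialVector u _ hq, radialVector_eq, smul_smul, radialScalar, radialScalar]
  · intro φ hφ hc
    have hψ := isRadialTest_sphericalMean (a := fun _ => 1) continuous_const hφ hc
    have i1 := integrable_mul_fderiv_apply Lρ hφ hc measurable_const Wt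
    have i2 := integrable_mul_fderiv_apply Lm hφ hc mWr Wr
    simp only [deriv_slice hφ, fderiv_slice_apply hφ, radialVector_eq, radialScalar,
      clm_apply_zero_smul]
    refine integral_radial_polar ?_ (h.mass _ hψ) fun t => ae_of_all _ fun r hr => ?_
    · refine (i1.add i2).congr (ae_of_all _ fun q => ?_)
      simp only [Pi.add_apply]
      ring
    · have j1 := integrable_sphere_fderiv (a := fun _ => 1) continuous_const hφ t r continuous_const
        (v := fun _ => (1, 0))
      have j2 := integrable_sphere_fderiv (a := fun _ => 1) continuous_const hφ t r
        (v := fun ω => (0, ω)) (by fun_prop)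
      simp only [norm_smul_sphere hr, radialUnit_smul_sphere hr]
      rw [deriv_sphericalMean_fst continuous_const hφ,
        (hasDerivAt_sphericalMean_snd continuous_const hφ t r).deriv, ← integral_const_mul,
        ← integral_const_mul, ← integral_add (j1.const_mul _) (j2.const_mul _)]
      exact integral_congr_ae (ae_of_all _ fun ω => by ring)
  · intro i φ hφ hc
    have ha : Continuous fun z : EuclideanSpace ℝ (Fin n) => z i := by fun_prop
    have hψ := isRadialTestZero_sphericalMean_coord hn hφ hc i
    have hu : ∀ z : EuclideanSpace ℝ (Fin n), |radialUnit z i| ≤ 1 := fun z =>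
      (PiLp.norm_apply_le (radialUnit z) i).trans (norm_radialUnit_le z)
    have mu : Measurable fun q : ℝ × EuclideanSpace ℝ (Fin n) => radialUnit q.2 i :=
      ha.measurable.comp (measurable_radialUnit.comp measurable_snd)
    have i1 := integrable_mul_fderiv_apply Lm hφ hc
      (W := fun q => radialUnit q.2 i • ((1 : ℝ), (0 : EuclideanSpace ℝ (Fin n))))
      (mu.smul measurable_const) fun q => by
        rw [norm_smul]
        exact mul_le_one₀ (hu q.2) (norm_nonneg _) (Wt q)
    have i2 := integrable_mul_fderiv_apply Lk hφ hc
      (W := fun q => radialUnit q.2 i • ((0 : ℝ), radialUnit q.2)) (mu.smul mWr) fun q => by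
        rw [norm_smul]
        exact mul_le_one₀ (hu q.2) (norm_nonneg _) (Wr q)
    have i3 := integrable_mul_fderiv_apply Lp hφ hc
      (W := fun _ => ((0 : ℝ), EuclideanSpace.single i (1 : ℝ))) measurable_const fun q => by
        simp [Prod.norm_def]
    simp only [deriv_slice hφ, fderiv_slice_apply hφ, radialVector_eq, radialScalar,
      clm_apply_zero_smul, PiLp.smul_apply, smul_eq_mul]
    simp only [map_smul, smul_eq_mul] at i1 i2
    refine integral_radial_polar ?_ (h.momentum _ hψ) fun t => ?_
    · refine ((i1.add i2).add i3).congr (ae_of_all _ fun q => ?_)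
      simp only [Pi.add_apply]
      ring
    · filter_upwards [sphere_integral_fderiv_single hφ t i] with r hr hr0
      have j1 := integrable_sphere_fderiv ha hφ t r continuous_const (v := fun _ => (1, 0))
      have j2 := integrable_sphere_fderiv ha hφ t r (v := fun ω => (0, ω)) (by fun_prop)
      have j3 := integrable_sphere_fderiv (a := fun _ => 1) continuous_const hφ t r
        (v := fun _ => (0, EuclideanSpace.single i 1)) continuous_const
      simp only [one_mul] at j3
      -- The pressure term (∂_r + m/r)ψ becomes the sphere integral of ∂_iφ.
      rw [← hr hr0]
      simp only [norm_smul_sphere hr0, radialUnit_smul_sphere hr0]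
      rw [deriv_sphericalMean_fst ha hφ, (hasDerivAt_sphericalMean_snd ha hφ t r).deriv,
        ← integral_const_mul, ← integral_const_mul, ← integral_const_mul,
        ← integral_add (j1.const_mul _) (j2.const_mul _),
        ← integral_add ((j1.const_mul _).fun_add (j2.const_mul _)) (j3.const_mul _)]
      exact integral_congr_ae (ae_of_all _ fun ω => by ring)
  · intro φ hφ hc
    have hψ := isRadialTest_sphericalMean (a := fun _ => 1) continuous_const hφ hc
    have i1 := integrable_mul_fderiv_apply Le hφ hc measurable_const Wt
    have i2 := integrable_mul_fderiv_apply Lf hφ hc mWr Wr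
    refine integral_radial_polar ?_ (h.energy _ hψ) fun t => ae_of_all _ fun r hr => ?_
    · refine (i1.add i2).congr ?_
      filter_upwards [hne] with q hq
      rw [sq_norm_radialVector u _ hq, deriv_slice hφ, fderiv_slice_apply hφ, radialVector_eq,
        clm_apply_zero_smul]
      simp only [Pi.add_apply, radialScalar]
      ring
    · have j1 := integrable_sphere_fderiv (a := fun _ => 1) continuous_const hφ t r continuous_const
        (v := fun _ => (1, 0))
      have j2 := integrable_sphere_fderiv (a := fun _ => 1) continuous_const hφ t r
        (v := fun ω => (0, ω)) (by fun_prop)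
      rw [deriv_sphericalMean_fst continuous_const hφ,
        (hasDerivAt_sphericalMean_snd continuous_const hφ t r).deriv, ← integral_const_mul,
        ← integral_const_mul, ← integral_add (j1.const_mul _) (j2.const_mul _)]
      refine integral_congr_ae (ae_of_all _ fun ω => ?_)
      have hz : r • ω.1 ≠ 0 := norm_pos_iff.1 (by rw [norm_smul_sphere hr]; exact hr)
      simp only [sq_norm_radialVector u _ hz]
      simp only [deriv_slice hφ, fderiv_slice_apply hφ,
        radialVector_eq, radialScalar, clm_apply_zero_smul, norm_smul_sphere hr,
        radialUnit_smul_sphere hr]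
      ring

end Lift

/-! ### Amplitude blowup -/

section Blowup

variable {n : ℕ}

/-- Any neighbourhood of the origin contains some (0,z), z ≠ 0, at which f exceeds M. By continuity
f exceeds M on a neighbourhood of that point, which has positive measure. -/
theorem blowsUpAtCollapse_of_continuousAt [Nontrivial (EuclideanSpace ℝ (Fin n))]
    {f : ℝ → EuclideanSpace ℝ (Fin n) → ℝ} (h0 : Tendsto (f 0) (𝓝[≠] 0) atTop)
    (hc : ∀ z, z ≠ 0 →
      ContinuousAt (fun q : ℝ × EuclideanSpace ℝ (Fin n) => f q.1 q.2) (0, z)) :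
    BlowsUpAtCollapse f := by
  refine ⟨h0, fun U hU M => ?_⟩
  have hU2 : ∀ᶠ z in 𝓝 (0 : EuclideanSpace ℝ (Fin n)), U ∈ 𝓝 ((0 : ℝ), z) :=
    ((by fun_prop : Continuous fun z : EuclideanSpace ℝ (Fin n) => ((0 : ℝ), z)).tendsto
      0).eventually (eventually_mem_nhds_iff.2 hU)
  obtain ⟨z, ⟨hz1, hz2⟩, hz3⟩ := (((hU2.filter_mono nhdsWithin_le_nhds).and
    (h0.eventually_gt_atTop M)).and self_mem_nhdsWithin).exists
  exact Measure.measure_pos_of_mem_nhds _ (inter_mem hz1 ((hc z hz3).eventually_const_lt hz2))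

theorem blowsUpAtCollapse_selfSimilar [Nontrivial (EuclideanSpace ℝ (Fin n))]
    {f : ℝ → EuclideanSpace ℝ (Fin n) → ℝ} {Q : ℝ → ℝ} {lam β : ℝ} (hβ : β < 0)
    (hQ : ContinuousAt Q 0) (hQ0 : 0 < Q 0)
    (hf : ∀ t z, z ≠ 0 → f t z = ‖z‖ ^ β * Q (t / ‖z‖ ^ lam)) : BlowsUpAtCollapse f := by
  refine blowsUpAtCollapse_of_continuousAt ?_ fun z hz => ?_
  · refine (((tendsto_rpow_neg_nhdsGT_zero hβ).comp
      tendsto_norm_nhdsNE_zero).atTop_mul_const hQ0).congr' ?_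
    filter_upwards [self_mem_nhdsWithin] with z hz
    rw [hf 0 z hz, zero_div, Function.comp_apply]
  · have hz0 : ‖z‖ ≠ 0 := norm_ne_zero_iff.2 hz
    have hne : ∀ᶠ q : ℝ × EuclideanSpace ℝ (Fin n) in 𝓝 (0, z), q.2 ≠ 0 :=
      continuous_snd.continuousAt.eventually_ne hz
    have hn : ContinuousAt (fun q : ℝ × EuclideanSpace ℝ (Fin n) => ‖q.2‖) (0, z) := by fun_prop
    refine ContinuousAt.congr ?_ (hne.mono fun q hq => (hf q.1 q.2 hq).symm)
    refine (hn.rpow_const (Or.inl hz0)).mul (ContinuousAt.comp' (f := fun q : ℝ ×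
      EuclideanSpace ℝ (Fin n) => q.1 / ‖q.2‖ ^ lam) ?_ (continuousAt_fst.div
        (hn.rpow_const (Or.inl hz0)) (Real.rpow_pos_of_pos (norm_pos_iff.2 hz) _).ne'))
    simpa using hQ

end Blowup

namespace IsSimilarityFlow

variable {n : ℕ} {γ lam B : ℝ} {R w ε : ℝ → ℝ} {ρ u e : ℝ → ℝ → ℝ}

theorem isWeakSolution (h : IsSimilarityFlow n γ lam B R w ε)
    (hf : IsSelfSimilarFields lam R w ε ρ u e) :
    IsWeakSolution n (idealPressure γ) (radialScalar n ρ) (radialVector n u) (radialScalar n e) :=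
  (h.isRadialWeakSolution hf).isWeakSolution (by exact_mod_cast h.two_le)

theorem nontrivial_space (h : IsSimilarityFlow n γ lam B R w ε) :
    Nontrivial (EuclideanSpace ℝ (Fin n)) :=
  Module.nontrivial_of_finrank_pos (R := ℝ) (by
    rw [finrank_euclideanSpace_fin]
    rcases h.dim with rfl | rfl <;> norm_num)

theorem blowsUp_velocity (h : IsSimilarityFlow n γ lam B R w ε)
    (hf : IsSelfSimilarFields lam R w ε ρ u e) :
    BlowsUpAtCollapse (fun t (z : EuclideanSpace ℝ (Fin n)) => ‖radialVector n u t z‖) := by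
  have := h.nontrivial_space
  refine blowsUpAtCollapse_selfSimilar (Q := fun x => |w x|) (lam := lam) (β := 1 - lam)
    (by linarith [h.one_lt_lam]) (h.continuousAt_w 0 (by norm_num) h.B_pos.ne).abs
    (abs_pos.2 h.w_zero) fun t z hz => ?_
  rw [norm_radialVector u t hz, hf.velocity _ _ (norm_pos_iff.2 hz), abs_mul,
    abs_of_pos (Real.rpow_pos_of_pos (norm_pos_iff.2 hz) _)]

theorem blowsUp_energy (h : IsSimilarityFlow n γ lam B R w ε)
    (hf : IsSelfSimilarFields lam R w ε ρ u e) : BlowsUpAtCollapse (radialScalar n e) := by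
  have := h.nontrivial_space
  exact blowsUpAtCollapse_selfSimilar (β := 2 - 2 * lam) (by linarith [h.one_lt_lam])
    (h.continuousAt_ε 0 (by norm_num) h.B_pos.ne) h.ε_zero
    fun t z hz => hf.energy t ‖z‖ (norm_pos_iff.2 hz)

theorem blowsUp_pressure (h : IsSimilarityFlow n γ lam B R w ε)
    (hf : IsSelfSimilarFields lam R w ε ρ u e) :
    BlowsUpAtCollapse (fun t (z : EuclideanSpace ℝ (Fin n)) =>
      idealPressure γ (radialScalar n ρ t z) (radialScalar n e t z)) := by
  have := h.nontrivial_space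
  refine blowsUpAtCollapse_selfSimilar (Q := fun x => idealPressure γ (R x) (ε x))
    (β := 2 - 2 * lam) (by linarith [h.one_lt_lam]) ?_ ?_
    fun t z hz => pressure_field hf (norm_pos_iff.2 hz)
  · exact (continuousAt_const.mul (h.continuousAt_R 0 (by norm_num) h.B_pos.ne)).mul
      (h.continuousAt_ε 0 (by norm_num) h.B_pos.ne)
  · exact mul_pos (mul_pos (by linarith [h.one_lt_γ]) (h.R_pos 0 (by norm_num) h.B_pos.ne)) h.ε_zero

end IsSimilarityFlow

theorem isSelfSimilarFields_sim {γ lam : ℝ} {R V C : ℝ → ℝ} {ℓ L : ℝ} :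
    IsSelfSimilarFields lam R (speedProfile lam V ℓ)
      (fun x => speedProfile lam C L x ^ 2 / (γ * (γ - 1)))
      (simDensity lam R) (simSpeed lam V ℓ) (simEnergy γ lam C L) where
  density _ _ _ := rfl
  velocity t r _ := simSpeed_eq lam V ℓ t r
  energy t r hr := by
    rw [simEnergy, simSpeed_eq, mul_pow, IsSimilarityFlow.rpow_sq_velocity hr, mul_div_assoc]

theorem mainTheorem1 (n : ℕ) (hn : n = 2 ∨ n = 3) (γ lam B : ℝ) (hγ : 1 < γ)
    (hlam₁ : 1 < lam) (hlam₂ : lam < 1 + (n : ℝ) / 2) (R V C : ℝ → ℝ)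
    (hsol : IsCompleteSimilarityShock n γ lam B R V C) (ℓ L : ℝ)
    (hP1 : ∃ a b : ℝ, 0 < a ∧ ∀ x : ℝ, a ≤ 1 + V x ∧ 1 + V x ≤ b)
    (hP2V : Tendsto (fun x => V x / x) (𝓝[≠] 0) (𝓝 ℓ)) (hℓ : 0 < ℓ)
    (hP2C : Tendsto (fun x => C x / x) (𝓝[≠] 0) (𝓝 L)) (hL : L < 0)
    (hP3V : Tendsto V atTop (𝓝 (-(2 * (lam - 1) / (n * γ)))))
    (hP3C : Tendsto C atTop atBot) :
    IsRadialWeakSolution (n - 1) (idealPressure γ)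
      (simDensity lam R) (simSpeed lam V ℓ) (simEnergy γ lam C L) ∧
    IsWeakSolution n (idealPressure γ)
      (radialScalar n (simDensity lam R)) (radialVector n (simSpeed lam V ℓ))
      (radialScalar n (simEnergy γ lam C L)) ∧
    BlowsUpAtCollapse (fun t (z : EuclideanSpace ℝ (Fin n)) =>
      ‖radialVector n (simSpeed lam V ℓ) t z‖) ∧
    BlowsUpAtCollapse (radialScalar n (simEnergy γ lam C L)) ∧
    BlowsUpAtCollapse (fun t (z : EuclideanSpace ℝ (Fin n)) =>
      idealPressure γ (radialScalar n (simDensity lam R) t z)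
        (radialScalar n (simEnergy γ lam C L) t z)) := by
  have h := (IsSimilarityShockFlow.mk hn hγ hlam₁ hlam₂ hsol hP1 hP2V hℓ hP2C hL hP3V
    hP3C).isSimilarityFlow
  have hf := isSelfSimilarFields_sim (γ := γ) (lam := lam) (R := R) (V := V) (C := C) (ℓ := ℓ)
    (L := L)
  exact ⟨h.isRadialWeakSolution hf, h.isWeakSolution hf, h.blowsUp_velocity hf,
    h.blowsUp_energy hf, h.blowsUp_pressure hf⟩
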